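/- Let $B=\begin{pmatrix}0&1\\1&0\end{pmatrix}$, let $P$ be a complex $2\times2$ matrix function with entries in $C^1[0,\infty)$, and let $Q$ be a complex $2\times 2$ matrix with $QB+BQ=B$ and $Q^2=Q$. For $\lambda\in\mathbb C$ let $\varphi(x,\lambda)$ and $\widetilde\varphi(x,\lambda)$ be the $2\times2$ matrix solutions of $$B\varphi'+P(x)\varphi=\lambda\varphi\quad(0<x<\infty),\qquad \varphi(0)=Q,$$ $$-\widetilde\varphi'B+\widetilde\varphi P(x)=\lambda\widetilde\varphi\quad(0<x<\infty),\qquad \widetilde\varphi(0)=Q,$$ where $'=d/dx$. Let $\mathbb K^2(0,\infty)$ be the set of functions in $L^2(0,\infty)$ that vanish beyond some point $\sigma>0$. For $2\times 2$ matrix functions $f,g$ with entries in $\mathbb K^2(0,\infty)$ put $$\Phi_f(\rho)=\int_0^\infty f(x)\varphi(x,i\rho)\,dx,\qquad \widetilde\Phi_g(\rho)=\int_0^\infty\widetilde\varphi(x,i\rho)g(x)\,dx .$$ Let $Z$ be the space of entire functions $e$ with $|e(\rho)|\le C\exp(\sigma|\operatorname{Im}\rho|)$ for some $C,\sigma>0$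 depending on $e$ that are integrable on the real line. The type of $e$ is $\limsup_{r\to\infty}r^{-1}\ln\max_{|\rho|=r}|e(\rho)|$, and $e_n\to e$ in $Z$ means that $\int_{-\infty}^\infty|e_n(\rho)-e(\rho)|\,d\rho\to0$ and the types of the $e_n$ are bounded. Let $Z'$ be the space of linear functionals on $Z$ that are continuous for this convergence. For a matrix $D=(D_{kl})$ with $D_{kl}\in Z'$ and matrix functions $A,C$ all of whose products $A_{ik}C_{lj}$ belong to $Z$, write $\int_{-\infty}^\infty A(\rho)D(\rho)C(\rho)\,d\rho$ for the matrix with entries $\sum_{k,l}\langle D_{kl},A_{ik}C_{lj}\rangle$. Then there is a $2\times2$ matrix $D=(D_{kl})$ with $D_{kl}\in Z'$ and $D=QDQ$ such that the following hold. (i) For all $f,g$ with entries in $\mathbb K^2(0,\infty)$, the products of the entries of $\Phi_f$ and $\widetilde\Phi_g$ belong to $Z$ and $$\int_0^\infty f(x)g(x)\,dx=\int_{-\infty}^\infty\Phi_f(\rho)D(\rho)\widetilde\Phi_g(\rho)\,d\rho .$$ The equality extends to all $f,g$ with entries in $L^2(0,\infty)$, the right-hand side being understood as the limit of $\int_{-\infty}^\infty\Phi_{f_n}D\,\widetilde\Phi_{g_n}\,d\rho$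 for arbitrary $f_n,g_n$ with entries in $\mathbb K^2(0,\infty)$ such that $f_n\to f$ and $g_n\to g$ in $L^2(0,\infty)$. (ii) For every $f$ with entries in $\mathbb K^2(0,\infty)$ such that all entries of $\Phi_f$ and $\widetilde\Phi_f$ belong to $Z$, for almost every $x>0$, $$f(x)=\int_{-\infty}^\infty\Phi_f(\rho)D(\rho)\widetilde\varphi(x,i\rho)\,d\rho=\int_{-\infty}^\infty\varphi(x,i\rho)D(\rho)\widetilde\Phi_f(\rho)\,d\rho ,$$ where all products of entries involved belong to $Z$. -/

import Mathlib

open MeasureTheory Filter Topology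

noncomputable section

namespace SpectralFn

/-- Complex `2 × 2` matrices. -/
abbrev M2 : Type := Matrix (Fin 2) (Fin 2) ℂ

/-- The coefficient matrix `B` of the differential operator `B d/dx + P`. -/
def B : M2 := !![0, 1; 1, 0]

/-! ### The space of test functions and its dual -/

/-- Functions of exponential type: entire functions with `|e(ρ)| ≤ C exp(σ |Im ρ|)`. -/
def IsExpType (e : ℂ → ℂ) : Prop :=
  Differentiable ℂ e ∧
    ∃ C > (0 : ℝ), ∃ σ > (0 : ℝ), ∀ ρ : ℂ, ‖e ρ‖ ≤ C * Real.exp (σ * |ρ.im|)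

/-- The type `limsup_{r → ∞} r⁻¹ ln (max_{|ρ| = r} |e(ρ)|)` of an entire function
(with the convention `ln 0 = -∞`). -/
def expType (e : ℂ → ℂ) : EReal :=
  limsup (fun r : ℝ => ENNReal.log (⨆ ρ ∈ Metric.sphere (0 : ℂ) r, ‖e ρ‖ₑ) / (r : EReal)) atTop

/-- The space `Z` of entire functions of exponential type that are integrable on the real line. -/
def Z : Submodule ℂ (ℂ → ℂ) where
  carrier := {e | IsExpType e ∧ Integrable (fun t : ℝ => e (t : ℂ))}
  zero_mem' := by
    refine ⟨⟨differentiable_const 0, 1, one_pos, 1, one_pos, fun ρ => ?_⟩, ?_⟩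
    · simp only [Pi.zero_apply, norm_zero]
      positivity
    · exact integrable_zero ℝ ℂ volume
  add_mem' := by
    rintro a b ⟨⟨ha, C, hC, σ, hσ, hab⟩, hai⟩ ⟨⟨hb, C', hC', σ', hσ', hbb⟩, hbi⟩
    refine ⟨⟨ha.add hb, C + C', by positivity, max σ σ', lt_max_of_lt_left hσ, fun ρ => ?_⟩,
      hai.add hbi⟩
    have h1 : Real.exp (σ * |ρ.im|) ≤ Real.exp (max σ σ' * |ρ.im|) := by
      gcongr
      exact le_max_left _ _
    have h2 : Real.exp (σ' * |ρ.im|) ≤ Real.exp (max σ σ' * |ρ.im|) := by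
      gcongr
      exact le_max_right _ _
    calc ‖(a + b) ρ‖ ≤ ‖a ρ‖ + ‖b ρ‖ := norm_add_le _ _
      _ ≤ C * Real.exp (σ * |ρ.im|) + C' * Real.exp (σ' * |ρ.im|) := add_le_add (hab ρ) (hbb ρ)
      _ ≤ C * Real.exp (max σ σ' * |ρ.im|) + C' * Real.exp (max σ σ' * |ρ.im|) := by gcongr
      _ = (C + C') * Real.exp (max σ σ' * |ρ.im|) := by ring
  smul_mem' := by
    rintro c a ⟨⟨ha, C, hC, σ, hσ, hab⟩, hai⟩
    refine ⟨⟨ha.const_smul c, (‖c‖ + 1) * C, by positivity, σ, hσ, fun ρ => ?_⟩, hai.smul c⟩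
    calc ‖(c • a) ρ‖ = ‖c‖ * ‖a ρ‖ := norm_mul _ _
      _ ≤ (‖c‖ + 1) * (C * Real.exp (σ * |ρ.im|)) := by
        gcongr
        · linarith
        · exact hab ρ
      _ = (‖c‖ + 1) * C * Real.exp (σ * |ρ.im|) := by ring

/-- Convergence of a sequence in `Z`: convergence in `L¹(ℝ)` with bounded types. -/
def ZConverges (e : ℕ → Z) (e₀ : Z) : Prop :=
  Tendsto (fun n => ∫ t : ℝ, ‖(e n : ℂ → ℂ) t - (e₀ : ℂ → ℂ) t‖) atTop (𝓝 0) ∧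
    (⨆ n, expType (e n)) < ⊤

/-- The space `Z'` of distributions: linear functionals on `Z` that are continuous
for the convergence in `Z`. -/
def ZDual : Submodule ℂ (Z →ₗ[ℂ] ℂ) where
  carrier := {T | ∀ (e : ℕ → Z) (e₀ : Z), ZConverges e e₀ →
    Tendsto (fun n => T (e n)) atTop (𝓝 (T e₀))}
  zero_mem' := by
    intro e e₀ _
    simp
  add_mem' := by
    intro S T hS hT e e₀ h
    exact (hS e e₀ h).add (hT e e₀ h)
  smul_mem' := by
    intro c T hT e e₀ h
    exact (hT e e₀ h).const_smul c

/-- The product `Q D Q` of a matrix of distributions with scalar matrices. -/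
def sandwich (Q : M2) (D : Matrix (Fin 2) (Fin 2) ZDual) : Matrix (Fin 2) (Fin 2) ZDual :=
  Matrix.of fun i j => ∑ k, ∑ l, (Q i k * Q l j) • D k l

/-- `∫ A(ρ) D(ρ) C(ρ) dρ = M` for a matrix `D` of distributions: every product of an entry of `A`
and an entry of `C` is a test function, and
`M i j = ∑ k l, ⟨D k l, A(ρ) i k * C(ρ) l j⟩` for all `i`, `j`. -/
def HasDistIntegral (D : Matrix (Fin 2) (Fin 2) ZDual) (A C : ℂ → M2) (M : M2) : Prop :=
  ∃ h : ∀ i k l j : Fin 2, (fun ρ : ℂ => A ρ i k * C ρ l j) ∈ Z,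
    ∀ i j : Fin 2, M i j =
      ∑ k, ∑ l, (D k l : Z →ₗ[ℂ] ℂ) ⟨fun ρ : ℂ => A ρ i k * C ρ l j, h i k l j⟩

/-! ### The boundary value problems -/

/-- `u` solves `B u' + P u = lam u` on `0 < x < ∞`, `u(0) = Q`. -/
def IsSolution (P : ℝ → M2) (Q : M2) (lam : ℂ) (u : ℝ → M2) : Prop :=
  u 0 = Q ∧ ContinuousOn u (Set.Ici 0) ∧
    ∀ x : ℝ, 0 < x → ∃ u' : M2, (∀ i j, HasDerivAt (fun t => u t i j) (u' i j) x) ∧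
      B * u' + P x * u x = lam • u x

/-- `v` solves `- v' B + v P = lam v` on `0 < x < ∞`, `v(0) = Q`. -/
def IsAdjSolution (P : ℝ → M2) (Q : M2) (lam : ℂ) (v : ℝ → M2) : Prop :=
  v 0 = Q ∧ ContinuousOn v (Set.Ici 0) ∧
    ∀ x : ℝ, 0 < x → ∃ v' : M2, (∀ i j, HasDerivAt (fun t => v t i j) (v' i j) x) ∧
      -(v' * B) + v x * P x = lam • v x

/-! ### Square integrable matrix functions on the half line and their transforms -/

/-- Matrix functions with entries in `L²(0, ∞)`. -/
def IsL2 (f : ℝ → M2) : Prop :=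
  ∀ i j, MemLp (fun x => f x i j) 2 (volume.restrict (Set.Ioi 0))

/-- Matrix functions with entries in `L²(0, ∞)` that vanish beyond some point `σ`. -/
def IsK2 (f : ℝ → M2) : Prop :=
  IsL2 f ∧ ∃ σ > (0 : ℝ), ∀ᵐ x ∂(volume.restrict (Set.Ioi (0 : ℝ))), σ < x → f x = 0

/-- Entrywise convergence in `L²(0, ∞)`. -/
def L2Converges (f : ℕ → ℝ → M2) (f₀ : ℝ → M2) : Prop :=
  ∀ i j, Tendsto (fun n => eLpNorm (fun x => f n x i j - f₀ x i j) 2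
    (volume.restrict (Set.Ioi 0))) atTop (𝓝 0)

/-- The entrywise integral over `(0, ∞)` of a matrix function. -/
def halfLineIntegral (f : ℝ → M2) : M2 :=
  Matrix.of fun i j => ∫ x in Set.Ioi (0 : ℝ), f x i j

/-- `Φ_f(ρ) = ∫₀^∞ f(x) φ(x, iρ) dx`. -/
def Phi (φ : ℂ → ℝ → M2) (f : ℝ → M2) (ρ : ℂ) : M2 :=
  halfLineIntegral fun x => f x * φ (Complex.I * ρ) x

/-- `Φ̃_g(ρ) = ∫₀^∞ φ̃(x, iρ) g(x) dx`. -/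
def PhiTilde (φt : ℂ → ℝ → M2) (g : ℝ → M2) (ρ : ℂ) : M2 :=
  halfLineIntegral fun x => φt (Complex.I * ρ) x * g x

end SpectralFn

end

open SpectralFn

/-! The conditions on `Q` make it a rank-one projection, `Q = m ℓᵀ` with `ℓ · m = 1`. Hence the rows
of `Φ_f` are scalar transforms times `ℓ`, and the columns of `Φ̃_g` are `m` times scalar transforms.
In the eigenbasis of `B`, after exponential gauge factors have removed the diagonal part of `P`, the
two components of a solution are, up to constants, `Ψ(x)` and `Ψ(-x)` for one scalar function on the
whole line with `Ψ'(x) = iρ Ψ(x) - γ(x) Ψ(-x)`, `Ψ(0) = 1`. The adjoint problem leads to the same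
`γ` with `x` and `-x` exchanged. Parseval's equality thus asks for a functional `d` with, formally,
`d(Ψ(x) Ψ(y)) = δ(x + y)`.

Successive approximations give kernels supported in the cone `|v| ≤ |x|` with `Ψ(x) = e^{iρx} + ∫
K(x, v) e^{iρv} dv` and, conversely, `e^{iρs} = Ψ(s) + ∫ H(s, z) Ψ(z) dz` (`act_psi`). The case `y =
0` requires `d(Ψ(z)) = δ(z)`, so `d(e^{iρs})` must be `δ(s) + H(s, 0)`. A test function is a
superposition of exponentials with the coefficients `unhat e`, which have compact support by
Paley–Wiener; this turns the requirement into the definition of `dist`. No growth condition on `P`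
enters, because only compact pieces of `H(·, 0)` are ever integrated.

That this `d` works rests on `eq_act`, which says formally `d(e^{iρs} Ψ(x)) = δ(s + x) + H(s, -x)`,
the coefficient of `Ψ(-x)` in `e^{iρs}`; the defect solves a homogeneous Volterra equation.
Integrated against `L²` functions, and combined with the inversion `coact_coact` of the transposed
kernels, it yields `dist_spectral_mul_spectral` (Parseval) and `dist_spectral_mul_psi` (expansion).
Continuity on `Z` (`distLinear_mem_ZDual`) follows from Phragmén–Lindelöf and Paley–Wiener: bounded
types confine all `unhat (e n)` to one interval. The matrix is `D = 2 d · m ℓᵀ`, and the `L²`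
extension is continuity of the bilinear form `∫ f g`. -/

namespace SpectralFn
open Set Function Real intervalIntegral

/-! ### Volterra equations for kernels supported in a cone. -/

lemma integral_exp_abs_le {l : ℝ} (hl : 0 < l) (a : ℝ) :
    |∫ t in (0 : ℝ)..a, exp (l * |t|)| ≤ exp (l * |a|) / l := by
  have key : ∀ a : ℝ, 0 ≤ a → ∫ t in (0 : ℝ)..a, exp (l * |t|) = (exp (l * a) - 1) / l := by
    intro a ha
    have : ∫ t in (0 : ℝ)..a, exp (l * |t|) = ∫ t in (0 : ℝ)..a, exp (l * t) := by
      refine integral_congr fun t ht => ?_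
      rw [uIcc_of_le ha] at ht
      simp only [abs_of_nonneg ht.1]
    rw [this, intervalIntegral.integral_comp_mul_left (fun t => exp t) hl.ne', integral_exp]
    simp [div_eq_inv_mul]
  have key2 : ∀ a : ℝ, 0 ≤ a → |∫ t in (0 : ℝ)..a, exp (l * |t|)| ≤ exp (l * |a|) / l := by
    intro a ha
    have h1 : 1 ≤ exp (l * a) := one_le_exp (by positivity)
    rw [key a ha, abs_of_nonneg ha, abs_of_nonneg (div_nonneg (by linarith) hl.le)]
    gcongr
    linarith
  rcases le_total 0 a with ha | ha
  · exact key2 a ha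
  · have h := key2 (-a) (by linarith)
    have h2 : ∫ t in (0 : ℝ)..(-a), exp (l * |t|) = -∫ t in (0 : ℝ)..a, exp (l * |t|) := by
      have := intervalIntegral.integral_comp_neg (a := 0) (b := -a) (fun t : ℝ => exp (l * |t|))
      simp only [abs_neg, neg_neg, neg_zero] at this
      rw [this, integral_symm]
    rwa [h2, abs_neg, abs_neg] at h

/-- In the norm weighted by `exp (l |t|)` one integration gains a factor `1 / l`. This drives both
the convergence of the Picard series and the uniqueness theorem. -/
lemma norm_integral_le_exp_abs {f : ℝ → ℂ} {a A l : ℝ} (hl : 0 < l) (hA : 0 ≤ A)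
    (h : ∀ t ∈ uIoc 0 a, ‖f t‖ ≤ A * exp (l * |t|)) :
    ‖∫ t in (0 : ℝ)..a, f t‖ ≤ A / l * exp (l * |a|) := by
  have h1 := intervalIntegral.norm_integral_le_abs_of_norm_le (f := f)
    (g := fun t => A * exp (l * |t|)) (a := 0) (b := a) (μ := volume)
    ((ae_restrict_iff' measurableSet_uIoc).2 (Eventually.of_forall h))
    ((by fun_prop : Continuous fun t : ℝ => A * exp (l * |t|)).intervalIntegrable _ _)
  rw [intervalIntegral.integral_const_mul, abs_mul, abs_of_nonneg hA] at h1
  calc _ ≤ _ := h1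
    _ ≤ A * (exp (l * |a|) / l) := by gcongr; exact integral_exp_abs_le hl a
    _ = _ := by ring

lemma measurable_intervalIntegral_param {α : Type*} [MeasurableSpace α] {a : α → ℝ}
    (ha : Measurable a) {F : α → ℝ → ℂ} (hF : Measurable (uncurry F)) :
    Measurable fun p => ∫ t in (0 : ℝ)..a p, F p t := by
  have h1 : MeasurableSet {q : α × ℝ | q.2 ∈ Ioc 0 (a q.1)} :=
    (measurableSet_lt measurable_const measurable_snd).inter
      (measurableSet_le measurable_snd (ha.comp measurable_fst))
  have h2 : MeasurableSet {q : α × ℝ | q.2 ∈ Ioc (a q.1) 0} :=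
    (measurableSet_lt (ha.comp measurable_fst) measurable_snd).inter
      (measurableSet_le measurable_snd measurable_const)
  have e : (fun p => ∫ t in (0 : ℝ)..a p, F p t) = fun p =>
      (∫ t, {q : α × ℝ | q.2 ∈ Ioc 0 (a q.1)}.indicator (uncurry F) (p, t)) -
        ∫ t, {q : α × ℝ | q.2 ∈ Ioc (a q.1) 0}.indicator (uncurry F) (p, t) := by
    ext p
    rw [intervalIntegral, ← MeasureTheory.integral_indicator measurableSet_Ioc,
      ← MeasureTheory.integral_indicator measurableSet_Ioc]
    rfl
  rw [e]
  exact ((hF.indicator h1).stronglyMeasurable.integral_prod_right').measurable.sub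
    ((hF.indicator h2).stronglyMeasurable.integral_prod_right').measurable

lemma abs_le_of_mem_uIoc {a t : ℝ} (ht : t ∈ uIoc 0 a) : |t| ≤ |a| := by
  rcases le_total 0 a with h | h
  · rw [uIoc_of_le h] at ht
    rw [abs_of_nonneg h, abs_of_pos ht.1]; exact ht.2
  · rw [uIoc_of_ge h] at ht
    rw [abs_of_nonpos h, abs_of_nonpos ht.2]; linarith [ht.1]

/-- A measurable kernel, bounded for bounded first argument, supported in the cone
`|b| ≤ |a|`. -/
structure IsConeKernel (W : ℝ → ℝ → ℂ) : Prop where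
  measurable : Measurable (uncurry W)
  support : ∀ a b, |a| < |b| → W a b = 0
  bound : ∀ R : ℝ, ∃ C : ℝ, 0 ≤ C ∧ ∀ a b, |a| ≤ R → ‖W a b‖ ≤ C

/-- Picard iterates of a linear Volterra equation for kernels. -/
noncomputable def picard (κ : ℝ → ℝ → ℝ → ℂ) (r : ℝ → ℝ) (ℓ : ℝ → ℝ → ℝ → ℝ) (g : ℝ → ℝ → ℂ) :
    ℕ → ℝ → ℝ → ℂ
  | 0 => g
  | n + 1 => fun a b => ∫ t in (0 : ℝ)..a, κ a b t * picard κ r ℓ g n (r t) (ℓ a b t)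

/-- Solvability of a linear Volterra equation for kernels supported in a cone. -/
theorem exists_volterra_kernel {κ : ℝ → ℝ → ℝ → ℂ} {r : ℝ → ℝ} {ℓ : ℝ → ℝ → ℝ → ℝ}
    {g : ℝ → ℝ → ℂ} (hg : IsConeKernel g)
    (hκm : Measurable fun p : (ℝ × ℝ) × ℝ => κ p.1.1 p.1.2 p.2)
    (hrm : Measurable r) (hr : ∀ t, |r t| = |t|)
    (hℓm : Measurable fun p : (ℝ × ℝ) × ℝ => ℓ p.1.1 p.1.2 p.2)
    (hℓ : ∀ a b t, t ∈ uIoc 0 a → |ℓ a b t| ≤ |t| → |b| ≤ |a|)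
    (hκ : ∀ R : ℝ, ∃ M : ℝ, 0 ≤ M ∧ ∀ a b t, |a| ≤ R → t ∈ uIoc 0 a → |ℓ a b t| ≤ |t| →
      ‖κ a b t‖ ≤ M) :
    ∃ W : ℝ → ℝ → ℂ, IsConeKernel W ∧
      ∀ a b, W a b = g a b + ∫ t in (0 : ℝ)..a, κ a b t * W (r t) (ℓ a b t) := by
  set w := picard κ r ℓ g with hw
  have hsucc : ∀ n a b, w (n + 1) a b = ∫ t in (0 : ℝ)..a, κ a b t * w n (r t) (ℓ a b t) :=
    fun n a b => rfl
  have hcomp : ∀ W : ℝ → ℝ → ℂ, Measurable (uncurry W) →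
      Measurable fun p : (ℝ × ℝ) × ℝ => κ p.1.1 p.1.2 p.2 * W (r p.2) (ℓ p.1.1 p.1.2 p.2) :=
    fun W hW => hκm.mul (hW.comp ((hrm.comp measurable_snd).prodMk hℓm))
  have hmeas : ∀ n, Measurable (uncurry (w n)) := by
    intro n
    induction n with
    | zero => exact hg.measurable
    | succ n ih => exact measurable_intervalIntegral_param measurable_fst (hcomp _ ih)
  have hsupp : ∀ n a b, |a| < |b| → w n a b = 0 := by
    intro n
    induction n with
    | zero => exact hg.support
    | succ n ih =>
      intro a b hab
      rw [hsucc, intervalIntegral.integral_congr_ae (g := fun _ => 0), intervalIntegral.integral_zero]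
      refine Eventually.of_forall fun t ht => ?_
      -- A nonzero integrand forces `|ℓ a b t| ≤ |t|`, and `hℓ` then puts `(a, b)` back in the cone.
      rw [ih, mul_zero]
      rw [hr]
      by_contra! h
      exact absurd (hℓ a b t ht h) (not_le.2 hab)
  have hbound : ∀ R : ℝ, ∃ C l : ℝ, 0 ≤ C ∧ 0 < l ∧ (∀ n a b, |a| ≤ R →
      ‖w n a b‖ ≤ C * (1 / 2) ^ n * exp (l * |a|)) ∧ (∀ n a b t, |a| ≤ R → t ∈ uIoc 0 a →
      ‖κ a b t * w n (r t) (ℓ a b t)‖ ≤ C * (1 / 2) ^ n * (l / 2) * exp (l * |t|)) := by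
    intro R
    obtain ⟨C, hC0, hC⟩ := hg.bound R
    obtain ⟨M, hM0, hM⟩ := hκ R
    -- With this weight each iteration halves the bound; the summand `1` keeps `l` positive. Since
    -- `r` preserves `|t|`, reflections do not disturb the weight.
    set l := 2 * (M + 1) with hl
    have hlpos : 0 < l := by positivity
    have step : ∀ n, (∀ a b, |a| ≤ R → ‖w n a b‖ ≤ C * (1 / 2) ^ n * exp (l * |a|)) →
        ∀ a b t, |a| ≤ R → t ∈ uIoc 0 a →
        ‖κ a b t * w n (r t) (ℓ a b t)‖ ≤ C * (1 / 2) ^ n * (l / 2) * exp (l * |t|) := by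
      intro n ih a b t ha ht
      by_cases h : |ℓ a b t| ≤ |t|
      · have h1 := hM a b t ha ht h
        have h2 := ih (r t) (ℓ a b t) (by rw [hr]; exact (abs_le_of_mem_uIoc ht).trans ha)
        rw [hr] at h2
        rw [norm_mul]
        calc _ ≤ (M + 1) * (C * (1 / 2) ^ n * exp (l * |t|)) := by
              gcongr
              linarith
          _ = _ := by rw [hl]; ring
      · rw [hsupp n _ _ (by rw [hr]; exact not_le.1 h), mul_zero, norm_zero]
        positivity
    have main : ∀ n a b, |a| ≤ R → ‖w n a b‖ ≤ C * (1 / 2) ^ n * exp (l * |a|) := by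
      intro n
      induction n with
      | zero =>
        intro a b ha
        have h1 : 1 ≤ exp (l * |a|) := one_le_exp (by positivity)
        calc _ ≤ C := hC a b ha
          _ ≤ C * (1 / 2) ^ 0 * exp (l * |a|) := by
            rw [pow_zero, mul_one]; nlinarith
      | succ n ih =>
        intro a b ha
        rw [hsucc]
        refine (norm_integral_le_exp_abs hlpos (by positivity)
          (fun t ht => step n ih a b t ha ht)).trans (le_of_eq ?_)
        rw [pow_succ]
        field_simp
    exact ⟨C, l, hC0, hlpos, main, fun n => step n (main n)⟩
  have hsum : ∀ a b, Summable fun n => w n a b := by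
    intro a b
    obtain ⟨C, l, hC0, hl, h1, -⟩ := hbound |a|
    refine Summable.of_norm_bounded (g := fun n : ℕ => C * (1 / 2) ^ n * exp (l * |a|)) ?_
      fun n => h1 n a b le_rfl
    exact (summable_geometric_two.mul_left C).mul_right _
  refine ⟨fun a b => ∑' n, w n a b, ⟨?_, ?_, ?_⟩, ?_⟩
  · refine measurable_of_tendsto_metrizable
      (f := fun (n : ℕ) (p : ℝ × ℝ) => ∑ i ∈ Finset.range n, w i p.1 p.2) (fun n => ?_) ?_
    · exact Finset.measurable_fun_sum _ fun i _ => hmeas i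
    · rw [tendsto_pi_nhds]
      exact fun p => (hsum p.1 p.2).hasSum.tendsto_sum_nat
  · intro a b hab
    simp [hsupp _ a b hab]
  · intro R
    obtain ⟨C, l, hC0, hl, h1, -⟩ := hbound R
    refine ⟨C * 2 * exp (l * R), by positivity, fun a b ha => ?_⟩
    have hs : HasSum (fun n : ℕ => C * (1 / 2) ^ n * exp (l * |a|)) (C * 2 * exp (l * |a|)) :=
      (hasSum_geometric_two.mul_left C).mul_right _
    refine (tsum_of_norm_bounded hs fun n => h1 n a b ha).trans ?_
    gcongr
  · intro a b
    obtain ⟨C, l, hC0, hl, h1, h2⟩ := hbound |a|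
    beta_reduce
    rw [(hsum a b).tsum_eq_zero_add]
    congr 1
    have := intervalIntegral.hasSum_integral_of_dominated_convergence (μ := volume) (a := 0) (b := a)
      (F := fun n t => κ a b t * w n (r t) (ℓ a b t))
      (f := fun t => κ a b t * ∑' n, w n (r t) (ℓ a b t))
      (fun (n : ℕ) t => C * (1 / 2) ^ n * (l / 2) * exp (l * |t|))
      (fun n => ((hcomp _ (hmeas n)).comp
        (measurable_const.prodMk measurable_id : Measurable fun t : ℝ => ((a, b), t))
        ).aestronglyMeasurable)
      (fun n => Eventually.of_forall fun t ht => h2 n a b t le_rfl ht)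
      (Eventually.of_forall fun t ht =>
        ((summable_geometric_two.mul_left C).mul_right _).mul_right _) ?_
      (Eventually.of_forall fun t ht => (hsum _ _).hasSum.mul_left _)
    · rw [← this.tsum_eq]
      exact tsum_congr fun n => hsucc n a b
    · refine Continuous.intervalIntegrable ?_ _ _
      have : (fun t : ℝ => ∑' n : ℕ, C * (1 / 2) ^ n * (l / 2) * exp (l * |t|)) =
          fun t => C * 2 * (l / 2) * exp (l * |t|) := by
        ext t
        exact (((hasSum_geometric_two.mul_left C).mul_right _).mul_right _).tsum_eq
      rw [this]
      fun_prop

end SpectralFn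

/-! ### Oriented integrals and the two transmutation kernels. -/

namespace SpectralFn
open Set Function Real intervalIntegral

/-- Locally bounded measurable functions. -/
structure IsLocBdd (f : ℝ → ℂ) : Prop where
  measurable : Measurable f
  bound : ∀ R : ℝ, ∃ C : ℝ, 0 ≤ C ∧ ∀ x, |x| ≤ R → ‖f x‖ ≤ C

lemma IsLocBdd.of_continuous {f : ℝ → ℂ} (hf : Continuous f) : IsLocBdd f := by
  refine ⟨hf.measurable, fun R => ?_⟩
  obtain ⟨C, hC⟩ := (isCompact_Icc (a := -R) (b := R)).exists_bound_of_continuousOn hf.continuousOn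
  exact ⟨max C 0, le_max_right _ _, fun x hx => (hC x (abs_le.1 hx)).trans (le_max_left _ _)⟩

lemma IsLocBdd.mul {f g : ℝ → ℂ} (hf : IsLocBdd f) (hg : IsLocBdd g) :
    IsLocBdd fun x => f x * g x := by
  refine ⟨hf.measurable.mul hg.measurable, fun R => ?_⟩
  obtain ⟨C, hC0, hC⟩ := hf.bound R
  obtain ⟨D, hD0, hD⟩ := hg.bound R
  refine ⟨C * D, by positivity, fun x hx => ?_⟩
  rw [norm_mul]
  exact mul_le_mul (hC x hx) (hD x hx) (norm_nonneg _) hC0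

lemma IsLocBdd.comp_continuous {f : ℝ → ℂ} (hf : IsLocBdd f) {r : ℝ → ℝ} (hr : Continuous r) :
    IsLocBdd fun x => f (r x) := by
  refine ⟨hf.measurable.comp hr.measurable, fun R => ?_⟩
  obtain ⟨S, hS⟩ := (isCompact_Icc (a := -R) (b := R)).exists_bound_of_continuousOn
    hr.continuousOn
  obtain ⟨C, hC0, hC⟩ := hf.bound S
  exact ⟨C, hC0, fun x hx => hC _ (hS x (abs_le.1 hx))⟩

lemma intervalIntegrable_of_measurable_of_bound {f : ℝ → ℂ} {a b C : ℝ} (hf : Measurable f)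
    (h : ∀ t ∈ uIoc a b, ‖f t‖ ≤ C) : IntervalIntegrable f volume a b := by
  rw [intervalIntegrable_iff]
  refine Measure.integrableOn_of_bounded (M := C) ?_ hf.aestronglyMeasurable ?_
  · simp [uIoc]
  · exact (ae_restrict_iff' measurableSet_uIoc).2 (Eventually.of_forall h)

lemma IsLocBdd.intervalIntegrable {f : ℝ → ℂ} (hf : IsLocBdd f) (a b : ℝ) :
    IntervalIntegrable f volume a b := by
  obtain ⟨C, -, hC⟩ := hf.bound (max |a| |b|)
  refine intervalIntegrable_of_measurable_of_bound (C := C) hf.measurable fun t ht => hC t ?_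
  rcases mem_uIoc.1 ht with h | h
  · exact abs_le_max_abs_abs h.1.le h.2
  · rw [max_comm]; exact abs_le_max_abs_abs h.1.le h.2

lemma integrable_of_bounded_interval {f : ℝ → ℂ} {R C : ℝ} (hf : AEStronglyMeasurable f volume)
    (hC : ∀ x, ‖f x‖ ≤ C) (hs : ∀ x, R < |x| → f x = 0) : Integrable f := by
  have h1 : IntegrableOn f (Icc (-R) R) :=
    Measure.integrableOn_of_bounded (M := C) (by simp) hf
      (Eventually.of_forall hC)
  refine (integrableOn_iff_integrable_of_support_subset fun x hx => ?_).1 h1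
  rw [mem_Icc, ← abs_le]
  by_contra h
  exact hx (hs x (not_le.1 h))

lemma integrable_of_bounded_box {f : ℝ × ℝ → ℂ} {R C : ℝ} (hf : AEStronglyMeasurable f (volume.prod volume))
    (hC : ∀ x, ‖f x‖ ≤ C) (hs : ∀ x, R < |x.1| ∨ R < |x.2| → f x = 0) :
    Integrable f (volume.prod volume) := by
  have h1 : IntegrableOn f (Icc (-R) R ×ˢ Icc (-R) R) (volume.prod volume) := by
    refine Measure.integrableOn_of_bounded (M := C) ?_ hf (Eventually.of_forall hC)
    rw [Measure.prod_prod]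
    simp [ENNReal.mul_eq_top]
  refine (integrableOn_iff_integrable_of_support_subset fun x hx => ?_).1 h1
  rw [mem_prod, mem_Icc, mem_Icc, ← abs_le, ← abs_le]
  by_contra h
  rw [not_and_or, not_le, not_le] at h
  exact hx (hs x h)

/-- The oriented indicator of `(0, x]`. -/
noncomputable def orient (x t : ℝ) : ℂ := (Ioc 0 x).indicator 1 t - (Ioc x 0).indicator 1 t

/-- The oriented indicator of `[0, s)`. -/
noncomputable def orient' (s t : ℝ) : ℂ := (Ico 0 s).indicator 1 t - (Ico s 0).indicator 1 t

lemma measurable_orient : Measurable (uncurry orient) := by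
  have h1 : MeasurableSet {q : ℝ × ℝ | q.2 ∈ Ioc 0 q.1} :=
    (measurableSet_lt measurable_const measurable_snd).inter
      (measurableSet_le measurable_snd measurable_fst)
  have h2 : MeasurableSet {q : ℝ × ℝ | q.2 ∈ Ioc q.1 0} :=
    (measurableSet_lt measurable_fst measurable_snd).inter
      (measurableSet_le measurable_snd measurable_const)
  exact (measurable_one.indicator h1).sub (measurable_one.indicator h2)

lemma measurable_orient' : Measurable (uncurry orient') := by
  have h1 : MeasurableSet {q : ℝ × ℝ | q.2 ∈ Ico 0 q.1} :=
    (measurableSet_le measurable_const measurable_snd).inter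
      (measurableSet_lt measurable_snd measurable_fst)
  have h2 : MeasurableSet {q : ℝ × ℝ | q.2 ∈ Ico q.1 0} :=
    (measurableSet_le measurable_fst measurable_snd).inter
      (measurableSet_lt measurable_snd measurable_const)
  exact (measurable_one.indicator h1).sub (measurable_one.indicator h2)

lemma norm_orient_le (x t : ℝ) : ‖orient x t‖ ≤ 1 := by
  unfold orient
  by_cases h1 : t ∈ Ioc 0 x <;> by_cases h2 : t ∈ Ioc x 0 <;> simp [h1, h2]

lemma norm_orient'_le (x t : ℝ) : ‖orient' x t‖ ≤ 1 := by
  unfold orient'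
  by_cases h1 : t ∈ Ico 0 x <;> by_cases h2 : t ∈ Ico x 0 <;> simp [h1, h2]

lemma orient_eq_zero {x t : ℝ} (h : t ∉ uIoc 0 x) : orient x t = 0 := by
  rw [mem_uIoc, not_or] at h
  have h1 : t ∉ Ioc 0 x := h.1
  have h2 : t ∉ Ioc x 0 := h.2
  simp [orient, h1, h2]

lemma orient'_eq_zero {x t : ℝ} (h : t ∉ uIcc 0 x) : orient' x t = 0 := by
  have h1 : t ∉ Ico 0 x := fun h' => h (Icc_subset_uIcc ⟨h'.1, h'.2.le⟩)
  have h2 : t ∉ Ico x 0 := fun h' => h (Icc_subset_uIcc' ⟨h'.1, h'.2.le⟩)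
  simp [orient', h1, h2]

lemma intervalIntegral_eq_orient (f : ℝ → ℂ) (x : ℝ) :
    ∫ t in (0 : ℝ)..x, f t = ∫ t, orient x t * f t := by
  have e1 : ∀ s : Set ℝ, (fun t => s.indicator (1 : ℝ → ℂ) t * f t) = s.indicator f := by
    intro s; ext t
    by_cases h : t ∈ s <;> simp [h]
  rcases le_total 0 x with hx | hx
  · have e2 : (fun t => orient x t * f t) = (Ioc 0 x).indicator f := by
      rw [← e1]; ext t; simp [orient, Ioc_eq_empty (not_lt.2 hx)]
    rw [e2, MeasureTheory.integral_indicator measurableSet_Ioc, integral_of_le hx]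
  · have e2 : (fun t => orient x t * f t) = fun t => -(Ioc x 0).indicator f t := by
      rw [← e1]; ext t; simp [orient, Ioc_eq_empty (not_lt.2 hx)]
    rw [e2, MeasureTheory.integral_neg, MeasureTheory.integral_indicator measurableSet_Ioc,
      integral_of_ge hx]

lemma integral_intervalIntegral_swap {F : ℝ → ℝ → ℂ} {x C R : ℝ} (hF : Measurable (uncurry F))
    (hC : ∀ t ∈ uIoc 0 x, ∀ v, ‖F t v‖ ≤ C) (hR : ∀ t ∈ uIoc 0 x, ∀ v, R < |v| → F t v = 0) :
    ∫ v, ∫ t in (0 : ℝ)..x, F t v = ∫ t in (0 : ℝ)..x, ∫ v, F t v := by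
  have h0 : ∀ t v, t ∉ uIoc 0 x → orient x t * F t v = 0 := fun t v h => by
    rw [orient_eq_zero h, zero_mul]
  have hint : Integrable (uncurry fun v t => orient x t * F t v) (volume.prod volume) := by
    refine integrable_of_bounded_box (R := max R |x|) (C := max C 0) ?_ ?_ ?_
    · exact ((measurable_orient.comp (measurable_const.prodMk measurable_snd)).mul
        (hF.comp measurable_swap)).aestronglyMeasurable
    · rintro ⟨v, t⟩
      simp only [uncurry]
      by_cases h : t ∈ uIoc 0 x
      · rw [norm_mul]
        calc _ ≤ 1 * C := mul_le_mul (norm_orient_le _ _) (hC t h v) (norm_nonneg _) zero_le_one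
          _ ≤ _ := by rw [one_mul]; exact le_max_left _ _
      · rw [h0 _ _ h, norm_zero]; exact le_max_right _ _
    · rintro ⟨v, t⟩ h
      simp only [uncurry, max_lt_iff] at h ⊢
      by_cases ht : t ∈ uIoc 0 x
      · rcases h with h | h
        · rw [hR t ht v h.1, mul_zero]
        · exact absurd (abs_le_of_mem_uIoc ht) (not_le.2 h.2)
      · exact h0 _ _ ht
  simp_rw [intervalIntegral_eq_orient, ← MeasureTheory.integral_const_mul]
  exact MeasureTheory.integral_integral_swap hint

/-- The two indicators differ only in their endpoints. Both conventions are kept because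
`orient_add_orient'` has to hold pointwise, not just almost everywhere. -/
lemma orient'_ae_eq (x : ℝ) : orient' x =ᵐ[volume] orient x := by
  have h0 : ∀ᵐ t : ℝ, t ≠ 0 := by simp [ae_iff]
  have h1 : ∀ᵐ t : ℝ, t ≠ x := by simp [ae_iff]
  filter_upwards [h0, h1] with t ht0 htx
  have e1 : t ∈ Ico 0 x ↔ t ∈ Ioc 0 x :=
    ⟨fun h => ⟨lt_of_le_of_ne h.1 ht0.symm, h.2.le⟩, fun h => ⟨h.1.le, lt_of_le_of_ne h.2 htx⟩⟩
  have e2 : t ∈ Ico x 0 ↔ t ∈ Ioc x 0 :=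
    ⟨fun h => ⟨lt_of_le_of_ne h.1 htx.symm, h.2.le⟩, fun h => ⟨h.1.le, lt_of_le_of_ne h.2 ht0⟩⟩
  have aux : ∀ A B : Set ℝ, (t ∈ A ↔ t ∈ B) →
      A.indicator (1 : ℝ → ℂ) t = B.indicator 1 t := by
    intro A B h
    by_cases hB : t ∈ B
    · rw [indicator_of_mem hB, indicator_of_mem (h.2 hB)]
    · rw [indicator_of_notMem hB, indicator_of_notMem fun hA => hB (h.1 hA)]
  rw [orient, orient', aux _ _ e1, aux _ _ e2]

lemma abs_le_of_mem_uIcc {a t : ℝ} (ht : t ∈ uIcc 0 a) : |t| ≤ |a| := by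
  simpa using abs_sub_left_of_mem_uIcc ht

lemma abs_add_abs_sub_of_mem_uIcc {a t : ℝ} (ht : t ∈ uIcc 0 a) : |t| + |a - t| = |a| := by
  rcases le_total 0 a with h | h
  · rw [uIcc_of_le h] at ht
    rw [abs_of_nonneg h, abs_of_nonneg ht.1, abs_of_nonneg (by linarith [ht.2])]; ring
  · rw [uIcc_of_ge h] at ht
    rw [abs_of_nonpos h, abs_of_nonpos ht.2, abs_of_nonpos (by linarith [ht.1])]; ring

/-- The coefficient of the reduced scalar problem: locally bounded and vanishing at `0`. -/
structure IsPotential (γ : ℝ → ℂ) : Prop extends IsLocBdd γ where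
  zero : γ 0 = 0

/-- The transmutation kernel: the solutions of `Ψ'(x) = iρ Ψ(x) - γ(x) Ψ(-x)`, `Ψ(0) = 1` are
`e^{iρx} + ∫ K(x, v) e^{iρv} dv`. -/
structure IsTransmutation (γ : ℝ → ℂ) (K : ℝ → ℝ → ℂ) : Prop extends IsConeKernel K where
  eq : ∀ x v, K x v = -(1 / 2) * γ ((x - v) / 2) * orient x ((x - v) / 2) +
    ∫ t in (0 : ℝ)..x, -γ t * K (-t) (v - x + t)

/-- The inverse transmutation kernel. -/
structure IsInverseTransmutation (γ : ℝ → ℂ) (H : ℝ → ℝ → ℂ) : Prop extends IsConeKernel H where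
  eq : ∀ s z, H s z = 1 / 2 * γ ((s - z) / 2) * orient' s ((s - z) / 2) +
    ∫ t in (0 : ℝ)..s, γ (s - z - t) * H t (s - z - t)

/-- With `t = (x - v) / 2` between `0` and `x`, the number `v = (x - t) - t` satisfies `|v| ≤ |x -
t| + |t| = |x|`. -/
lemma isConeKernel_source {γ : ℝ → ℂ} (hγ : IsPotential γ) (c : ℂ) {o : ℝ → ℝ → ℂ}
    (hom : Measurable (uncurry o)) (ho1 : ∀ x t, ‖o x t‖ ≤ 1)
    (ho0 : ∀ x t, t ∉ uIcc 0 x → o x t = 0) :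
    IsConeKernel fun x v => c * γ ((x - v) / 2) * o x ((x - v) / 2) := by
  have hs : ∀ x v : ℝ, (x - v) / 2 ∈ uIcc 0 x → |v| ≤ |x| ∧ |(x - v) / 2| ≤ |x| := by
    intro x v h
    have h1 := abs_add_abs_sub_of_mem_uIcc h
    refine ⟨?_, by linarith [abs_nonneg (x - (x - v) / 2)]⟩
    have h3 : v = (x - (x - v) / 2) - (x - v) / 2 := by ring
    calc |v| = |(x - (x - v) / 2) - (x - v) / 2| := by rw [← h3]
      _ ≤ |x - (x - v) / 2| + |(x - v) / 2| := abs_sub _ _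
      _ = |x| := by rw [add_comm]; exact h1
  refine ⟨?_, fun x v h => ?_, fun R => ?_⟩
  · have h1 : Measurable fun p : ℝ × ℝ => (p.1 - p.2) / 2 := by fun_prop
    exact ((hγ.measurable.comp h1).const_mul c).mul (hom.comp (measurable_fst.prodMk h1))
  · rw [ho0 x _ fun h' => not_le.2 h (hs x v h').1, mul_zero]
  · obtain ⟨C, hC0, hC⟩ := hγ.bound R
    refine ⟨‖c‖ * C, by positivity, fun x v hx => ?_⟩
    by_cases h : (x - v) / 2 ∈ uIcc 0 x
    · rw [norm_mul, norm_mul]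
      calc _ ≤ ‖c‖ * C * 1 := by
            gcongr
            · exact hC _ ((hs x v h).2.trans hx)
            · exact ho1 _ _
        _ = _ := mul_one _
    · rw [ho0 _ _ h, mul_zero, norm_zero]; positivity

/-- The equation for `K` results from inserting `Ψ(x) = e^{iρx} + ∫ K(x, v) e^{iρv} dv` into `Ψ(x) =
e^{iρx} - ∫₀ˣ e^{iρ(x-t)} γ(t) Ψ(-t) dt` and comparing coefficients of `e^{iρv}`. The exponential
part of `Ψ(-t)` gives `v = x - 2t`, whence the source at `t = (x - v) / 2` and the Jacobian `1 / 2`.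
-/
theorem exists_transmutation {γ : ℝ → ℂ} (hγ : IsPotential γ) : ∃ K, IsTransmutation γ K := by
  have hcone : ∀ a b t : ℝ, t ∈ uIoc 0 a → |b - a + t| ≤ |t| → |b| ≤ |a| := by
    intro a b t ht h
    have h1 := abs_add_abs_sub_of_mem_uIcc (uIoc_subset_uIcc ht)
    have h3 : b = (b - a + t) + (a - t) := by ring
    calc |b| = |(b - a + t) + (a - t)| := by rw [← h3]
      _ ≤ |b - a + t| + |a - t| := abs_add_le _ _
      _ ≤ |a| := by linarith
  have hbd : ∀ R : ℝ, ∃ M : ℝ, 0 ≤ M ∧ ∀ a b t : ℝ, |a| ≤ R → t ∈ uIoc 0 a →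
      |b - a + t| ≤ |t| → ‖-γ t‖ ≤ M := by
    intro R
    obtain ⟨C, hC0, hC⟩ := hγ.bound R
    exact ⟨C, hC0, fun a b t ha ht _ => by
      rw [norm_neg]; exact hC t ((abs_le_of_mem_uIoc ht).trans ha)⟩
  obtain ⟨K, hK, hKe⟩ := exists_volterra_kernel (κ := fun _ _ t => -γ t) (r := fun t => -t)
    (ℓ := fun x v t => v - x + t)
    (isConeKernel_source hγ (-(1 / 2)) measurable_orient norm_orient_le
      fun x t h => orient_eq_zero fun h' => h (uIoc_subset_uIcc h'))
    (hγ.measurable.comp measurable_snd).neg measurable_neg abs_neg (by fun_prop) hcone hbd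
  exact ⟨K, ⟨hK, hKe⟩⟩

/-- Differentiating `e^{iρs} = Ψ(s) + ∫ H(s, z) Ψ(z) dz` in `s` gives formally `(∂_s + ∂_z) H(s, z)
= γ(-z) H(s, -z)` with a source on `s + z = 0`. The equation for `H` is this one integrated along
the characteristics `s - z = const`. -/
theorem exists_inverseTransmutation {γ : ℝ → ℂ} (hγ : IsPotential γ) :
    ∃ H, IsInverseTransmutation γ H := by
  have hcone : ∀ a b t : ℝ, t ∈ uIoc 0 a → |a - b - t| ≤ |t| → |b| ≤ |a| := by
    intro a b t ht h
    have h1 := abs_add_abs_sub_of_mem_uIcc (uIoc_subset_uIcc ht)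
    have h3 : b = (a - t) - (a - b - t) := by ring
    calc |b| = |(a - t) - (a - b - t)| := by rw [← h3]
      _ ≤ |a - t| + |a - b - t| := abs_sub _ _
      _ ≤ |a| := by linarith
  have hbd : ∀ R : ℝ, ∃ M : ℝ, 0 ≤ M ∧ ∀ a b t : ℝ, |a| ≤ R → t ∈ uIoc 0 a →
      |a - b - t| ≤ |t| → ‖γ (a - b - t)‖ ≤ M := by
    intro R
    obtain ⟨C, hC0, hC⟩ := hγ.bound R
    exact ⟨C, hC0, fun a b t ha ht h => hC _ (h.trans ((abs_le_of_mem_uIoc ht).trans ha))⟩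
  obtain ⟨H, hH, hHe⟩ := exists_volterra_kernel (κ := fun s z t => γ (s - z - t))
    (r := fun t => t) (ℓ := fun s z t => s - z - t)
    (isConeKernel_source hγ (1 / 2) measurable_orient' norm_orient'_le
      fun x t h => orient'_eq_zero h)
    (hγ.measurable.comp (by fun_prop)) measurable_id (fun _ => rfl) (by fun_prop) hcone hbd
  exact ⟨H, ⟨hH, hHe⟩⟩

/-- The action `f(x) + ∫ W(x, v) f(v) dv` of a kernel. -/
noncomputable def act (W : ℝ → ℝ → ℂ) (x : ℝ) (f : ℝ → ℂ) : ℂ := f x + ∫ v, W x v * f v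

lemma IsConeKernel.integrable_mul {W : ℝ → ℝ → ℂ} (hW : IsConeKernel W) (x : ℝ) {f : ℝ → ℂ}
    (hf : IsLocBdd f) : Integrable fun v => W x v * f v := by
  obtain ⟨C, hC0, hC⟩ := hW.bound |x|
  obtain ⟨D, hD0, hD⟩ := hf.bound |x|
  have hm : Measurable (W x) := hW.measurable.comp measurable_prodMk_left
  refine integrable_of_bounded_interval (R := |x|) (C := C * D)
    (hm.mul hf.measurable).aestronglyMeasurable (fun v => ?_)
    fun v hv => by rw [hW.support _ _ hv, zero_mul]
  rcases le_or_gt |v| |x| with hv | hv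
  · rw [norm_mul]
    exact mul_le_mul (hC x v le_rfl) (hD v hv) (norm_nonneg _) hC0
  · rw [hW.support _ _ hv, zero_mul, norm_zero]; positivity

lemma act_const_mul (W : ℝ → ℝ → ℂ) (x : ℝ) (c : ℂ) (f : ℝ → ℂ) :
    act W x (fun v => c * f v) = c * act W x f := by
  simp only [act]
  rw [mul_add, ← MeasureTheory.integral_const_mul]
  congr 1
  exact MeasureTheory.integral_congr_ae (Eventually.of_forall fun v => by ring)

lemma IsConeKernel.norm_act_le {W : ℝ → ℝ → ℂ} {x : ℝ} {f : ℝ → ℂ} {R C D : ℝ}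
    (hW : IsConeKernel W) (hx : |x| ≤ R) (hC : ∀ v, ‖W x v‖ ≤ C) (hD0 : 0 ≤ D)
    (hD : ∀ v, |v| ≤ |x| → ‖f v‖ ≤ D) : ‖act W x f‖ ≤ D + C * D * (2 * R) := by
  have hC0 : 0 ≤ C := (norm_nonneg _).trans (hC 0)
  have h1 : ‖∫ v, W x v * f v‖ ≤ C * D * (2 * |x|) := by
    have e : ∫ v, W x v * f v = ∫ v in Icc (-|x|) |x|, W x v * f v := by
      refine (setIntegral_eq_integral_of_forall_compl_eq_zero fun v hv => ?_).symm
      rw [mem_Icc, ← abs_le, not_le] at hv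
      rw [hW.support _ _ hv, zero_mul]
    rw [e]
    refine (norm_setIntegral_le_of_norm_le_const (C := C * D) (by simp) fun v hv => ?_).trans ?_
    · rw [norm_mul]
      exact mul_le_mul (hC v) (hD v (abs_le.2 hv)) (norm_nonneg _) hC0
    · rw [measureReal_def, Real.volume_Icc, ENNReal.toReal_ofReal (by linarith [abs_nonneg x])]
      exact le_of_eq (by ring)
  calc ‖act W x f‖ ≤ ‖f x‖ + ‖∫ v, W x v * f v‖ := norm_add_le _ _
    _ ≤ D + C * D * (2 * |x|) := add_le_add (hD x le_rfl) h1
    _ ≤ _ := by gcongr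

lemma IsConeKernel.measurable_act {W : ℝ → ℝ → ℂ} (hW : IsConeKernel W) {α : Type*}
    [MeasurableSpace α] {a : α → ℝ} (ha : Measurable a) {f : α → ℝ → ℂ}
    (hf : Measurable (uncurry f)) : Measurable fun p => act W (a p) (f p) := by
  refine (hf.comp (measurable_id.prodMk ha)).add ?_
  have h : Measurable fun q : α × ℝ => W (a q.1) q.2 * f q.1 q.2 :=
    (hW.measurable.comp ((ha.comp measurable_fst).prodMk measurable_snd)).mul hf
  exact h.stronglyMeasurable.integral_prod_right'.measurable

lemma IsConeKernel.isLocBdd_act {W : ℝ → ℝ → ℂ} (hW : IsConeKernel W) {f : ℝ → ℂ}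
    (hf : IsLocBdd f) : IsLocBdd fun x => act W x f := by
  refine ⟨hW.measurable_act measurable_id (hf.measurable.comp measurable_snd), fun R => ?_⟩
  obtain ⟨C, hC0, hC⟩ := hW.bound R
  obtain ⟨D, hD0, hD⟩ := hf.bound R
  refine ⟨max (D + C * D * (2 * R)) 0, le_max_right _ _, fun x hx => le_max_of_le_left ?_⟩
  exact hW.norm_act_le hx (fun v => hC x v hx) hD0 fun v hv => hD v (hv.trans hx)

end SpectralFn

/-! ### The kernel equations applied to functions. -/

namespace SpectralFn
open Set Function Real intervalIntegral

lemma integral_comp_half_sub (g : ℝ → ℂ) (x : ℝ) : ∫ v, g ((x - v) / 2) = 2 * ∫ t, g t := by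
  rw [integral_sub_left_eq_self (fun y => g (y / 2)) volume x, Measure.integral_comp_div]
  simp

variable {γ : ℝ → ℂ} {K H : ℝ → ℝ → ℂ}

lemma IsConeKernel.measurable_right {W : ℝ → ℝ → ℂ} (hW : IsConeKernel W) (x : ℝ) :
    Measurable (W x) := hW.measurable.comp measurable_prodMk_left

/-- The equation for `K` integrated against an arbitrary `f` in place of an exponential. For `f(v) =
e^{iρv}` it is Duhamel's formula for `Ψ`; `eq_act` needs it for translates of `H(·, 0)`. -/
theorem IsTransmutation.act_eq (hγ : IsPotential γ) (hK : IsTransmutation γ K) {f : ℝ → ℂ}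
    (hf : IsLocBdd f) (x : ℝ) :
    act K x f = f x - ∫ t in (0 : ℝ)..x, γ t * act K (-t) fun v => f (v + (x - t)) := by
  have hA := (isConeKernel_source hγ (-(1 / 2)) measurable_orient norm_orient_le
      fun x t h => orient_eq_zero fun h' => h (uIoc_subset_uIcc h')).integrable_mul x hf
  have hKi := hK.integrable_mul x hf
  set A := fun v => -(1 / 2) * γ ((x - v) / 2) * orient x ((x - v) / 2) * f v with hAdef
  set F : ℝ → ℝ → ℂ := fun t v => -(γ t) * K (-t) (v - x + t) * f v with hF
  have e1 : ∀ v, K x v * f v = A v + ∫ t in (0 : ℝ)..x, F t v := by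
    intro v
    rw [hAdef, hF]
    simp only [intervalIntegral.integral_mul_const]
    rw [hK.eq x v]; ring
  have hBi : Integrable fun v => ∫ t in (0 : ℝ)..x, F t v := by
    refine (hKi.sub hA).congr (Eventually.of_forall fun v => ?_)
    simp only [Pi.sub_apply, e1]; ring
  -- The source term supplies the point value `f (-t + (x - t))` inside `act K (-t)`; the integral
  -- term supplies the rest.
  have e2 : ∫ v, A v = -∫ t in (0 : ℝ)..x, γ t * f (-t + (x - t)) := by
    have : A = fun v => -(1 / 2) * (fun t => orient x t * (γ t * f (-t + (x - t)))) ((x - v) / 2) := by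
      ext v
      simp only [hAdef]
      rw [show -((x - v) / 2) + (x - (x - v) / 2) = v by ring]; ring
    rw [this, MeasureTheory.integral_const_mul, 
      integral_comp_half_sub (fun t => orient x t * (γ t * f (-t + (x - t)))),
      intervalIntegral_eq_orient]
    ring
  obtain ⟨Cγ, hγ0, hCγ⟩ := hγ.bound |x|
  obtain ⟨CK, hK0, hCK⟩ := hK.bound |x|
  obtain ⟨Cf, hf0, hCf⟩ := hf.bound |x|
  have hsupp : ∀ t ∈ uIoc 0 x, ∀ v, |x| < |v| → K (-t) (v - x + t) = 0 := by
    intro t ht v hv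
    refine hK.support _ _ ?_
    have h1 := abs_add_abs_sub_of_mem_uIcc (uIoc_subset_uIcc ht)
    have h2 : |v| ≤ |v - x + t| + |x - t| := by
      calc |v| = |(v - x + t) + (x - t)| := by ring_nf
        _ ≤ _ := abs_add_le _ _
    rw [abs_neg]; linarith
  have hFm : Measurable (uncurry F) := by
    have h1 : Measurable fun p : ℝ × ℝ => K (-p.1) (p.2 - x + p.1) :=
      hK.measurable.comp ((measurable_fst.neg).prodMk (by fun_prop))
    exact ((hγ.measurable.comp measurable_fst).neg.mul h1).mul (hf.measurable.comp measurable_snd)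
  have e3 : ∫ v, ∫ t in (0 : ℝ)..x, F t v = ∫ t in (0 : ℝ)..x, ∫ v, F t v := by
    refine integral_intervalIntegral_swap (C := Cγ * CK * Cf) (R := |x|) hFm (fun t ht v => ?_)
      fun t ht v hv => ?_
    · rcases le_or_gt |v| |x| with hv | hv
      · have ht' := abs_le_of_mem_uIoc ht
        rw [hF, norm_mul, norm_mul, norm_neg]
        gcongr
        · exact hCγ t ht'
        · exact hCK _ _ (by rwa [abs_neg])
        · exact hCf v hv
      · simp only [hF]
        rw [hsupp t ht v hv, mul_zero, zero_mul, norm_zero]; positivity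
    · simp only [hF]
      rw [hsupp t ht v hv, mul_zero, zero_mul]
  have e4 : ∀ t, ∫ v, F t v = -(γ t * ∫ v, K (-t) v * f (v + (x - t))) := by
    intro t
    rw [← integral_add_right_eq_self (fun v => F t v) (x - t), ← neg_mul,
      ← MeasureTheory.integral_const_mul]
    refine MeasureTheory.integral_congr_ae (Eventually.of_forall fun v => ?_)
    simp only [hF]
    rw [show v + (x - t) - x + t = v by ring]; ring
  have i1 : IntervalIntegrable (fun t => γ t * f (-t + (x - t))) volume 0 x :=
    (hγ.toIsLocBdd.mul (hf.comp_continuous (r := fun t => -t + (x - t)) (by fun_prop))).intervalIntegrable _ _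
  have i2 : IntervalIntegrable (fun t => γ t * ∫ v, K (-t) v * f (v + (x - t))) volume 0 x := by
    have h1 : IntervalIntegrable (fun t => γ t * act K (-t) fun v => f (v + (x - t))) volume 0 x := by
      obtain ⟨D, hD0, hD⟩ := hf.bound (|x| + |x| + |x|)
      refine intervalIntegrable_of_measurable_of_bound (C := Cγ * (D + CK * D * (2 * |x|))) ?_ ?_
      · exact hγ.measurable.mul (hK.measurable_act measurable_neg (hf.measurable.comp (by fun_prop)))
      · intro t ht
        have ht' := abs_le_of_mem_uIoc ht
        have hb := hK.norm_act_le (x := -t) (f := fun v => f (v + (x - t))) (R := |x|) (C := CK)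
          (D := D) (by rwa [abs_neg]) (fun v => hCK _ _ (by rwa [abs_neg])) hD0 fun v hv => by
            refine hD _ ?_
            rw [abs_neg] at hv
            have := abs_add_le v (x - t)
            have := abs_sub x t
            linarith
        rw [norm_mul]
        exact mul_le_mul (hCγ t ht') hb (norm_nonneg _) hγ0
    refine (h1.sub i1).congr (fun t _ => ?_)
    simp only [act]; ring
  simp only [act]
  rw [MeasureTheory.integral_congr_ae (Eventually.of_forall e1), MeasureTheory.integral_add hA hBi, e2, e3]
  simp only [e4, mul_add]
  rw [intervalIntegral.integral_neg, intervalIntegral.integral_add i1 i2]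
  ring

lemma IsInverseTransmutation.intervalIntegrable_act (hγ : IsPotential γ)
    (hH : IsInverseTransmutation γ H) {f : ℝ → ℂ} (hf : IsLocBdd f) (s : ℝ) :
    IntervalIntegrable (fun t => act H t fun w => γ w * f (s - t - w)) volume 0 s := by
  obtain ⟨Cγ, hγ0, hCγ⟩ := hγ.bound |s|
  obtain ⟨CH, hH0, hCH⟩ := hH.bound |s|
  obtain ⟨D, hD0, hD⟩ := hf.bound (|s| + |s| + |s|)
  refine intervalIntegrable_of_measurable_of_bound
    (C := Cγ * D + CH * (Cγ * D) * (2 * |s|)) ?_ fun t ht => ?_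
  · exact hH.measurable_act measurable_id
      ((hγ.measurable.comp measurable_snd).mul (hf.measurable.comp (by fun_prop)))
  · have ht' := abs_le_of_mem_uIoc ht
    refine hH.norm_act_le ht' (fun v => hCH _ _ ht') (by positivity) fun v hv => ?_
    rw [norm_mul]
    refine mul_le_mul (hCγ v (hv.trans ht')) (hD _ ?_) (norm_nonneg _) hγ0
    have h1 := abs_sub (s - t) v
    have h2 := abs_sub s t
    linarith

/-- The same passage from kernel to operator for `H`: the source gives the point value at `w = t`,
and the substitution `w = s - z - t` gives the integral part. -/
theorem IsInverseTransmutation.act_eq (hγ : IsPotential γ) (hH : IsInverseTransmutation γ H)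
    {f : ℝ → ℂ} (hf : IsLocBdd f) (s : ℝ) :
    act H s f = f s + ∫ t in (0 : ℝ)..s, act H t fun w => γ w * f (s - t - w) := by
  have hA := (isConeKernel_source hγ (1 / 2) measurable_orient' norm_orient'_le
      fun x t h => orient'_eq_zero h).integrable_mul s hf
  have hHi := hH.integrable_mul s hf
  set A := fun z => 1 / 2 * γ ((s - z) / 2) * orient' s ((s - z) / 2) * f z with hAdef
  set F : ℝ → ℝ → ℂ := fun t z => γ (s - z - t) * H t (s - z - t) * f z with hF
  have e1 : ∀ z, H s z * f z = A z + ∫ t in (0 : ℝ)..s, F t z := by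
    intro z
    rw [hAdef, hF]
    simp only [intervalIntegral.integral_mul_const]
    rw [hH.eq s z]; ring
  have hBi : Integrable fun z => ∫ t in (0 : ℝ)..s, F t z := by
    refine (hHi.sub hA).congr (Eventually.of_forall fun z => ?_)
    simp only [Pi.sub_apply, e1]; ring
  have e2 : ∫ z, A z = ∫ t in (0 : ℝ)..s, γ t * f (s - t - t) := by
    have : A = fun z => 1 / 2 * (fun t => orient' s t * (γ t * f (s - t - t))) ((s - z) / 2) := by
      ext z
      simp only [hAdef]
      rw [show s - (s - z) / 2 - (s - z) / 2 = z by ring]; ring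
    rw [this, MeasureTheory.integral_const_mul, 
      integral_comp_half_sub (fun t => orient' s t * (γ t * f (s - t - t))),
      intervalIntegral_eq_orient,
      MeasureTheory.integral_congr_ae (g := fun t => orient s t * (γ t * f (s - t - t)))]
    · ring
    · filter_upwards [orient'_ae_eq s] with t ht
      rw [ht]
  obtain ⟨Cγ, hγ0, hCγ⟩ := hγ.bound |s|
  obtain ⟨CH, hH0, hCH⟩ := hH.bound |s|
  obtain ⟨Cf, hf0, hCf⟩ := hf.bound |s|
  have hsupp : ∀ t ∈ uIoc 0 s, ∀ z, |s| < |z| → H t (s - z - t) = 0 := by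
    intro t ht z hz
    refine hH.support _ _ ?_
    have h1 := abs_add_abs_sub_of_mem_uIcc (uIoc_subset_uIcc ht)
    have h2 : |z| ≤ |s - t| + |s - z - t| := by
      calc |z| = |(s - t) - (s - z - t)| := by ring_nf
        _ ≤ _ := abs_sub _ _
    linarith
  have hFm : Measurable (uncurry F) := by
    have h1 : Measurable fun p : ℝ × ℝ => H p.1 (s - p.2 - p.1) :=
      hH.measurable.comp (measurable_fst.prodMk
        (show Measurable fun p : ℝ × ℝ => s - p.2 - p.1 by fun_prop))
    have h2 : Measurable fun p : ℝ × ℝ => γ (s - p.2 - p.1) :=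
      hγ.measurable.comp (show Measurable fun p : ℝ × ℝ => s - p.2 - p.1 by fun_prop)
    exact (h2.mul h1).mul (hf.measurable.comp measurable_snd)
  have e3 : ∫ z, ∫ t in (0 : ℝ)..s, F t z = ∫ t in (0 : ℝ)..s, ∫ z, F t z := by
    refine integral_intervalIntegral_swap (C := Cγ * CH * Cf) (R := |s|) hFm (fun t ht z => ?_)
      fun t ht z hz => ?_
    · have ht' := abs_le_of_mem_uIoc ht
      by_cases hz : |z| ≤ |s| ∧ |s - z - t| ≤ |t|
      · rw [hF, norm_mul, norm_mul]
        gcongr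
        · exact hCγ _ (hz.2.trans ht')
        · exact hCH _ _ ht'
        · exact hCf z hz.1
      · have : H t (s - z - t) = 0 := by
          rw [not_and_or, not_le, not_le] at hz
          rcases hz with h | h
          · exact hsupp t ht z h
          · exact hH.support _ _ h
        simp only [hF]
        rw [this, mul_zero, zero_mul, norm_zero]; positivity
    · simp only [hF]
      rw [hsupp t ht z hz, mul_zero, zero_mul]
  have e4 : ∀ t, ∫ z, F t z = ∫ w, H t w * (γ w * f (s - t - w)) := by
    intro t
    rw [← integral_sub_left_eq_self (fun z => F t z) volume (s - t)]
    refine MeasureTheory.integral_congr_ae (Eventually.of_forall fun v => ?_)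
    simp only [hF]
    rw [show s - (s - t - v) - t = v by ring]; ring
  have i1 : IntervalIntegrable (fun t => γ t * f (s - t - t)) volume 0 s :=
    (hγ.toIsLocBdd.mul (hf.comp_continuous (r := fun t => s - t - t) (by fun_prop))).intervalIntegrable _ _
  have i2 : IntervalIntegrable (fun t => ∫ w, H t w * (γ w * f (s - t - w))) volume 0 s := by
    refine ((hH.intervalIntegrable_act hγ hf s).sub i1).congr (fun t _ => ?_)
    simp only [act]; ring
  simp only [act]
  rw [MeasureTheory.integral_congr_ae (Eventually.of_forall e1), MeasureTheory.integral_add hA hBi, e2, e3]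
  simp only [e4]
  rw [intervalIntegral.integral_add i1 i2]

end SpectralFn

/-! ### Uniqueness for Volterra equations, the solutions of the scalar problem, and the relations
between the kernels. -/

namespace SpectralFn
open Set Function Real intervalIntegral

/-- Fubini on the triangle `0 < t < r ≤ s`. -/
lemma intervalIntegral_triangle_of_nonneg {G : ℝ → ℝ → ℂ} {s C : ℝ} (hs : 0 ≤ s)
    (hG : Measurable (uncurry G)) (hC : ∀ t r, |t| ≤ |s| → |r| ≤ |s| → ‖G t r‖ ≤ C) :
    ∫ t in (0 : ℝ)..s, ∫ r in t..s, G t r = ∫ r in (0 : ℝ)..s, ∫ t in (0 : ℝ)..r, G t r := by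
  set S : Set (ℝ × ℝ) := {p | 0 < p.1 ∧ p.1 < p.2 ∧ p.2 ≤ s} with hS
  have hSm : MeasurableSet S :=
    (measurableSet_lt measurable_const measurable_fst).inter
      ((measurableSet_lt measurable_fst measurable_snd).inter
        (measurableSet_le measurable_snd measurable_const))
  have hC0 : 0 ≤ C := (norm_nonneg _).trans (hC 0 0 (by simp) (by simp))
  have hint : Integrable (uncurry fun t r => S.indicator (uncurry G) (t, r))
      (volume.prod volume) := by
    have h0 : ∀ p : ℝ × ℝ, |s| < |p.1| ∨ |s| < |p.2| → p ∉ S := by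
      rintro ⟨t, r⟩ h ⟨h1, h2, h3⟩
      simp only at h1 h2 h3 h
      rw [abs_of_nonneg hs, abs_of_pos h1, abs_of_pos (h1.trans h2)] at h
      rcases h with h | h <;> linarith
    refine integrable_of_bounded_box (R := |s|) (C := C)
      ((hG.indicator hSm).aestronglyMeasurable) (fun p => ?_) fun p hp => ?_
    · by_cases h : p ∈ S
      · have h' : ¬(|s| < |p.1| ∨ |s| < |p.2|) := fun h' => h0 p h' h
        push Not at h'
        simp only [uncurry, Prod.mk.eta, indicator_of_mem h]
        exact hC _ _ h'.1 h'.2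
      · simp only [uncurry, Prod.mk.eta, indicator_of_notMem h, norm_zero, hC0]
    · simp only [uncurry, Prod.mk.eta, indicator_of_notMem (h0 p hp)]
  have e1 : ∫ t in (0 : ℝ)..s, ∫ r in t..s, G t r =
      ∫ t, ∫ r, S.indicator (uncurry G) (t, r) := by
    rw [integral_of_le hs, ← MeasureTheory.integral_indicator measurableSet_Ioc]
    refine MeasureTheory.integral_congr_ae (Eventually.of_forall fun t => ?_)
    by_cases ht : t ∈ Ioc 0 s
    · simp only [indicator_of_mem ht]
      rw [integral_of_le ht.2, ← MeasureTheory.integral_indicator measurableSet_Ioc]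
      refine MeasureTheory.integral_congr_ae (Eventually.of_forall fun r => ?_)
      by_cases hr : r ∈ Ioc t s
      · simp only [indicator_of_mem hr]
        rw [indicator_of_mem (show (t, r) ∈ S from ⟨ht.1, hr⟩)]; rfl
      · simp only [indicator_of_notMem hr]
        rw [indicator_of_notMem fun h : (t, r) ∈ S => hr h.2]
    · simp only [indicator_of_notMem ht]
      rw [MeasureTheory.integral_congr_ae (g := fun _ => 0), MeasureTheory.integral_zero]
      refine Eventually.of_forall fun r => indicator_of_notMem (fun h : (t, r) ∈ S => ht ?_) _
      exact ⟨h.1, (h.2.1.trans_le h.2.2).le⟩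
  have e2 : ∫ r in (0 : ℝ)..s, ∫ t in (0 : ℝ)..r, G t r =
      ∫ r, ∫ t, S.indicator (uncurry G) (t, r) := by
    rw [integral_of_le hs, ← MeasureTheory.integral_indicator measurableSet_Ioc]
    refine MeasureTheory.integral_congr_ae (Eventually.of_forall fun r => ?_)
    by_cases hr : r ∈ Ioc 0 s
    · simp only [indicator_of_mem hr]
      rw [integral_of_le hr.1.le, integral_Ioc_eq_integral_Ioo,
        ← MeasureTheory.integral_indicator measurableSet_Ioo]
      refine MeasureTheory.integral_congr_ae (Eventually.of_forall fun t => ?_)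
      by_cases ht : t ∈ Ioo 0 r
      · simp only [indicator_of_mem ht]
        rw [indicator_of_mem (show (t, r) ∈ S from ⟨ht.1, ht.2, hr.2⟩)]; rfl
      · simp only [indicator_of_notMem ht]
        rw [indicator_of_notMem fun h : (t, r) ∈ S => ht ⟨h.1, h.2.1⟩]
    · simp only [indicator_of_notMem hr]
      rw [MeasureTheory.integral_congr_ae (g := fun _ => 0), MeasureTheory.integral_zero]
      refine Eventually.of_forall fun t => indicator_of_notMem (fun h : (t, r) ∈ S => hr ?_) _
      exact ⟨h.1.trans h.2.1, h.2.2⟩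
  rw [e1, e2]
  exact MeasureTheory.integral_integral_swap hint

lemma intervalIntegral_triangle {G : ℝ → ℝ → ℂ} {s C : ℝ}
    (hG : Measurable (uncurry G)) (hC : ∀ t r, |t| ≤ |s| → |r| ≤ |s| → ‖G t r‖ ≤ C) :
    ∫ t in (0 : ℝ)..s, ∫ r in t..s, G t r = ∫ r in (0 : ℝ)..s, ∫ t in (0 : ℝ)..r, G t r := by
  rcases le_total 0 s with hs | hs
  · exact intervalIntegral_triangle_of_nonneg hs hG hC
  · have h := intervalIntegral_triangle_of_nonneg (G := fun t r => G (-t) (-r)) (s := -s) (C := C)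
      (by linarith) (hG.comp (by fun_prop : Measurable fun p : ℝ × ℝ => (-p.1, -p.2)))
      (fun t r ht hr => hC _ _ (by simpa using ht) (by simpa using hr))
    have e1 : ∀ t, ∫ r in t..(-s), G (-t) (-r) = -∫ r in (-t)..s, G (-t) r := by
      intro t
      rw [intervalIntegral.integral_comp_neg (fun r => G (-t) r), neg_neg, integral_symm]
    have e2 : ∀ r, ∫ t in (0 : ℝ)..r, G (-t) (-r) = -∫ t in (0 : ℝ)..(-r), G t (-r) := by
      intro r
      rw [intervalIntegral.integral_comp_neg (fun t => G t (-r)), neg_zero, integral_symm]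
    simp only [e1, e2, intervalIntegral.integral_neg, neg_inj] at h
    rw [intervalIntegral.integral_comp_neg (fun t => ∫ r in t..s, G t r),
      intervalIntegral.integral_comp_neg (fun r => ∫ t in (0 : ℝ)..r, G t r), neg_neg, neg_zero,
      integral_symm, integral_symm (a := 0)] at h
    exact neg_inj.1 h

lemma IsConeKernel.act_intervalIntegral {W : ℝ → ℝ → ℂ} (hW : IsConeKernel W) {F : ℝ → ℝ → ℂ}
    {x c C : ℝ} (hF : Measurable (uncurry F))
    (hC : ∀ r ∈ uIoc 0 c, ∀ w, |w| ≤ |x| → ‖F r w‖ ≤ C) :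
    act W x (fun w => ∫ r in (0 : ℝ)..c, F r w) = ∫ r in (0 : ℝ)..c, act W x (F r) := by
  obtain ⟨D, hD0, hD⟩ := hW.bound |x|
  have hb : ∀ r ∈ uIoc 0 c, ∀ w, ‖W x w * F r w‖ ≤ D * C := by
    intro r hr w
    have hC0 : 0 ≤ C := (norm_nonneg _).trans (hC r hr x le_rfl)
    rcases le_or_gt |w| |x| with hw | hw
    · rw [norm_mul]
      exact mul_le_mul (hD x w le_rfl) (hC r hr w hw) (norm_nonneg _) hD0
    · rw [hW.support _ _ hw, zero_mul, norm_zero]; positivity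
  have hm : Measurable (uncurry fun r w => W x w * F r w) :=
    ((hW.measurable_right x).comp measurable_snd).mul hF
  have i1 : IntervalIntegrable (fun r => F r x) volume 0 c :=
    intervalIntegrable_of_measurable_of_bound (C := C)
      (hF.comp (measurable_id.prodMk measurable_const)) fun r hr => hC r hr x le_rfl
  have i2 : IntervalIntegrable (fun r => ∫ w, W x w * F r w) volume 0 c := by
    have i3 : IntervalIntegrable (fun r => act W x (F r)) volume 0 c :=
      intervalIntegrable_of_measurable_of_bound (C := C + D * C * (2 * |x|))
        (hW.measurable_act measurable_const hF) fun r hr =>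
          hW.norm_act_le le_rfl (fun v => hD _ _ le_rfl)
            ((norm_nonneg _).trans (hC r hr x le_rfl)) (hC r hr)
    refine (i3.sub i1).congr (fun r _ => ?_)
    simp [act]
  simp only [act]
  rw [intervalIntegral.integral_add i1 i2, ← integral_intervalIntegral_swap hm hb
    (R := |x|) fun r hr w hw => by rw [hW.support _ _ hw, zero_mul]]
  simp only [intervalIntegral.integral_const_mul]

/-- Uniqueness for homogeneous Volterra equations. -/
theorem volterra_unique {ι : Type*} {f : ℝ → ι → ℂ} {S : ℝ → ι → Prop} {C M : ℝ}
    (hC : ∀ x i, S x i → ‖f x i‖ ≤ C)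
    (h : ∀ x i, S x i → ∃ g : ℝ → ℂ, f x i = ∫ t in (0 : ℝ)..x, g t ∧
      ∀ t ∈ uIoc 0 x, ∃ j, S (-t) j ∧ ‖g t‖ ≤ M * ‖f (-t) j‖)
    {x : ℝ} {i : ι} (hS : S x i) : f x i = 0 := by
  have hC0 : 0 ≤ C := (norm_nonneg _).trans (hC x i hS)
  -- The weight again makes every application of the equation halve the bound, so all powers of `1 /
  -- 2` are admissible. The index may change from `i` to `j` as long as the region `S` is preserved.
  set l := 2 * (|M| + 1) with hl
  have hlpos : 0 < l := by positivity
  have main : ∀ (n : ℕ) x i, S x i → ‖f x i‖ ≤ C * (1 / 2) ^ n * exp (l * |x|) := by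
    intro n
    induction n with
    | zero =>
      intro x i hS
      have h1 : 1 ≤ exp (l * |x|) := one_le_exp (by positivity)
      refine (hC x i hS).trans ?_
      rw [pow_zero, mul_one]; nlinarith
    | succ n ih =>
      intro x i hS
      obtain ⟨g, hg, hgt⟩ := h x i hS
      rw [hg]
      refine (norm_integral_le_exp_abs (A := C * (1 / 2) ^ n * (l / 2)) hlpos (by positivity)
        fun t ht => ?_).trans (le_of_eq ?_)
      · obtain ⟨j, hj, hb⟩ := hgt t ht
        have h2 := ih _ _ hj
        rw [abs_neg] at h2
        calc ‖g t‖ ≤ M * ‖f (-t) j‖ := hb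
          _ ≤ (|M| + 1) * (C * (1 / 2) ^ n * exp (l * |t|)) := by
            gcongr
            linarith [le_abs_self M]
          _ = _ := by rw [hl]; ring
      · rw [pow_succ]; field_simp
  have hlim : Tendsto (fun n : ℕ => C * (1 / 2) ^ n * exp (l * |x|)) atTop (𝓝 0) := by
    have := ((tendsto_pow_atTop_nhds_zero_of_lt_one (r := (1 / 2 : ℝ)) (by norm_num)
      (by norm_num)).const_mul C).mul_const (exp (l * |x|))
    simpa using this
  have := ge_of_tendsto' hlim fun n => main n x i hS
  exact norm_le_zero_iff.1 this

variable {γ : ℝ → ℂ} {K H : ℝ → ℝ → ℂ}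

/-- The solution of the reduced scalar problem. -/
noncomputable def psi (K : ℝ → ℝ → ℂ) (ρ : ℂ) (x : ℝ) : ℂ :=
  act K x fun v => Complex.exp (Complex.I * ρ * v)

lemma isLocBdd_cexp (ρ : ℂ) : IsLocBdd fun v : ℝ => Complex.exp (Complex.I * ρ * v) :=
  IsLocBdd.of_continuous (by fun_prop)

lemma IsConeKernel.isLocBdd_psi (hK : IsConeKernel K) (ρ : ℂ) : IsLocBdd (psi K ρ) :=
  hK.isLocBdd_act (isLocBdd_cexp ρ)

lemma IsTransmutation.psi_eq (hγ : IsPotential γ) (hK : IsTransmutation γ K) (ρ : ℂ) (x : ℝ) :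
    psi K ρ x = Complex.exp (Complex.I * ρ * x) -
      ∫ t in (0 : ℝ)..x, Complex.exp (Complex.I * ρ * (x - t)) * (γ t * psi K ρ (-t)) := by
  rw [psi, hK.act_eq hγ (isLocBdd_cexp ρ)]
  congr 1
  refine intervalIntegral.integral_congr fun t _ => ?_
  simp only [psi]
  rw [mul_left_comm, ← act_const_mul K (-t) (Complex.exp _)]
  refine congrArg (γ t * ·) (congrArg (act K (-t)) (funext fun v => ?_))
  rw [← Complex.exp_add]
  congr 1
  push_cast; ring

lemma IsTransmutation.isLocBdd_rhs (hγ : IsPotential γ) (hK : IsTransmutation γ K) (ρ : ℂ) :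
    IsLocBdd fun t => γ t * psi K ρ (-t) :=
  hγ.toIsLocBdd.mul ((hK.isLocBdd_psi ρ).comp_continuous continuous_neg)

/-- Duhamel's formula started at `b` instead of `0`, by subtracting the formulas for `a` and `b`. -/
lemma IsTransmutation.psi_eq_base (hγ : IsPotential γ) (hK : IsTransmutation γ K) (ρ : ℂ)
    (a b : ℝ) :
    psi K ρ a = Complex.exp (Complex.I * ρ * (a - b)) * psi K ρ b -
      ∫ t in b..a, Complex.exp (Complex.I * ρ * (a - t)) * (γ t * psi K ρ (-t)) := by
  have hi : ∀ c d e : ℝ, IntervalIntegrable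
      (fun t : ℝ => Complex.exp (Complex.I * ρ * (c - t)) * (γ t * psi K ρ (-t))) volume d e :=
    fun c d e => ((IsLocBdd.of_continuous (by fun_prop)).mul
      (hK.isLocBdd_rhs hγ ρ)).intervalIntegrable _ _
  have e1 : Complex.exp (Complex.I * ρ * (a - b)) * psi K ρ b = Complex.exp (Complex.I * ρ * a) -
      ∫ t in (0 : ℝ)..b, Complex.exp (Complex.I * ρ * (a - t)) * (γ t * psi K ρ (-t)) := by
    rw [hK.psi_eq hγ ρ b, mul_sub, ← Complex.exp_add, ← intervalIntegral.integral_const_mul]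
    congr 1
    · congr 1; ring
    · refine intervalIntegral.integral_congr fun t _ => ?_
      rw [← mul_assoc, ← Complex.exp_add]
      congr 2; ring
  rw [hK.psi_eq hγ ρ a, e1, ← intervalIntegral.integral_interval_sub_left (hi a 0 a) (hi a 0 b)]
  ring

lemma act_sub {W : ℝ → ℝ → ℂ} (hW : IsConeKernel W) (x : ℝ) {f g : ℝ → ℂ} (hf : IsLocBdd f)
    (hg : IsLocBdd g) : act W x (fun v => f v - g v) = act W x f - act W x g := by
  simp only [act, mul_sub]
  rw [MeasureTheory.integral_sub (hW.integrable_mul x hf) (hW.integrable_mul x hg)]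
  ring

/-- The exponential is recovered from the solutions of the reduced problem. -/
theorem IsInverseTransmutation.act_psi (hγ : IsPotential γ) (hK : IsTransmutation γ K)
    (hH : IsInverseTransmutation γ H) (ρ : ℂ) (s : ℝ) :
    act H s (psi K ρ) = Complex.exp (Complex.I * ρ * s) := by
  set g : ℝ → ℂ := fun t => γ t * psi K ρ (-t) with hg
  have hgl : IsLocBdd g := hK.isLocBdd_rhs hγ ρ
  set e : ℝ → ℂ := fun t => Complex.exp (Complex.I * ρ * t) with he
  have hel : IsLocBdd e := isLocBdd_cexp ρ
  have hec : Continuous e := by fun_prop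
  set J : ℝ → ℝ → ℂ := fun t r => act H t fun w => γ w * g (r - t - w) with hJ
  have hJm : Measurable (uncurry J) := hH.measurable_act (a := fun p : ℝ × ℝ => p.1) measurable_fst
    (f := fun p w => γ w * g (p.2 - p.1 - w))
    ((hγ.measurable.comp measurable_snd).mul (hgl.measurable.comp
      (show Measurable fun q : (ℝ × ℝ) × ℝ => q.1.2 - q.1.1 - q.2 by fun_prop)))
  obtain ⟨Cγ, hγ0, hCγ⟩ := hγ.bound |s|
  obtain ⟨CH, hH0, hCH⟩ := hH.bound |s|
  obtain ⟨Cg, hg0, hCg⟩ := hgl.bound (|s| + |s| + |s|)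
  obtain ⟨Ce, he0, hCe⟩ := hel.bound (|s| + |s|)
  have hJb : ∀ t r, |t| ≤ |s| → |r| ≤ |s| → ‖J t r‖ ≤ Cγ * Cg + CH * (Cγ * Cg) * (2 * |s|) := by
    intro t r ht hr
    refine hH.norm_act_le ht (fun v => hCH _ _ ht) (by positivity) fun v hv => ?_
    rw [norm_mul]
    refine mul_le_mul (hCγ v (hv.trans ht)) (hCg _ ?_) (norm_nonneg _) hγ0
    have h1 := abs_sub (r - t) v
    have h2 := abs_sub r t
    linarith
  -- expansion of the integrand
  have key : ∀ t ∈ uIcc 0 s, act H t (fun w => γ w * psi K ρ (s - t - w)) =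
      e (s - t) * act H t g - ∫ r in t..s, e (s - r) * J t r := by
    intro t ht
    have ht' := abs_le_of_mem_uIcc ht
    have hsum := abs_add_abs_sub_of_mem_uIcc ht
    have h1 : ∀ w, γ w * psi K ρ (s - t - w) = e (s - t) * g w -
        ∫ r in (0 : ℝ)..(s - t), e (s - t - r) * (γ w * g (r - w)) := by
      intro w
      -- The base point `-w` is chosen so that the leading term contains `γ w * psi K ρ (-w) = g w`
      -- and its exponential factor no longer depends on `w`.
      rw [hK.psi_eq_base hγ ρ (s - t - w) (-w)]
      have h2 : ∫ r in (-w)..(s - t - w),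
          Complex.exp (Complex.I * ρ * ((s - t - w : ℝ) - r)) * (γ r * psi K ρ (-r)) =
          ∫ r in (0 : ℝ)..(s - t), e (s - t - r) * g (r - w) := by
        have := intervalIntegral.integral_comp_sub_right (a := 0) (b := s - t)
          (fun r => Complex.exp (Complex.I * ρ * ((s - t - w : ℝ) - r)) * (γ r * psi K ρ (-r))) w
        rw [zero_sub] at this
        rw [← this]
        refine intervalIntegral.integral_congr fun r _ => ?_
        simp only [he, hg]
        congr 2; push_cast; ring
      rw [h2, mul_sub, ← intervalIntegral.integral_const_mul]
      congr 1
      · simp only [he, hg]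
        rw [mul_left_comm]
        congr 2; push_cast; ring
      · refine intervalIntegral.integral_congr fun r _ => ?_
        ring
    have hFm : Measurable (uncurry fun r w => e (s - t - r) * (γ w * g (r - w))) :=
      (hel.measurable.comp (by fun_prop : Measurable fun p : ℝ × ℝ => s - t - p.1)).mul
        ((hγ.measurable.comp measurable_snd).mul
          (hgl.measurable.comp (by fun_prop : Measurable fun p : ℝ × ℝ => p.1 - p.2)))
    have hFb : ∀ r ∈ uIoc 0 (s - t), ∀ w, |w| ≤ |t| →
        ‖e (s - t - r) * (γ w * g (r - w))‖ ≤ Ce * (Cγ * Cg) := by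
      intro r hr w hw
      have hr' := abs_le_of_mem_uIoc hr
      rw [norm_mul, norm_mul]
      gcongr
      · refine hCe _ ?_
        have := abs_sub (s - t) r
        have := abs_nonneg t
        linarith [abs_nonneg (s - t)]
      · exact hCγ _ (hw.trans ht')
      · refine hCg _ ?_
        have := abs_sub r w
        linarith [abs_nonneg (s - t), abs_nonneg t]
    have hmint : IsLocBdd fun w => ∫ r in (0 : ℝ)..(s - t), e (s - t - r) * (γ w * g (r - w)) := by
      have : (fun w => ∫ r in (0 : ℝ)..(s - t), e (s - t - r) * (γ w * g (r - w))) =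
          fun w => e (s - t) * g w - γ w * psi K ρ (s - t - w) := by
        ext w; rw [h1]; ring
      rw [this]
      have i1 : IsLocBdd fun w => e (s - t) * g w := (IsLocBdd.of_continuous continuous_const).mul hgl
      have i2 : IsLocBdd fun w => γ w * psi K ρ (s - t - w) := hγ.toIsLocBdd.mul
        ((hK.isLocBdd_psi ρ).comp_continuous (r := fun w => s - t - w) (by fun_prop))
      refine ⟨i1.measurable.sub i2.measurable, fun R => ?_⟩
      obtain ⟨C1, h10, h1⟩ := i1.bound R
      obtain ⟨C2, h20, h2⟩ := i2.bound R
      exact ⟨C1 + C2, by positivity, fun x hx => (norm_sub_le _ _).trans (add_le_add (h1 x hx) (h2 x hx))⟩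
    rw [funext h1, act_sub hH.toIsConeKernel t ((IsLocBdd.of_continuous continuous_const).mul hgl) hmint,
      act_const_mul, hH.act_intervalIntegral hFm hFb]
    congr 1
    have h3 := intervalIntegral.integral_comp_add_left (a := 0) (b := s - t)
      (fun r => e (s - r) * J t r) t
    rw [add_zero, add_sub_cancel] at h3
    rw [← h3]
    refine intervalIntegral.integral_congr fun r _ => ?_
    simp only [hJ]
    rw [act_const_mul]
    congr 1
    · congr 1; ring
    · congr 1
      ext w
      congr 2; ring
  have hagl : IsLocBdd fun t => act H t g := hH.isLocBdd_act hgl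
  have hesl : IsLocBdd fun t => e (s - t) := hel.comp_continuous (r := fun t => s - t) (by fun_prop)
  have i1 : IntervalIntegrable (fun t => e (s - t) * act H t g) volume 0 s :=
    (hesl.mul hagl).intervalIntegrable _ _
  have i2 : IntervalIntegrable (fun t => ∫ r in t..s, e (s - r) * J t r) volume 0 s := by
    refine (i1.sub (hH.intervalIntegrable_act hγ (hK.isLocBdd_psi ρ) s)).congr fun t ht => ?_
    simp only [key t (uIoc_subset_uIcc ht)]; ring
  -- After the exchange of order the inner integral `∫₀ʳ J t r dt` equals `act H r g - g r` by
  -- `act_eq` for `g`. The terms with `act H · g` then cancel, and what is left is the Duhamel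
  -- integral of `Ψ(s)` with the opposite sign.
  have tri : ∫ t in (0 : ℝ)..s, ∫ r in t..s, e (s - r) * J t r =
      ∫ r in (0 : ℝ)..s, e (s - r) * (act H r g - g r) := by
    rw [intervalIntegral_triangle (C := Ce * (Cγ * Cg + CH * (Cγ * Cg) * (2 * |s|)))]
    · refine intervalIntegral.integral_congr fun r _ => ?_
      rw [intervalIntegral.integral_const_mul, hH.act_eq hγ hgl r]
      ring
    · exact (hesl.measurable.comp measurable_snd).mul hJm
    · intro t r ht hr
      rw [norm_mul]
      refine mul_le_mul (hCe _ ?_) (hJb t r ht hr) (norm_nonneg _) he0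
      have := abs_sub s r
      linarith
  have i3 : IntervalIntegrable (fun t => e (s - t) * g t) volume 0 s :=
    (hesl.mul hgl).intervalIntegrable _ _
  rw [hH.act_eq hγ (hK.isLocBdd_psi ρ), intervalIntegral.integral_congr key,
    intervalIntegral.integral_sub i1 i2, tri]
  simp only [mul_sub]
  rw [intervalIntegral.integral_sub i1 i3, hK.psi_eq hγ ρ s]
  have : ∫ t in (0 : ℝ)..s, e (s - t) * g t = ∫ t in (0 : ℝ)..s,
      Complex.exp (Complex.I * ρ * (s - t)) * (γ t * psi K ρ (-t)) := by
    refine intervalIntegral.integral_congr fun r _ => ?_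
    simp only [he, hg]
    push_cast; rfl
  rw [this]; ring

/-- At `c = (s + x) / 2` the conditions `c < s` and `x < c` are equivalent, so the indicators of
complementary cases add up to that of `s + x`. The opposite endpoint conventions of `orient` and
`orient'` make this exact also when `c = x`. -/
lemma orient_add_orient' {s x : ℝ} (h : s + x ≠ 0) :
    orient' s ((s + x) / 2) - orient' (s + x) ((s + x) / 2) + orient x ((s + x) / 2) = 0 := by
  set c := (s + x) / 2 with hc
  have hs : s = 2 * c - x := by rw [hc]; ring
  rcases lt_or_gt_of_ne (show c ≠ 0 by rw [hc]; exact div_ne_zero h two_ne_zero) with h1 | h1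
  · have a1 : ∀ y, orient' y c = -if y ≤ c then 1 else 0 := fun y => by
      have : ¬ 0 ≤ c := not_le.2 h1
      simp [orient', indicator, this, h1]
    have a2 : orient x c = -if x < c then 1 else 0 := by
      have : ¬ 0 < c := not_lt.2 h1.le
      simp [orient, indicator, this, h1.le]
    rw [a1, a1, a2, if_pos (show s + x ≤ c by linarith)]
    rcases lt_or_ge x c with h2 | h2
    · rw [if_neg (by linarith), if_pos h2]; ring
    · rw [if_pos (by linarith), if_neg (not_lt.2 h2)]; ring
  · have a1 : ∀ y, orient' y c = if c < y then 1 else 0 := fun y => by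
      have : ¬ c < 0 := not_lt.2 h1.le
      simp [orient', indicator, this, h1.le]
    have a2 : orient x c = if c ≤ x then 1 else 0 := by
      have : ¬ c ≤ 0 := not_le.2 h1
      simp [orient, indicator, this, h1]
    rw [a1, a1, a2, if_pos (show c < s + x by linarith)]
    rcases le_or_gt c x with h2 | h2
    · rw [if_neg (by linarith), if_pos h2]; ring
    · rw [if_pos (by linarith), if_neg (not_le.2 h2)]; ring

/-- Both kernels are determined by the trace `H(·, 0)`. -/
theorem IsInverseTransmutation.eq_act (hγ : IsPotential γ) (hK : IsTransmutation γ K)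
    (hH : IsInverseTransmutation γ H) (x s : ℝ) :
    H s (-x) = K x (-s) + act K x fun v => H (s + v) 0 := by
  set h : ℝ → ℂ := fun s => H s 0 with hh
  have hl : IsLocBdd h := ⟨hH.measurable.comp (measurable_id.prodMk measurable_const), fun R => by
    obtain ⟨C, hC0, hC⟩ := hH.bound R
    exact ⟨C, hC0, fun x hx => hC x 0 hx⟩⟩
  have hsh : ∀ s, IsLocBdd fun v => h (s + v) := fun s =>
    hl.comp_continuous (r := fun v => s + v) (by fun_prop)
  set R := |x| + |s| with hR
  -- The defect satisfies `D x s = -∫₀ˣ γ t * D (-t) (s + x - t) dt`. The region `|x| + |s| ≤ R` is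
  -- invariant under `(x, s) ↦ (-t, s + x - t)`, so uniqueness applies with `s` as the moving index.
  set D : ℝ → ℝ → ℂ := fun x s => H s (-x) - K x (-s) - act K x fun v => h (s + v) with hD
  obtain ⟨Cγ, hγ0, hCγ⟩ := hγ.bound R
  obtain ⟨CH, hH0, hCH⟩ := hH.bound R
  obtain ⟨CK, hK0, hCK⟩ := hK.bound R
  obtain ⟨Ch, hh0, hCh⟩ := hl.bound R
  have hbact : ∀ x s, |x| + |s| ≤ R → ‖act K x fun v => h (s + v)‖ ≤ Ch + CK * Ch * (2 * R) := by
    intro x s hxs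
    have hx : |x| ≤ R := by linarith [abs_nonneg s]
    refine hK.norm_act_le hx (fun v => hCK _ _ hx) hh0 fun v hv => hCh _ ?_
    linarith [abs_add_le s v]
  have hreg : ∀ x s t : ℝ, |x| + |s| ≤ R → t ∈ uIoc 0 x → |-t| + |s + x - t| ≤ R := by
    intro x s t hxs ht
    have h1 := abs_add_abs_sub_of_mem_uIcc (uIoc_subset_uIcc ht)
    have h2 := abs_add_le s (x - t)
    rw [abs_neg, show s + x - t = s + (x - t) by ring]
    linarith
  have main : D x s = 0 := by
    refine volterra_unique (S := fun x s => |x| + |s| ≤ R)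
      (C := CH + CK + (Ch + CK * Ch * (2 * R))) (M := Cγ) ?_ ?_ le_rfl
    · intro x s hxs
      have hx : |x| ≤ R := by linarith [abs_nonneg s]
      have hs : |s| ≤ R := by linarith [abs_nonneg x]
      refine (norm_sub_le _ _).trans (add_le_add ((norm_sub_le _ _).trans
        (add_le_add (hCH _ _ hs) (hCK _ _ hx))) (hbact x s hxs))
    · intro x s hxs
      refine ⟨fun t => -(γ t * D (-t) (s + x - t)), ?_, fun t ht => ⟨s + x - t, hreg x s t hxs ht, ?_⟩⟩
      · have j1 : IntervalIntegrable (fun t => γ t * H (s + x - t) t) volume 0 x := by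
          refine intervalIntegrable_of_measurable_of_bound (C := Cγ * CH)
            (hγ.measurable.mul (hH.measurable.comp
              (show Measurable fun t : ℝ => (s + x - t, t) by fun_prop))) fun t ht => ?_
          have h1 := hreg x s t hxs ht
          rw [abs_neg] at h1
          rw [norm_mul]
          exact mul_le_mul (hCγ _ (by linarith [abs_nonneg (s + x - t)]))
            (hCH _ _ (by linarith [abs_nonneg t])) (norm_nonneg _) hγ0
        have j2 : IntervalIntegrable (fun t => γ t * K (-t) (-(s + x - t))) volume 0 x := by
          refine intervalIntegrable_of_measurable_of_bound (C := Cγ * CK)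
            (hγ.measurable.mul (hK.measurable.comp
              (show Measurable fun t : ℝ => (-t, -(s + x - t)) by fun_prop))) fun t ht => ?_
          have h1 := hreg x s t hxs ht
          rw [norm_mul]
          refine mul_le_mul (hCγ _ ?_)
            (hCK _ _ (by linarith [abs_nonneg (s + x - t)])) (norm_nonneg _) hγ0
          rw [abs_neg] at h1
          linarith [abs_nonneg (s + x - t)]
        have j3 : IntervalIntegrable (fun t => γ t * act K (-t) fun v => h (s + x - t + v))
            volume 0 x := by
          refine intervalIntegrable_of_measurable_of_bound (C := Cγ * (Ch + CK * Ch * (2 * R)))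
            (hγ.measurable.mul (hK.measurable_act measurable_neg
              (f := fun t v => h (s + x - t + v)) (hl.measurable.comp
              (show Measurable fun p : ℝ × ℝ => s + x - p.1 + p.2 by fun_prop)))) fun t ht => ?_
          have h1 := hreg x s t hxs ht
          rw [norm_mul]
          refine mul_le_mul (hCγ _ ?_) (hbact _ _ h1) (norm_nonneg _) hγ0
          rw [abs_neg] at h1
          linarith [abs_nonneg (s + x - t)]
        -- rewriting the defining equations
        have hshift : ∀ s z : ℝ, H s z = 1 / 2 * γ ((s - z) / 2) * orient' s ((s - z) / 2) +
            ∫ t in (-z)..(s - z), γ t * H (s - z - t) t := by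
          intro s z
          have := intervalIntegral.integral_comp_sub_left (a := 0) (b := s)
            (fun t => γ t * H (s - z - t) t) (s - z)
          rw [hH.eq s z]
          congr 1
          rw [sub_zero, show s - z - s = -z by ring] at this
          rw [← this]
          refine intervalIntegral.integral_congr fun t _ => ?_
          simp only [sub_sub_cancel]
        have hHall : ∀ a b c : ℝ, IntervalIntegrable (fun t => γ t * H (a - t) t) volume b c := by
          intro a b c
          refine (hγ.toIsLocBdd.mul (g := fun t => H (a - t) t) ⟨hH.measurable.comp
            (show Measurable fun t : ℝ => (a - t, t) by fun_prop), fun S => ?_⟩).intervalIntegrable _ _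
          obtain ⟨C, hC0, hC⟩ := hH.bound (|a| + S)
          exact ⟨C, hC0, fun t ht => hC _ _ ((abs_sub a t).trans (by linarith))⟩
        -- Written with the variable `s - z - t`, the integrand depends on `s` and `z` only through
        -- `s - z`. Hence `H s (-x)` and `H (s + x) 0` have the same integrand, over `x..s + x` and
        -- `0..s + x`, and differ by an integral over `0..x`.
        have e1 : H s (-x) - h (s + x) = 1 / 2 * γ ((s + x) / 2) *
            (orient' s ((s + x) / 2) - orient' (s + x) ((s + x) / 2)) -
            ∫ t in (0 : ℝ)..x, γ t * H (s + x - t) t := by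
          rw [hh]
          simp only
          rw [hshift s (-x), hshift (s + x) 0]
          simp only [sub_neg_eq_add, neg_neg, sub_zero, neg_zero]
          rw [← intervalIntegral.integral_interval_sub_left (hHall (s + x) 0 (s + x)) (hHall (s + x) 0 x)]
          ring
        have e2 : K x (-s) = -(1 / 2) * γ ((s + x) / 2) * orient x ((s + x) / 2) -
            ∫ t in (0 : ℝ)..x, γ t * K (-t) (-(s + x - t)) := by
          have e : ∫ t in (0 : ℝ)..x, -γ t * K (-t) (-s - x + t) =
              -∫ t in (0 : ℝ)..x, γ t * K (-t) (-(s + x - t)) := by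
            rw [← intervalIntegral.integral_neg]
            refine intervalIntegral.integral_congr fun t _ => ?_
            rw [show -s - x + t = -(s + x - t) by ring]; ring
          rw [hK.eq x (-s), e, sub_neg_eq_add, add_comm x s]
          ring
        have e3 := hK.act_eq hγ (hsh s) x
        have e4 : ∫ t in (0 : ℝ)..x, γ t * act K (-t) (fun v => h (s + (v + (x - t)))) =
            ∫ t in (0 : ℝ)..x, γ t * act K (-t) (fun v => h (s + x - t + v)) := by
          refine intervalIntegral.integral_congr fun t _ => ?_
          congr 2
          ext v
          congr 1; ring
        rw [e4] at e3
        -- The three source terms cancel; the exceptional case `s + x = 0` is covered by `γ 0 = 0`.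
        have e5 : γ ((s + x) / 2) * (orient' s ((s + x) / 2) - orient' (s + x) ((s + x) / 2) +
            orient x ((s + x) / 2)) = 0 := by
          rcases eq_or_ne (s + x) 0 with h0 | h0
          · rw [h0, zero_div, hγ.zero, zero_mul]
          · rw [orient_add_orient' h0, mul_zero]
        have e6 : ∫ t in (0 : ℝ)..x, -(γ t * D (-t) (s + x - t)) =
            -((∫ t in (0 : ℝ)..x, γ t * H (s + x - t) t) -
            (∫ t in (0 : ℝ)..x, γ t * K (-t) (-(s + x - t))) -
            ∫ t in (0 : ℝ)..x, γ t * act K (-t) fun v => h (s + x - t + v)) := by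
          rw [intervalIntegral.integral_neg, ← intervalIntegral.integral_sub j1 j2,
            ← intervalIntegral.integral_sub (j1.sub j2) j3]
          congr 1
          refine intervalIntegral.integral_congr fun t _ => ?_
          simp only [hD, neg_neg]; ring
        rw [e6]
        simp only [hD]
        linear_combination e1 - e2 - e3 + 1 / 2 * e5
      · rw [norm_neg, norm_mul]
        gcongr
        refine hCγ _ ?_
        have h1 := hreg x s t hxs ht
        rw [abs_neg] at h1
        linarith [abs_nonneg (s + x - t)]
  simp only [hD] at main
  linear_combination main

end SpectralFn

/-! ### Fourier transforms of square integrable functions with compact support. -/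

namespace SpectralFn
open Set Function Real
open scoped FourierTransform SchwartzMap ContDiff

lemma continuous_fourier_of_integrable {f : ℝ → ℂ} (h1 : Integrable f) : Continuous (𝓕 f) :=
  VectorFourier.fourierIntegral_continuous (Real.continuous_fourierChar)
    (by exact continuous_inner) h1

/-- The `L²` Fourier transform of an integrable function is given by the Fourier integral. -/
theorem coeFn_fourier_toLp {f : ℝ → ℂ} (h1 : Integrable f) (h2 : MemLp f 2) :
    ((𝓕 (h2.toLp f) : Lp ℂ 2 (volume : Measure ℝ)) : ℝ → ℂ) =ᵐ[volume] 𝓕 f := by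
  refine ae_eq_of_integral_contDiff_smul_eq
    ((Lp.memLp _).locallyIntegrable (by norm_num))
    (continuous_fourier_of_integrable h1).locallyIntegrable fun g hg hgs => ?_
  have hgc : ContDiff ℝ ∞ fun x => (g x : ℂ) := Complex.ofRealCLM.contDiff.comp hg
  have hgcs : HasCompactSupport fun x => (g x : ℂ) := hgs.comp_left (g := fun x : ℝ => (x : ℂ)) rfl
  -- Against a Schwartz function the `L²` transform acts by moving the transform onto that function
  -- (`e1`); for an integrable function the Fourier integral does the same by Fubini (`e3`).
  set G : 𝓢(ℝ, ℂ) := hgcs.toSchwartzMap hgc with hG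
  have hGa : ∀ x, G x = (g x : ℂ) := fun x => rfl
  have e1 := DFunLike.congr_fun (Lp.fourier_toTemperedDistribution_eq (h2.toLp f)) G
  rw [TemperedDistribution.fourier_apply, Lp.toTemperedDistribution_apply,
    Lp.toTemperedDistribution_apply] at e1
  have e2 : ∫ x, (𝓕 G : 𝓢(ℝ, ℂ)) x • (h2.toLp f : ℝ → ℂ) x = ∫ x, (𝓕 G : 𝓢(ℝ, ℂ)) x • f x :=
    integral_congr_ae (h2.coeFn_toLp.mono fun x hx => by simp only [hx])
  have e3 : ∫ x, G x • 𝓕 f x = ∫ x, (𝓕 G : 𝓢(ℝ, ℂ)) x • f x := by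
    have := VectorFourier.integral_fourierIntegral_smul_eq_flip (μ := volume) (ν := volume)
      (L := innerₗ ℝ) (f := f) (g := (G : ℝ → ℂ))
      Real.continuous_fourierChar (by exact continuous_inner) h1 G.integrable
    rw [flip_innerₗ] at this
    simp only [smul_eq_mul] at this ⊢
    rw [SchwartzMap.fourier_coe]
    calc _ = ∫ x, 𝓕 f x * G x := by congr 1; ext x; ring
      _ = ∫ x, f x * 𝓕 (G : ℝ → ℂ) x := this
      _ = _ := by congr 1; ext x; ring
  have e4 : ∀ h : ℝ → ℂ, ∫ x, g x • h x = ∫ x, G x • h x := by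
    intro h
    refine integral_congr_ae (Eventually.of_forall fun x => ?_)
    simp [hGa]
  rw [e4, e4, e3, ← e1, e2]

/-- `Ê(ρ) = ∫ E(s) e^{iρs} ds`. -/
noncomputable def hat (E : ℝ → ℂ) (ρ : ℂ) : ℂ := ∫ s, E s * Complex.exp (Complex.I * ρ * s)

/-- Square integrable functions supported in `[-σ, σ]`. -/
structure IsL2On (E : ℝ → ℂ) (σ : ℝ) : Prop where
  memLp : MemLp E 2
  support : ∀ x, σ < |x| → E x = 0

variable {E F : ℝ → ℂ} {σ τ : ℝ}

lemma IsL2On.mono (hE : IsL2On E σ) (h : σ ≤ τ) : IsL2On E τ :=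
  ⟨hE.memLp, fun x hx => hE.support x (h.trans_lt hx)⟩

lemma integrable_of_memLp_of_support (hm : MemLp E 2) (hs : ∀ x, σ < |x| → E x = 0) :
    Integrable E := by
  have h1 : IntegrableOn E (Icc (-σ) σ) := by
    have : IsFiniteMeasure (volume.restrict (Icc (-σ) σ)) := ⟨by simp⟩
    exact (hm.restrict _).integrable (by norm_num)
  refine (integrableOn_iff_integrable_of_support_subset fun x hx => ?_).1 h1
  rw [mem_Icc, ← abs_le]
  by_contra h
  exact hx (hs x (not_le.1 h))

lemma IsL2On.integrable (hE : IsL2On E σ) : Integrable E :=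
  integrable_of_memLp_of_support hE.memLp hE.support

lemma norm_cexp_I_mul (ρ : ℂ) (s : ℝ) :
    ‖Complex.exp (Complex.I * ρ * s)‖ = exp (-(ρ.im * s)) := by
  rw [Complex.norm_exp]; simp

lemma norm_cexp_I_mul_le (ρ : ℂ) {s : ℝ} (hs : |s| ≤ σ) :
    ‖Complex.exp (Complex.I * ρ * s)‖ ≤ exp (σ * |ρ.im|) := by
  rw [norm_cexp_I_mul]
  gcongr
  calc -(ρ.im * s) ≤ |ρ.im * s| := neg_le_abs _
    _ = |s| * |ρ.im| := by rw [abs_mul, mul_comm]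
    _ ≤ _ := by gcongr

lemma integrable_hat (hE : Integrable E) (hs : ∀ x, σ < |x| → E x = 0) (ρ : ℂ) :
    Integrable fun s : ℝ => E s * Complex.exp (Complex.I * ρ * s) := by
  refine (hE.norm.mul_const (exp (σ * |ρ.im|))).mono' (hE.aestronglyMeasurable.mul
    (by fun_prop : Continuous fun s : ℝ => Complex.exp (Complex.I * ρ * s)).aestronglyMeasurable)
    (Eventually.of_forall fun s => ?_)
  rcases le_or_gt |s| σ with h | h
  · rw [norm_mul]
    gcongr
    exact norm_cexp_I_mul_le ρ h
  · rw [hs s h]; simp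

lemma norm_hat_le (hE : Integrable E) (hs : ∀ x, σ < |x| → E x = 0) (ρ : ℂ) :
    ‖hat E ρ‖ ≤ (∫ s, ‖E s‖) * exp (σ * |ρ.im|) := by
  rw [← integral_mul_const]
  refine norm_integral_le_of_norm_le (hE.norm.mul_const _) (Eventually.of_forall fun s => ?_)
  rcases le_or_gt |s| σ with h | h
  · rw [norm_mul]
    gcongr
    exact norm_cexp_I_mul_le ρ h
  · rw [hs s h]; simp

lemma differentiable_hat (hE : Integrable E) (hs : ∀ x, σ < |x| → E x = 0) :
    Differentiable ℂ (hat E) := by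
  intro ρ₀
  have hm : ∀ ρ : ℂ, AEStronglyMeasurable (fun s : ℝ => E s * Complex.exp (Complex.I * ρ * s))
      volume := fun ρ => (integrable_hat hE hs ρ).aestronglyMeasurable
  have h := hasDerivAt_integral_of_dominated_loc_of_deriv_le (𝕜 := ℂ) (μ := volume)
    (F := fun ρ s => E s * Complex.exp (Complex.I * ρ * s))
    (F' := fun ρ s => E s * (Complex.exp (Complex.I * ρ * s) * (Complex.I * s))) (x₀ := ρ₀)
    (s := Metric.ball ρ₀ 1)
    (bound := fun s => ‖E s‖ * (exp (σ * (|ρ₀.im| + 1)) * σ)) (Metric.ball_mem_nhds ρ₀ one_pos)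
    (Eventually.of_forall hm) (integrable_hat hE hs ρ₀) ?_ ?_ (hE.norm.mul_const _) ?_
  · exact h.2.differentiableAt
  · exact hE.aestronglyMeasurable.mul (by fun_prop : Continuous fun s : ℝ =>
      Complex.exp (Complex.I * ρ₀ * s) * (Complex.I * s)).aestronglyMeasurable
  · refine Eventually.of_forall fun s ρ hρ => ?_
    rcases le_or_gt |s| σ with h | h
    · have hσ : 0 ≤ σ := (abs_nonneg _).trans h
      rw [norm_mul, norm_mul]
      have h1 : |ρ.im| ≤ |ρ₀.im| + 1 := by
        have h2 : |(ρ - ρ₀).im| ≤ 1 := (Complex.abs_im_le_norm _).trans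
          (by rw [← dist_eq_norm]; exact (Metric.mem_ball.1 hρ).le)
        rw [Complex.sub_im] at h2
        have := abs_sub_abs_le_abs_sub ρ.im ρ₀.im
        linarith
      gcongr
      · exact (norm_cexp_I_mul_le ρ h).trans (by gcongr)
      · simpa using h
    · rw [hs s h]; simp
  · refine Eventually.of_forall fun s ρ _ => ?_
    have h1 : HasDerivAt (fun ρ : ℂ => Complex.I * ρ * s) (Complex.I * s) ρ := by
      simpa using ((hasDerivAt_id ρ).const_mul Complex.I).mul_const (s : ℂ)
    exact h1.cexp.const_mul (E s)

/-- Translation between the kernels `e^{its}` and `e^{-2πits}`; it is the source of the factor `2π`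
in the Parseval identity. -/
lemma hat_ofReal (E : ℝ → ℂ) (t : ℝ) : hat E t = 𝓕 E (-t / (2 * π)) := by
  rw [hat, Real.fourier_eq']
  refine integral_congr_ae (Eventually.of_forall fun s => ?_)
  have hπ : (π : ℂ) ≠ 0 := by exact_mod_cast pi_ne_zero
  simp only [smul_eq_mul, inner]
  rw [mul_comm]
  congr 2
  push_cast
  field_simp
  simp
  field_simp

lemma memLp_fourier (h1 : Integrable E) (h2 : MemLp E 2) : MemLp (𝓕 E) 2 :=
  (memLp_congr_ae (coeFn_fourier_toLp h1 h2)).1 (Lp.memLp _)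

lemma IsL2On.memLp_hat (hE : IsL2On E σ) : MemLp (fun t : ℝ => hat E t) 2 := by
  have h := memLp_fourier hE.integrable hE.memLp
  have hc : Continuous fun t : ℝ => hat E t :=
    (differentiable_hat hE.integrable hE.support).continuous.comp Complex.continuous_ofReal
  refine (memLp_two_iff_integrable_sq_norm hc.aestronglyMeasurable).2 ?_
  have h1 := (memLp_two_iff_integrable_sq_norm h.aestronglyMeasurable).1 h
  have h2 := h1.comp_mul_left' (R := -(1 / (2 * π))) (by simp [pi_ne_zero])
  refine h2.congr (Eventually.of_forall fun t => ?_)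
  simp only [hat_ofReal]
  congr 3; ring_nf

lemma IsL2On.integrable_hat_mul (hE : IsL2On E σ) (hF : IsL2On F τ) :
    Integrable fun t : ℝ => hat E t * hat F t :=
  hE.memLp_hat.integrable_mul hF.memLp_hat

/-- Plancherel is sesquilinear. It becomes bilinear through `G(v) = conj F(-v)`, whose transform is
the conjugate of that of `F`. -/
lemma integral_fourier_mul_fourier (hE : Integrable E) (hE2 : MemLp E 2) (hF : Integrable F)
    (hF2 : MemLp F 2) : ∫ t, 𝓕 E t * 𝓕 F t = ∫ v, E v * F (-v) := by
  set G : ℝ → ℂ := fun v => starRingEnd ℂ (F (-v)) with hG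
  have hG1 : Integrable G := memLp_one_iff_integrable.1 (memLp_one_iff_integrable.2 hF.comp_neg).star
  have hG2 : MemLp G 2 := (hF2.comp_measurePreserving (Measure.measurePreserving_neg volume)).star
  have hGF : ∀ t, 𝓕 G t = starRingEnd ℂ (𝓕 F t) := by
    intro t
    rw [Real.fourier_eq', Real.fourier_eq', ← integral_conj,
      ← integral_neg_eq_self (fun v => (Complex.exp _) • G v)]
    refine integral_congr_ae (Eventually.of_forall fun v => ?_)
    simp only [hG, smul_eq_mul, map_mul, neg_neg, ← Complex.exp_conj]
    congr 2
    simp [map_ofNat]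
  have h := Lp.inner_fourier_eq (hG2.toLp G) (hE2.toLp E)
  rw [L2.inner_def, L2.inner_def] at h
  have e1 : ∫ a, inner ℂ ((𝓕 (hG2.toLp G) : Lp ℂ 2 (volume : Measure ℝ)) a) ((𝓕 (hE2.toLp E) : Lp ℂ 2 (volume : Measure ℝ)) a) =
      ∫ t, 𝓕 E t * 𝓕 F t := by
    refine integral_congr_ae ?_
    filter_upwards [coeFn_fourier_toLp hG1 hG2, coeFn_fourier_toLp hE hE2] with t h1 h2
    rw [h1, h2, hGF]; simp
  have e2 : ∫ a, inner ℂ ((hG2.toLp G : Lp ℂ 2 (volume : Measure ℝ)) a) ((hE2.toLp E : Lp ℂ 2 (volume : Measure ℝ)) a) =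
      ∫ v, E v * F (-v) := by
    refine integral_congr_ae ?_
    filter_upwards [hG2.coeFn_toLp, hE2.coeFn_toLp] with t h1 h2
    rw [h1, h2]; simp [hG]
  rw [← e1, h, e2]

/-- The bilinear Parseval identity. -/
theorem IsL2On.integral_hat_mul (hE : IsL2On E σ) (hF : IsL2On F τ) :
    ∫ t : ℝ, hat E t * hat F t = 2 * π * ∫ v, E v * F (-v) := by
  rw [← integral_fourier_mul_fourier hE.integrable hE.memLp hF.integrable hF.memLp]
  have e : (fun t : ℝ => hat E t * hat F t) =
      fun t : ℝ => (fun y => 𝓕 E y * 𝓕 F y) (t / (-(2 * π))) := by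
    ext t
    simp only [hat_ofReal]
    rw [div_neg, neg_div]
  rw [e, Measure.integral_comp_div (fun y => 𝓕 E y * 𝓕 F y) (-(2 * π))]
  simp [abs_of_pos pi_pos]

lemma IsL2On.ae_eq_zero_of_hat (hE : IsL2On E σ) (h : ∀ t : ℝ, hat E t = 0) : E =ᵐ[volume] 0 := by
  have h1 : ∀ t, 𝓕 E t = 0 := fun t => by
    have := h (-(2 * π * t))
    rw [hat_ofReal] at this
    rwa [neg_neg, mul_div_cancel_left₀ _ (by positivity)] at this
  have h2 := coeFn_fourier_toLp hE.integrable hE.memLp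
  have h3 : (𝓕 (hE.memLp.toLp E) : Lp ℂ 2 (volume : Measure ℝ)) = 0 :=
    (Lp.eq_zero_iff_ae_eq_zero).2 (h2.trans (Eventually.of_forall h1))
  have h4 : hE.memLp.toLp E = 0 := by
    rw [← norm_eq_zero, ← Lp.norm_fourier_eq, h3, norm_zero]
  exact hE.memLp.coeFn_toLp.symm.trans ((Lp.eq_zero_iff_ae_eq_zero).1 h4)

end SpectralFn

/-! ### Exponential type, Phragmén–Lindelöf and Paley–Wiener. -/

namespace SpectralFn
open Set Function Real

lemma norm_le_of_expType_lt {e : ℂ → ℂ} {τ : ℝ} (h : expType e < τ) :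
    ∀ᶠ r : ℝ in atTop, ∀ ρ : ℂ, ‖ρ‖ = r → ‖e ρ‖ ≤ exp (τ * r) := by
  filter_upwards [eventually_lt_of_limsup_lt h, eventually_gt_atTop 0] with r hr hr0 ρ hρ
  have h1 : ‖e ρ‖ₑ ≤ ⨆ ρ ∈ Metric.sphere (0 : ℂ) r, ‖e ρ‖ₑ :=
    le_iSup₂_of_le ρ (by simpa using hρ) le_rfl
  rw [EReal.div_lt_iff (by exact_mod_cast hr0) (EReal.coe_ne_top r)] at hr
  have h2 : ENNReal.log ‖e ρ‖ₑ ≤ ((τ * r : ℝ) : EReal) := by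
    push_cast
    exact (ENNReal.log_monotone h1).trans hr.le
  have h3 := EReal.exp_monotone h2
  rw [ENNReal.exp_log, EReal.exp_coe, ← ofReal_norm] at h3
  exact (ENNReal.ofReal_le_ofReal_iff (exp_pos _).le).1 h3

/-- Phragmén–Lindelöf in the right half-plane for `z ↦ e(iz) e^{-τz}`. This function has order at
most one, is bounded by `C` on the imaginary axis, where `e` is evaluated at real points, and is
bounded on the positive axis by the hypothesis on the type. The constant stays `C` while `σ`
improves to `τ`. -/
lemma norm_le_of_im_nonneg {e : ℂ → ℂ} {C σ τ : ℝ} (hd : Differentiable ℂ e) (hC : 0 ≤ C)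
    (he : ∀ ρ : ℂ, ‖e ρ‖ ≤ C * exp (σ * |ρ.im|))
    (hτ : ∀ᶠ r : ℝ in atTop, ∀ ρ : ℂ, ‖ρ‖ = r → ‖e ρ‖ ≤ exp (τ * r)) {ρ : ℂ} (hρ : 0 ≤ ρ.im) :
    ‖e ρ‖ ≤ C * exp (τ * ρ.im) := by
  set f : ℂ → ℂ := fun z => e (Complex.I * z) * Complex.exp (-(τ * z)) with hf
  have hn : ∀ z : ℂ, ‖f z‖ = ‖e (Complex.I * z)‖ * exp (-(τ * z.re)) := fun z => by
    simp [hf, Complex.norm_exp]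
  have hfd : Differentiable ℂ f := by
    have : Differentiable ℂ fun z : ℂ => e (Complex.I * z) := hd.comp (by fun_prop)
    fun_prop
  have main := PhragmenLindelof.right_half_plane_of_bounded_on_real (f := f) (C := C)
    (z := -Complex.I * ρ) hfd.diffContOnCl ⟨1, by norm_num, |σ| + |τ|, ?_⟩ ?_ ?_ (by simpa using hρ)
  · rw [hn] at main
    have e1 : Complex.I * (-Complex.I * ρ) = ρ := by
      rw [← mul_assoc, mul_neg, Complex.I_mul_I]; simp
    have e2 : (-Complex.I * ρ).re = ρ.im := by simp
    rw [e1, e2, exp_neg] at main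
    rwa [← div_eq_mul_inv, div_le_iff₀ (exp_pos _)] at main
  · refine Asymptotics.IsBigO.of_bound C (Eventually.of_forall fun z => ?_)
    rw [hn, rpow_one, Real.norm_of_nonneg (exp_pos _).le, add_mul, exp_add, ← mul_assoc]
    have h1 : |(Complex.I * z).im| ≤ ‖z‖ := by simpa using Complex.abs_re_le_norm z
    gcongr
    · refine (he _).trans ?_
      gcongr
      exact le_abs_self σ
    · refine (neg_le_abs _).trans ?_
      rw [abs_mul]
      gcongr
      exact Complex.abs_re_le_norm z
  · refine ⟨1, ?_⟩
    rw [eventually_map]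
    filter_upwards [hτ, eventually_gt_atTop 0] with x hx hx0
    rw [hn]
    have h1 := hx (Complex.I * x) (by simp [abs_of_pos hx0])
    rw [Complex.ofReal_re, exp_neg, ← div_eq_mul_inv]
    exact div_le_one_of_le₀ h1 (exp_pos _).le
  · intro x
    rw [hn]
    have e1 : Complex.I * (x * Complex.I) = ((-x : ℝ) : ℂ) := by
      rw [mul_comm, mul_assoc, Complex.I_mul_I]; simp
    rw [e1]
    simpa using he ((-x : ℝ) : ℂ)

/-- An entire function that is bounded on the real line and of type less than `τ` is
`O(e^{τ |Im ρ|})`. -/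
theorem IsExpType.norm_le_of_expType_lt {e : ℂ → ℂ} {τ : ℝ} (h : IsExpType e)
    (hτ : expType e < τ) : ∃ C : ℝ, 0 ≤ C ∧ ∀ ρ : ℂ, ‖e ρ‖ ≤ C * exp (τ * |ρ.im|) := by
  obtain ⟨hd, C, hC, σ, hσ, he⟩ := h
  have h1 := SpectralFn.norm_le_of_expType_lt hτ
  refine ⟨C, hC.le, fun ρ => ?_⟩
  rcases le_total 0 ρ.im with hρ | hρ
  · rw [abs_of_nonneg hρ]
    exact norm_le_of_im_nonneg hd hC.le he h1 hρ
  · rw [abs_of_nonpos hρ]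
    have := norm_le_of_im_nonneg (e := fun z => e (-z)) (C := C) (σ := σ) (τ := τ) (ρ := -ρ)
      (hd.comp differentiable_neg) hC.le (fun z => by simpa using he (-z))
      (h1.mono fun r hr z hz => hr (-z) (by simpa using hz)) (by simpa using hρ)
    simpa using this

/-- The zero of `1 + iεz` is `i / ε`, in the upper half-plane; below the real axis its square is a
denominator of modulus at least `1` with quadratic growth. -/
lemma one_add_sq_le_norm_sq {ε : ℝ} (hε : 0 ≤ ε) {z : ℂ} (hz : z.im ≤ 0) :
    1 + (ε * ‖z‖) ^ 2 ≤ ‖(1 + Complex.I * ε * z) ^ 2‖ := by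
  rw [norm_pow, Complex.sq_norm, Complex.normSq_apply, mul_pow, Complex.sq_norm,
    Complex.normSq_apply]
  simp
  nlinarith [mul_nonneg hε (neg_nonneg.2 hz)]

/-- Cauchy's theorem on the rectangle `[-X, X] × [-X, 0]`. On the vertical sides `g` itself need not
tend to `0`, so it is first divided by `(1 + iεz)²`; `ε → 0` is then dominated convergence. -/
lemma integral_eq_zero_of_lower_decay {g : ℂ → ℂ} {C δ : ℝ} (hg : Differentiable ℂ g)
    (hC : 0 ≤ C) (hδ : 0 < δ) (hb : ∀ z : ℂ, z.im ≤ 0 → ‖g z‖ ≤ C * exp (δ * z.im))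
    (hi : Integrable fun t : ℝ => g t) : ∫ t : ℝ, g t = 0 := by
  have hb1 : ∀ z : ℂ, z.im ≤ 0 → ‖g z‖ ≤ C := fun z hz => (hb z hz).trans
    (mul_le_of_le_one_right hC (exp_le_one_iff.2 (mul_nonpos_of_nonneg_of_nonpos hδ.le hz)))
  -- the regularized integral
  have hreg : ∀ ε : ℝ, 0 < ε → ∫ t : ℝ, g t / (1 + Complex.I * ε * t) ^ 2 = 0 := by
    intro ε hε
    set h : ℂ → ℂ := fun z => g z / (1 + Complex.I * ε * z) ^ 2 with hh
    have hne : ∀ z : ℂ, z.im ≤ 0 → (1 + Complex.I * ε * z) ^ 2 ≠ 0 := fun z hz h0 => by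
      have := one_add_sq_le_norm_sq hε.le hz
      rw [h0, norm_zero] at this
      nlinarith [sq_nonneg (ε * ‖z‖)]
    have hhle : ∀ z : ℂ, z.im ≤ 0 → ‖h z‖ ≤ ‖g z‖ := fun z hz => by
      have := one_add_sq_le_norm_sq hε.le hz
      rw [hh, norm_div]
      exact div_le_self (norm_nonneg _) (by nlinarith [sq_nonneg (ε * ‖z‖)])
    have hhc : Continuous fun t : ℝ => h t := by
      refine (hg.continuous.comp Complex.continuous_ofReal).div (by fun_prop) fun t => hne _ (by simp)
    have hhi : Integrable fun t : ℝ => h t := hi.norm.mono' hhc.aestronglyMeasurable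
      (Eventually.of_forall fun t => hhle _ (by simp))
    have hlim := intervalIntegral_tendsto_integral hhi tendsto_neg_atTop_atBot tendsto_id
    have hbound : ∀ X : ℝ, 0 < X → ‖∫ t : ℝ in (-X)..X, h t‖ ≤
        C * exp (-(δ * X)) * (2 * X) + 2 * (C / (ε * X) ^ 2 * X) := by
      intro X hX
      have hrect := Complex.integral_boundary_rect_eq_zero_of_differentiableOn h (-X + (-X : ℝ) * Complex.I)
        X (fun z hz => by
          have : z.im ≤ 0 := by
            have := hz.2
            simp only [mem_preimage, uIcc, mem_Icc] at this
            simpa [hX.le] using this.2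
          exact ((hg z).div (by fun_prop) (hne z this)).differentiableWithinAt)
      simp only [Complex.add_re, Complex.neg_re, Complex.ofReal_re, Complex.mul_re, Complex.I_re,
        Complex.ofReal_im, Complex.I_im, Complex.add_im, Complex.neg_im, Complex.mul_im,
        Complex.ofReal_zero, mul_zero, zero_mul, sub_zero, add_zero, neg_zero, mul_one, zero_add,
        smul_eq_mul] at hrect
      have b1 : ‖∫ t : ℝ in (-X)..X, h (t + (-X : ℝ) * Complex.I)‖ ≤ C * exp (-(δ * X)) * (2 * X) := by
        have h1 : ∀ t ∈ uIoc (-X) X, ‖h (t + (-X : ℝ) * Complex.I)‖ ≤ C * exp (-(δ * X)) := by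
          intro t _
          have e : ((t : ℂ) + (-X : ℝ) * Complex.I).im = -X := by simp
          have h2 := (hhle (t + (-X : ℝ) * Complex.I) (by rw [e]; linarith)).trans
            (hb _ (by rw [e]; linarith))
          rwa [e, mul_neg] at h2
        refine (intervalIntegral.norm_integral_le_of_norm_le_const h1).trans (le_of_eq ?_)
        rw [sub_neg_eq_add, abs_of_pos (by linarith)]; ring
      have b2 : ∀ x : ℝ, |x| = X → ‖Complex.I * ∫ y : ℝ in (-X)..0, h (x + y * Complex.I)‖ ≤
          C / (ε * X) ^ 2 * X := by
        intro x hx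
        rw [norm_mul, Complex.norm_I, one_mul]
        refine (intervalIntegral.norm_integral_le_of_norm_le_const (C := C / (ε * X) ^ 2)
          fun y hy => ?_).trans ?_
        · have hy0 : (x + y * Complex.I).im ≤ 0 := by
            rw [uIoc_of_le (by linarith)] at hy
            simpa using hy.2
          have h1 := one_add_sq_le_norm_sq hε.le hy0
          have h2 : X ≤ ‖x + y * Complex.I‖ := by
            have := Complex.abs_re_le_norm (x + y * Complex.I)
            simpa [hx] using this
          have h3 : (ε * X) ^ 2 ≤ (ε * ‖x + y * Complex.I‖) ^ 2 := by gcongr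
          rw [hh, norm_div]
          refine div_le_div₀ hC (hb1 _ hy0) (by positivity) (by linarith)
        · rw [zero_sub, neg_neg, abs_of_pos hX]
      have b3 := b2 X (abs_of_pos hX)
      have b4 := b2 (-X) (by rw [abs_neg, abs_of_pos hX])
      have e1 : ∫ t : ℝ in (-X)..X, h t = (Complex.I * ∫ y : ℝ in (-X)..0, h (X + y * Complex.I)) -
          (Complex.I * ∫ y : ℝ in (-X)..0, h ((-X : ℝ) + y * Complex.I)) +
          ∫ t : ℝ in (-X)..X, h (t + (-X : ℝ) * Complex.I) := by
        push_cast
        push_cast at hrect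
        linear_combination -hrect
      rw [e1]
      calc _ ≤ (C / (ε * X) ^ 2 * X + C / (ε * X) ^ 2 * X) + C * exp (-(δ * X)) * (2 * X) :=
            (norm_add_le _ _).trans (add_le_add ((norm_sub_le _ _).trans (add_le_add b3 b4)) b1)
        _ = _ := by ring
    have hz : Tendsto (fun X : ℝ => C * exp (-(δ * X)) * (2 * X) + 2 * (C / (ε * X) ^ 2 * X))
        atTop (𝓝 0) := by
      have t1 : Tendsto (fun X : ℝ => C * exp (-(δ * X)) * (2 * X)) atTop (𝓝 0) := by
        have := (tendsto_rpow_mul_exp_neg_mul_atTop_nhds_zero 1 δ hδ).const_mul (2 * C)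
        rw [mul_zero] at this
        refine this.congr fun X => ?_
        rw [rpow_one, neg_mul]; ring
      have t2 : Tendsto (fun X : ℝ => 2 * (C / (ε * X) ^ 2 * X)) atTop (𝓝 0) := by
        have := tendsto_inv_atTop_zero.const_mul (2 * C / ε ^ 2)
        rw [mul_zero] at this
        refine this.congr' ?_
        filter_upwards [eventually_gt_atTop 0] with X hX
        field_simp
      simpa using t1.add t2
    have hz' : Tendsto (fun X : ℝ => ∫ t : ℝ in (-X)..X, h t) atTop (𝓝 0) :=
      squeeze_zero_norm' ((eventually_gt_atTop 0).mono fun X hX => hbound X hX) hz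
    exact tendsto_nhds_unique hlim hz'
  have hlim : Tendsto (fun n : ℕ => ∫ t : ℝ, g t / (1 + Complex.I * ((1 / ((n : ℝ) + 1) : ℝ) : ℂ) * t) ^ 2)
      atTop (𝓝 (∫ t : ℝ, g t)) := by
    refine tendsto_integral_of_dominated_convergence (fun t => ‖g t‖) (fun n => ?_) hi.norm
      (fun n => Eventually.of_forall fun t => ?_) (Eventually.of_forall fun t => ?_)
    · refine (hi.aestronglyMeasurable.aemeasurable.div (Continuous.aemeasurable ?_)).aestronglyMeasurable
      fun_prop
    · have := one_add_sq_le_norm_sq (ε := 1 / ((n : ℝ) + 1)) (by positivity) (z := (t : ℂ)) (by simp)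
      rw [norm_div]
      exact div_le_self (norm_nonneg _) (by nlinarith [sq_nonneg (1 / ((n : ℝ) + 1) * ‖(t : ℂ)‖)])
    · have h1 : Tendsto (fun n : ℕ => ((1 / ((n : ℝ) + 1) : ℝ) : ℂ)) atTop (𝓝 ((0 : ℝ) : ℂ)) :=
        (Complex.continuous_ofReal.tendsto 0).comp tendsto_one_div_add_atTop_nhds_zero_nat
      have h2 : Tendsto (fun n : ℕ => g t / (1 + Complex.I * ((1 / ((n : ℝ) + 1) : ℝ) : ℂ) * t) ^ 2) atTop
          (𝓝 (g t / (1 + Complex.I * ((0 : ℝ) : ℂ) * t) ^ 2)) := by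
        refine tendsto_const_nhds.div ?_ (by simp)
        exact (((h1.const_mul Complex.I).mul_const (t : ℂ)).const_add 1).pow 2
      simpa using h2
  refine tendsto_nhds_unique hlim ?_
  simp only [hreg _ (Nat.one_div_pos_of_nat)]
  exact tendsto_const_nhds

/-- `(2 π)⁻¹ ∫ e(t) e^{-its} dt`. -/
noncomputable def unhat (e : ℂ → ℂ) (s : ℝ) : ℂ :=
  1 / (2 * π) * ∫ t : ℝ, e t * Complex.exp (-(Complex.I * t * s))

lemma norm_cexp_neg_I_mul (t s : ℝ) : ‖Complex.exp (-(Complex.I * t * s))‖ = 1 := by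
  rw [Complex.norm_exp]; simp

lemma integrable_unhat {e : ℂ → ℂ} (hi : Integrable fun t : ℝ => e t) (s : ℝ) :
    Integrable fun t : ℝ => e t * Complex.exp (-(Complex.I * t * s)) := by
  refine hi.norm.mono' (hi.aestronglyMeasurable.mul (Continuous.aestronglyMeasurable (by fun_prop)))
    (Eventually.of_forall fun t => ?_)
  rw [norm_mul, norm_cexp_neg_I_mul, mul_one]

/-- The Paley–Wiener theorem for integrable functions of exponential type. -/
theorem unhat_eq_zero {e : ℂ → ℂ} {C σ : ℝ} (hd : Differentiable ℂ e) (hC : 0 ≤ C)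
    (he : ∀ ρ : ℂ, ‖e ρ‖ ≤ C * exp (σ * |ρ.im|)) (hi : Integrable fun t : ℝ => e t) {s : ℝ}
    (hs : σ < |s|) : unhat e s = 0 := by
  have hnorm : ∀ z : ℂ, ‖Complex.exp (-(Complex.I * z * s))‖ = exp (s * z.im) := fun z => by
    rw [Complex.norm_exp]; simp [mul_comm]
  have hgi := integrable_unhat hi s
  rw [unhat]
  -- For `s > σ` the integrand decays like `exp ((s - σ) Im z)` in the lower half-plane; for `s <
  -- -σ` the same holds after `z ↦ -z`.
  rcases le_total 0 s with h0 | h0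
  · rw [abs_of_nonneg h0] at hs
    rw [integral_eq_zero_of_lower_decay (g := fun z => e z * Complex.exp (-(Complex.I * z * s)))
      (C := C) (δ := s - σ) (by fun_prop) hC (by linarith) (fun z hz => ?_) hgi, mul_zero]
    rw [norm_mul, hnorm]
    calc _ ≤ C * exp (σ * |z.im|) * exp (s * z.im) := by gcongr; exact he z
      _ = _ := by rw [abs_of_nonpos hz, mul_assoc, ← exp_add]; ring_nf
  · rw [abs_of_nonpos h0] at hs
    have h2 : Differentiable ℂ fun z => e (-z) := hd.comp differentiable_neg
    rw [← integral_neg_eq_self (fun t : ℝ => e t * Complex.exp (-(Complex.I * t * s)))]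
    push_cast
    rw [integral_eq_zero_of_lower_decay
      (g := fun z => e (-z) * Complex.exp (-(Complex.I * -z * s)))
      (C := C) (δ := -s - σ) (by fun_prop) hC (by linarith) (fun z hz => ?_)
      (by simpa using hgi.comp_neg), mul_zero]
    rw [norm_mul, hnorm]
    have := he (-z)
    rw [Complex.neg_im, abs_neg] at this
    calc _ ≤ C * exp (σ * |z.im|) * exp (s * (-z).im) := by gcongr
      _ = _ := by rw [abs_of_nonpos hz, mul_assoc, ← exp_add, Complex.neg_im]; ring_nf

end SpectralFn

/-! ### Transposed kernels, the spectral functional and the scalar Parseval equality. -/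

namespace SpectralFn
open Set Function Real

/-- The transposed action `F(v) + ∫ F(x) W(x, v) dx` of a kernel. -/
noncomputable def coact (W : ℝ → ℝ → ℂ) (F : ℝ → ℂ) (v : ℝ) : ℂ := F v + ∫ x, F x * W x v

variable {W K H : ℝ → ℝ → ℂ} {γ E F G : ℝ → ℂ} {σ τ : ℝ}

/-- If `F` lives on `[-σ, σ]`, the cone condition restricts `v` to `[-σ, σ]` as well, so only the
local integrability of `g` matters. -/
lemma IsConeKernel.integrable_prod (hW : IsConeKernel W) (hF : Integrable F)
    (hFs : ∀ x, σ < |x| → F x = 0) {g : ℝ → ℂ} (hg : IntegrableOn g (Icc (-σ) σ)) :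
    Integrable (fun p : ℝ × ℝ => F p.1 * W p.1 p.2 * g p.2) (volume.prod volume) := by
  obtain ⟨C, hC0, hC⟩ := hW.bound σ
  have hg' := hg.integrable_indicator measurableSet_Icc
  have e : (fun p : ℝ × ℝ => F p.1 * W p.1 p.2 * g p.2) =
      fun p => (F p.1 * (Icc (-σ) σ).indicator g p.2) * W p.1 p.2 := by
    ext ⟨x, v⟩
    by_cases hv : v ∈ Icc (-σ) σ
    · simp only [indicator_of_mem hv]; ring
    · simp only [indicator_of_notMem hv, mul_zero, zero_mul]
      rw [mem_Icc, ← abs_le, not_le] at hv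
      rcases le_or_gt |x| σ with hx | hx
      · rw [hW.support _ _ (hx.trans_lt hv), mul_zero, zero_mul]
      · rw [hFs x hx, zero_mul, zero_mul]
  rw [e]
  refine ((hF.mul_prod hg').norm.mul_const C).mono'
    ((hF.mul_prod hg').aestronglyMeasurable.mul hW.measurable.aestronglyMeasurable)
    (Eventually.of_forall fun p => ?_)
  rw [norm_mul]
  rcases le_or_gt |p.1| σ with hx | hx
  · gcongr
    exact hC _ _ hx
  · rw [hFs _ hx]; simp

lemma integrableOn_of_isLocBdd {g : ℝ → ℂ} (hg : IsLocBdd g) (σ : ℝ) :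
    IntegrableOn g (Icc (-σ) σ) := by
  obtain ⟨C, hC0, hC⟩ := hg.bound σ
  refine Measure.integrableOn_of_bounded (M := C) (by simp) hg.measurable.aestronglyMeasurable ?_
  exact (ae_restrict_iff' measurableSet_Icc).2 (Eventually.of_forall fun x hx => hC x (abs_le.2 hx))

lemma integrable_mul_of_isLocBdd (hF : Integrable F) (hFs : ∀ x, σ < |x| → F x = 0)
    {g : ℝ → ℂ} (hg : IsLocBdd g) : Integrable fun x => F x * g x := by
  obtain ⟨C, hC0, hC⟩ := hg.bound σ
  refine (hF.norm.mul_const C).mono' (hF.aestronglyMeasurable.mul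
    hg.measurable.aestronglyMeasurable) (Eventually.of_forall fun x => ?_)
  rw [norm_mul]
  rcases le_or_gt |x| σ with hx | hx
  · gcongr; exact hC x hx
  · rw [hFs x hx]; simp

/-- Transposition by Fubini. The function `g` is not assumed locally bounded, since it will be `E
(-v) + tracePairing H E v` with `E` merely square integrable. -/
lemma IsConeKernel.integral_mul_act (hW : IsConeKernel W) (hF : Integrable F)
    (hFs : ∀ x, σ < |x| → F x = 0) {g : ℝ → ℂ} (hg : IntegrableOn g (Icc (-σ) σ))
    (hFg : Integrable fun x => F x * g x) :
    ∫ x, F x * act W x g = ∫ v, coact W F v * g v := by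
  have hP := hW.integrable_prod hF hFs hg
  have h1 : Integrable fun x => ∫ v, F x * W x v * g v := hP.integral_prod_left
  have h2 : Integrable fun v => ∫ x, F x * W x v * g v := hP.integral_prod_right
  have e1 : ∀ x, F x * act W x g = F x * g x + ∫ v, F x * W x v * g v := fun x => by
    rw [act, mul_add, ← integral_const_mul]
    simp only [mul_assoc]
  have e2 : ∀ v, coact W F v * g v = F v * g v + ∫ x, F x * W x v * g v := fun v => by
    rw [coact, add_mul, ← integral_mul_const]
  simp only [e1, e2]
  rw [integral_add hFg h1, integral_add hFg h2]
  congr 1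
  exact integral_integral_swap hP

lemma IsConeKernel.isL2On_coact (hW : IsConeKernel W) (hF : IsL2On F σ) :
    IsL2On (coact W F) σ := by
  obtain ⟨C, hC0, hC⟩ := hW.bound σ
  have hz : ∀ v, σ < |v| → ∫ x, F x * W x v = 0 := fun v hv => by
    rw [integral_eq_zero_of_ae]
    refine Eventually.of_forall fun x => ?_
    rcases le_or_gt |x| σ with hx | hx
    · simp [hW.support _ _ (hx.trans_lt hv)]
    · simp [hF.support x hx]
  refine ⟨hF.memLp.add ?_, fun v hv => by rw [coact, hF.support v hv, hz v hv, add_zero]⟩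
  have hm : AEStronglyMeasurable (fun v => ∫ x, F x * W x v) volume := by
    have : AEStronglyMeasurable (fun p : ℝ × ℝ => F p.2 * W p.2 p.1) (volume.prod volume) :=
      hF.integrable.aestronglyMeasurable.comp_snd.mul
        (hW.measurable.comp measurable_swap).aestronglyMeasurable
    exact this.integral_prod_right'
  have hb : ∀ v, ‖∫ x, F x * W x v‖ ≤ (∫ x, ‖F x‖) * C := fun v => by
    rw [← integral_mul_const]
    refine norm_integral_le_of_norm_le (hF.integrable.norm.mul_const C)
      (Eventually.of_forall fun x => ?_)
    rw [norm_mul]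
    rcases le_or_gt |x| σ with hx | hx
    · gcongr; exact hC _ _ hx
    · rw [hF.support x hx]; simp
  have h0 : 0 ≤ (∫ x, ‖F x‖) * C := (norm_nonneg _).trans (hb 0)
  refine (memLp_two_iff_integrable_sq_norm hm).2 ?_
  have h1 := integrable_of_bounded_interval (f := fun v => (((‖∫ x, F x * W x v‖ ^ 2 : ℝ)) : ℂ))
    (R := σ) (C := ((∫ x, ‖F x‖) * C) ^ 2)
    (Complex.continuous_ofReal.comp_aestronglyMeasurable (hm.norm.pow 2)) (fun v => ?_)
    fun v hv => by simp [hz v hv]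
  · exact h1.re
  · rw [Complex.norm_real, Real.norm_of_nonneg (by positivity)]
    have := hb v
    gcongr

/-- `∫ F(x) Ψ(x, ρ) dx`. -/
noncomputable def spectral (K : ℝ → ℝ → ℂ) (F : ℝ → ℂ) (ρ : ℂ) : ℂ := ∫ x, F x * psi K ρ x

/-- `Ψ` is `act K` of the exponential, so the kernel can be moved onto `F`. The spectral transform
becomes a Fourier transform. -/
lemma IsL2On.spectral_eq_hat (hK : IsConeKernel K) (hF : IsL2On F σ) (ρ : ℂ) :
    spectral K F ρ = hat (coact K F) ρ :=
  hK.integral_mul_act hF.integrable hF.support (integrableOn_of_isLocBdd (isLocBdd_cexp ρ) σ)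
    (integrable_mul_of_isLocBdd hF.integrable hF.support (isLocBdd_cexp ρ))

lemma IsL2On.spectral_coact (hγ : IsPotential γ) (hK : IsTransmutation γ K)
    (hH : IsInverseTransmutation γ H) (hE : IsL2On E σ) (ρ : ℂ) :
    spectral K (coact H E) ρ = hat E ρ := by
  rw [spectral, ← hH.integral_mul_act hE.integrable hE.support
    (integrableOn_of_isLocBdd (hK.isLocBdd_psi ρ) σ)
    (integrable_mul_of_isLocBdd hE.integrable hE.support (hK.isLocBdd_psi ρ))]
  simp only [hH.act_psi hγ hK ρ]
  rfl

/-- The gain `1 / l` that makes the transposed integral operator a contraction in a weighted `L¹`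
norm. -/
lemma IsConeKernel.integral_exp_mul_norm_le (hW : IsConeKernel W) {C l x : ℝ} (hl : 0 < l)
    (hC : ∀ v, ‖W x v‖ ≤ C) :
    ∫ v, exp (l * |v|) * ‖W x v‖ ≤ 2 * C / l * exp (l * |x|) := by
  have hC0 : 0 ≤ C := (norm_nonneg _).trans (hC 0)
  have e : ∫ v, exp (l * |v|) * ‖W x v‖ = ∫ v in Ioc (-|x|) |x|, exp (l * |v|) * ‖W x v‖ := by
    rw [← integral_Icc_eq_integral_Ioc]
    refine (setIntegral_eq_integral_of_forall_compl_eq_zero fun v hv => ?_).symm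
    rw [mem_Icc, ← abs_le, not_le] at hv
    rw [hW.support _ _ hv, norm_zero, mul_zero]
  rw [e, ← intervalIntegral.integral_of_le (by linarith [abs_nonneg x])]
  have hcont : ∀ a b, IntervalIntegrable (fun v : ℝ => exp (l * |v|)) volume a b := fun a b =>
    (by fun_prop : Continuous fun v : ℝ => exp (l * |v|)).intervalIntegrable a b
  have h1 : ∫ v in (-|x|)..|x|, exp (l * |v|) * ‖W x v‖ ≤
      ∫ v in (-|x|)..|x|, exp (l * |v|) * C := by
    refine intervalIntegral.integral_mono_on (by linarith [abs_nonneg x]) ?_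
      ((hcont _ _).mul_const C) fun v _ => by gcongr; exact hC v
    refine ((hcont (-|x|) |x|).mul_const C).mono_fun'
      ((Continuous.aestronglyMeasurable (by fun_prop)).mul
        (hW.measurable_right x).norm.aestronglyMeasurable) (Eventually.of_forall fun v => ?_)
    simp only [norm_mul, norm_norm, Real.norm_of_nonneg (exp_pos _).le]
    gcongr; exact hC v
  refine h1.trans ?_
  rw [intervalIntegral.integral_mul_const,
    ← intervalIntegral.integral_add_adjacent_intervals (hcont _ 0) (hcont 0 _),
    intervalIntegral.integral_symm]
  have a1 := integral_exp_abs_le hl |x|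
  have a2 := integral_exp_abs_le hl (-|x|)
  rw [abs_abs] at a1
  rw [abs_neg, abs_abs] at a2
  have b1 := (le_abs_self _).trans a1
  have b2 := (neg_le_abs _).trans a2
  calc _ ≤ (exp (l * |x|) / l + exp (l * |x|) / l) * C := by gcongr
    _ = _ := by ring

/-- The transposed Volterra operator is injective. -/
theorem IsConeKernel.ae_eq_zero_of_coact (hW : IsConeKernel W) (hF : IsL2On F σ)
    (h : coact W F =ᵐ[volume] 0) : F =ᵐ[volume] 0 := by
  obtain ⟨C, hC0, hC⟩ := hW.bound σ
  -- Chosen so that `2 * C / l ≤ 1 / 2`: the weighted `L¹` norm of `F` is then at most half of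
  -- itself.
  set l := 4 * C + 1 with hl
  have hlpos : 0 < l := by positivity
  have hFi := hF.integrable
  have hcl : IsLocBdd fun v : ℝ => ((exp (l * |v|) : ℝ) : ℂ) := IsLocBdd.of_continuous (by fun_prop)
  have hP := (hW.integrable_prod hFi hF.support (integrableOn_of_isLocBdd hcl σ)).norm
  have hw : Integrable fun v => ‖F v‖ * exp (l * |v|) := by
    refine (integrable_mul_of_isLocBdd hFi hF.support hcl).norm.congr (Eventually.of_forall fun v => ?_)
    simp only [norm_mul, Complex.norm_real, Real.norm_of_nonneg (exp_pos _).le]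
  have hle : ∫ v, ‖F v‖ * exp (l * |v|) ≤ ∫ v, ∫ x, ‖F x * W x v * ((exp (l * |v|) : ℝ) : ℂ)‖ := by
    refine integral_mono_ae hw hP.integral_prod_right ?_
    filter_upwards [h] with v hv
    have : F v = -∫ x, F x * W x v := by
      simp only [coact, Pi.zero_apply] at hv
      linear_combination hv
    calc ‖F v‖ * exp (l * |v|) = ‖(∫ x, F x * W x v) * ((exp (l * |v|) : ℝ) : ℂ)‖ := by
          rw [this, norm_neg, norm_mul, Complex.norm_real, Real.norm_of_nonneg (exp_pos _).le]
      _ = ‖∫ x, F x * W x v * ((exp (l * |v|) : ℝ) : ℂ)‖ := by rw [integral_mul_const]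
      _ ≤ _ := norm_integral_le_integral_norm _
  have hswap : ∫ v, ∫ x, ‖F x * W x v * ((exp (l * |v|) : ℝ) : ℂ)‖ =
      ∫ x, ∫ v, ‖F x * W x v * ((exp (l * |v|) : ℝ) : ℂ)‖ := (integral_integral_swap hP).symm
  have hle2 : ∫ x, ∫ v, ‖F x * W x v * ((exp (l * |v|) : ℝ) : ℂ)‖ ≤
      ∫ x, 1 / 2 * (‖F x‖ * exp (l * |x|)) := by
    refine integral_mono hP.integral_prod_left (hw.const_mul _) fun x => ?_
    simp only [norm_mul, Complex.norm_real, Real.norm_of_nonneg (exp_pos _).le]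
    rcases le_or_gt |x| σ with hx | hx
    · have h1 := hW.integral_exp_mul_norm_le hlpos (fun v => hC x v hx)
      calc _ = ‖F x‖ * ∫ v, exp (l * |v|) * ‖W x v‖ := by
            rw [← integral_const_mul]
            congr 1; ext v; ring
        _ ≤ ‖F x‖ * (2 * C / l * exp (l * |x|)) := by gcongr
        _ ≤ ‖F x‖ * (1 / 2 * exp (l * |x|)) := by
            have h2 : 2 * C / l ≤ 1 / 2 := by
              rw [div_le_iff₀ hlpos]
              linarith
            exact mul_le_mul_of_nonneg_left (mul_le_mul_of_nonneg_right h2 (exp_pos _).le)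
              (norm_nonneg _)
        _ = _ := by ring
    · rw [hF.support x hx]; simp
  rw [integral_const_mul] at hle2
  have h0 : 0 ≤ ∫ v, ‖F v‖ * exp (l * |v|) := integral_nonneg fun v => by positivity
  have hzero : ∫ v, ‖F v‖ * exp (l * |v|) = 0 := by linarith
  rw [integral_eq_zero_iff_of_nonneg (fun v => by positivity) hw] at hzero
  filter_upwards [hzero] with v hv
  simpa [(exp_pos _).ne'] using hv

lemma IsL2On.sub (hF : IsL2On F σ) (hG : IsL2On G σ) : IsL2On (fun x => F x - G x) σ :=
  ⟨hF.memLp.sub hG.memLp, fun x hx => by rw [hF.support x hx, hG.support x hx, sub_zero]⟩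

/-- The transposed kernels are inverse to each other. -/
theorem IsL2On.coact_coact (hγ : IsPotential γ) (hK : IsTransmutation γ K)
    (hH : IsInverseTransmutation γ H) (hG : IsL2On G σ) :
    coact H (coact K G) =ᵐ[volume] G := by
  have hE := hK.isL2On_coact hG
  have hHE := hH.isL2On_coact hE
  have hD := hG.sub hHE
  -- `G` and `coact H (coact K G)` have the same spectral transform, because `H` turns `Ψ` back into
  -- the exponential. Injectivity of `hat` and of `coact K` then identifies them.
  have h1 : ∀ t : ℝ, hat (coact K fun x => G x - coact H (coact K G) x) t = 0 := by
    intro t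
    rw [← hD.spectral_eq_hat hK.toIsConeKernel, spectral]
    simp only [sub_mul]
    rw [integral_sub (integrable_mul_of_isLocBdd hG.integrable hG.support (hK.isLocBdd_psi _))
      (integrable_mul_of_isLocBdd hHE.integrable hHE.support (hK.isLocBdd_psi _))]
    have e1 := hG.spectral_eq_hat hK.toIsConeKernel t
    have e2 := hE.spectral_coact hγ hK hH t
    simp only [spectral] at e1 e2
    rw [e1, e2, sub_self]
  have h2 := hK.ae_eq_zero_of_coact hD ((hK.isL2On_coact hD).ae_eq_zero_of_hat h1)
  filter_upwards [h2] with x hx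
  exact (sub_eq_zero.1 hx).symm

lemma IsConeKernel.isLocBdd_trace (hH : IsConeKernel H) : IsLocBdd fun s => H s 0 :=
  ⟨hH.measurable.comp (measurable_id.prodMk measurable_const), fun R => by
    obtain ⟨C, hC0, hC⟩ := hH.bound R
    exact ⟨C, hC0, fun x hx => hC x 0 hx⟩⟩

/-- The smooth part of the spectral functional applied to the translates of `E`. -/
noncomputable def tracePairing (H : ℝ → ℝ → ℂ) (E : ℝ → ℂ) (v : ℝ) : ℂ := ∫ s, E s * H (s + v) 0

lemma IsConeKernel.isLocBdd_tracePairing (hH : IsConeKernel H) (hE : IsL2On E σ) :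
    IsLocBdd (tracePairing H E) := by
  have hh := hH.isLocBdd_trace
  -- `IsLocBdd` demands true measurability, hence a Borel representative of `E`.
  set E' := hE.integrable.aestronglyMeasurable.mk E with hE'
  have hEE : E =ᵐ[volume] E' := hE.integrable.aestronglyMeasurable.ae_eq_mk
  have hE'm : Measurable E' := hE.integrable.aestronglyMeasurable.stronglyMeasurable_mk.measurable
  have e : tracePairing H E = fun v => ∫ s, E' s * H (s + v) 0 := by
    ext v
    refine integral_congr_ae ?_
    filter_upwards [hEE] with s hs
    rw [hs]
  refine ⟨?_, fun R => ?_⟩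
  · rw [e]
    have : Measurable fun p : ℝ × ℝ => E' p.2 * H (p.2 + p.1) 0 :=
      (hE'm.comp measurable_snd).mul (hh.measurable.comp
        (show Measurable fun p : ℝ × ℝ => p.2 + p.1 by fun_prop))
    exact this.stronglyMeasurable.integral_prod_right'.measurable
  · obtain ⟨C, hC0, hC⟩ := hh.bound (σ + R)
    refine ⟨(∫ s, ‖E s‖) * C, mul_nonneg (integral_nonneg fun _ => norm_nonneg _) hC0, fun v hv => ?_⟩
    rw [← integral_mul_const]
    refine norm_integral_le_of_norm_le (hE.integrable.norm.mul_const C)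
      (Eventually.of_forall fun s => ?_)
    rw [norm_mul]
    rcases le_or_gt |s| σ with hs | hs
    · gcongr
      exact hC _ ((abs_add_le s v).trans (by linarith))
    · rw [hE.support s hs]; simp

lemma integrable_mul_trace (hH : IsConeKernel H) (hE : IsL2On E σ) (v : ℝ) :
    Integrable fun s => E s * H (s + v) 0 :=
  integrable_mul_of_isLocBdd hE.integrable hE.support
    (hH.isLocBdd_trace.comp_continuous (r := fun s => s + v) (by fun_prop))

/-- The spectral functional inverts the transmutation. -/
theorem IsL2On.act_tracePairing (hγ : IsPotential γ) (hK : IsTransmutation γ K)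
    (hH : IsInverseTransmutation γ H) (hE : IsL2On E σ) (x : ℝ) :
    act K x (fun v => E (-v) + tracePairing H E v) = coact H E (-x) := by
  have hEi := hE.integrable
  have hT := hH.isLocBdd_tracePairing hE
  obtain ⟨C, hC0, hC⟩ := hK.bound |x|
  obtain ⟨Ch, hh0, hCh⟩ := hH.isLocBdd_trace.bound (σ + |x|)
  have hKm := hK.measurable_right x
  have hi1 : Integrable fun v => K x v * E (-v) := by
    refine (hEi.comp_neg.norm.const_mul C).mono' (hKm.aestronglyMeasurable.mul
      hEi.comp_neg.aestronglyMeasurable) (Eventually.of_forall fun v => ?_)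
    rw [norm_mul]
    gcongr
    exact hC _ _ le_rfl
  have hi2 : Integrable fun v => K x v * tracePairing H E v := hK.integrable_mul x hT
  have hi3 : Integrable fun s => E s * K x (-s) := by
    refine hi1.comp_neg.congr (Eventually.of_forall fun s => ?_)
    simp only [neg_neg]; ring
  have hsh : ∀ s, IsLocBdd fun v => H (s + v) 0 := fun s =>
    hH.isLocBdd_trace.comp_continuous (r := fun v => s + v) (by fun_prop)
  -- Fubini for the double integral
  have hP : Integrable (fun p : ℝ × ℝ => K x p.1 * (E p.2 * H (p.2 + p.1) 0)) (volume.prod volume) := by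
    have hK1 : Integrable fun v => K x v := by
      refine (hK.integrable_mul x (IsLocBdd.of_continuous (continuous_const (y := (1 : ℂ))))).congr
        (Eventually.of_forall fun v => by simp)
    refine ((hK1.mul_prod hEi).norm.mul_const Ch).mono' ?_ (Eventually.of_forall fun p => ?_)
    · exact hK1.aestronglyMeasurable.comp_fst.mul (hEi.aestronglyMeasurable.comp_snd.mul
        (hH.isLocBdd_trace.measurable.comp
          (show Measurable fun p : ℝ × ℝ => p.2 + p.1 by fun_prop)).aestronglyMeasurable)
    · rw [← mul_assoc, norm_mul]
      rcases le_or_gt |p.1| |x| with h1 | h1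
      · rcases le_or_gt |p.2| σ with h2 | h2
        · gcongr
          exact hCh _ ((abs_add_le _ _).trans (by linarith))
        · rw [hE.support _ h2]; simp
      · rw [hK.support _ _ h1]; simp
  have e1 : ∫ v, K x v * tracePairing H E v = ∫ s, E s * ∫ v, K x v * H (s + v) 0 := by
    calc _ = ∫ v, ∫ s, K x v * (E s * H (s + v) 0) := by
          simp only [tracePairing, integral_const_mul]
      _ = ∫ s, ∫ v, K x v * (E s * H (s + v) 0) := integral_integral_swap hP
      _ = _ := by
          congr 1; ext s
          rw [← integral_const_mul]
          congr 1; ext v; ring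
  have hi4 : Integrable fun s => E s * ∫ v, K x v * H (s + v) 0 := by
    refine hP.integral_prod_right.congr (Eventually.of_forall fun s => ?_)
    simp only
    rw [← integral_const_mul]
    congr 1; ext v; ring
  have e2 : ∫ v, K x v * E (-v) = ∫ s, E s * K x (-s) := by
    rw [← integral_neg_eq_self (fun v => K x v * E (-v))]
    congr 1; ext s; rw [neg_neg]; ring
  -- The decisive use of `eq_act`; its three terms match the terms of `act K x` after Fubini.
  have e3 : ∀ s, E s * H s (-x) = E s * K x (-s) + E s * H (s + x) 0 +
      E s * ∫ v, K x v * H (s + v) 0 := fun s => by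
    rw [hH.eq_act hγ hK x s, act]; ring
  rw [act, coact]
  simp only [mul_add, e3]
  have hi5 : Integrable fun s => E s * K x (-s) + E s * H (s + x) 0 :=
    hi3.add (integrable_mul_trace hH.toIsConeKernel hE x)
  rw [integral_add hi1 hi2, e1, e2, integral_add hi5 hi4,
    integral_add hi3 (integrable_mul_trace hH.toIsConeKernel hE x), tracePairing]
  ring

/-- The spectral functional of the reduced problem. -/
noncomputable def dist (H : ℝ → ℝ → ℂ) (e : ℂ → ℂ) : ℂ := unhat e 0 + ∫ s, H s 0 * unhat e s

lemma IsL2On.translate (hE : IsL2On E σ) (s : ℝ) : IsL2On (fun v => E (v + s)) (σ + |s|) := by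
  refine ⟨hE.memLp.comp_measurePreserving (measurePreserving_add_right volume s), fun v hv => ?_⟩
  refine hE.support _ ?_
  have := abs_sub_abs_le_abs_add v s
  linarith

lemma hat_translate (E : ℝ → ℂ) (s t : ℝ) :
    hat (fun v => E (v + s)) t = hat E t * Complex.exp (-(Complex.I * t * s)) := by
  rw [hat, hat, ← integral_mul_const,
    ← integral_add_right_eq_self (fun v => E v * Complex.exp (Complex.I * t * v) * _) s]
  congr 1; ext v
  rw [mul_assoc (E (v + s)), ← Complex.exp_add]
  congr 2; push_cast; ring

/-- The convolution theorem, read off from the bilinear Parseval identity for `E` and a translate of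
`F`. -/
lemma IsL2On.unhat_hat_mul_hat (hE : IsL2On E σ) (hF : IsL2On F τ) (s : ℝ) :
    unhat (fun ρ => hat E ρ * hat F ρ) s = ∫ v, E v * F (s - v) := by
  have h := hE.integral_hat_mul (hF.translate s)
  simp only [hat_translate] at h
  have e : (fun t : ℝ => hat E t * hat F t * Complex.exp (-(Complex.I * t * s))) =
      fun t : ℝ => hat E t * (hat F t * Complex.exp (-(Complex.I * t * s))) := by
    ext t; ring
  rw [unhat, e, h]
  have hπ : (π : ℂ) ≠ 0 := by exact_mod_cast pi_ne_zero
  rw [← mul_assoc, one_div, inv_mul_cancel₀ (by simp [hπ]), one_mul]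
  congr 1; ext v; congr 2; ring

lemma IsL2On.dist_hat_mul_hat (hH : IsConeKernel H) (hE : IsL2On E σ) (hF : IsL2On F σ) :
    dist H (fun ρ => hat E ρ * hat F ρ) = ∫ v, E v * (F (-v) + tracePairing H F v) := by
  have hh := hH.isLocBdd_trace
  obtain ⟨C, hC0, hC⟩ := hh.bound (σ + σ)
  have hEi := hE.integrable
  have hFi := hF.integrable
  have hT := hH.isLocBdd_tracePairing hF
  have hi1 : Integrable fun v => E v * F (-v) :=
    hE.memLp.integrable_mul (hF.memLp.comp_measurePreserving (Measure.measurePreserving_neg volume))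
  have hi2 : Integrable fun v => E v * tracePairing H F v :=
    integrable_mul_of_isLocBdd hEi hE.support hT
  have hP : Integrable (fun p : ℝ × ℝ => H p.1 0 * (E p.2 * F (p.1 - p.2))) (volume.prod volume) := by
    have hconv : Integrable (fun p : ℝ × ℝ => E p.2 * F (p.1 - p.2)) (volume.prod volume) :=
      hEi.convolution_integrand (ContinuousLinearMap.mul ℂ ℂ) hFi
    refine (hconv.norm.const_mul C).mono' ((hh.measurable.comp
      measurable_fst).aestronglyMeasurable.mul hconv.aestronglyMeasurable)
      (Eventually.of_forall fun p => ?_)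
    rw [norm_mul]
    by_cases hp : |p.2| ≤ σ ∧ |p.1 - p.2| ≤ σ
    · gcongr
      refine hC _ ?_
      have := abs_add_le (p.1 - p.2) p.2
      rw [sub_add_cancel] at this
      linarith [hp.1, hp.2]
    · rw [not_and_or, not_le, not_le] at hp
      rcases hp with hp | hp
      · rw [hE.support _ hp]; simp
      · rw [hF.support _ hp]; simp
  have e1 : ∫ s, H s 0 * ∫ v, E v * F (s - v) = ∫ v, E v * tracePairing H F v := by
    calc _ = ∫ s, ∫ v, H s 0 * (E v * F (s - v)) := by simp only [integral_const_mul]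
      _ = ∫ v, ∫ s, H s 0 * (E v * F (s - v)) := integral_integral_swap hP
      _ = _ := by
          congr 1; ext v
          rw [tracePairing, ← integral_const_mul,
            ← integral_add_right_eq_self (fun s => H s 0 * (E v * F (s - v))) v]
          congr 1; ext s
          rw [add_sub_cancel_right]; ring
  rw [dist]
  simp only [hE.unhat_hat_mul_hat hF, zero_sub]
  rw [e1, ← integral_add hi1 hi2]
  simp only [mul_add]

/-- The Parseval equality for the reduced problem. -/
theorem IsL2On.dist_spectral_mul_spectral (hγ : IsPotential γ) (hK : IsTransmutation γ K)
    (hH : IsInverseTransmutation γ H) (hF : IsL2On F σ) (hG : IsL2On G σ) :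
    dist H (fun ρ => spectral K F ρ * spectral K G ρ) = ∫ x, F x * G (-x) := by
  have hE1 := hK.isL2On_coact hF
  have hE2 := hK.isL2On_coact hG
  have hT := hH.isLocBdd_tracePairing hE2
  have hneg : MemLp (fun v => coact K G (-v)) 2 :=
    hE2.memLp.comp_measurePreserving (Measure.measurePreserving_neg volume)
  simp only [hF.spectral_eq_hat hK.toIsConeKernel, hG.spectral_eq_hat hK.toIsConeKernel]
  -- Moving `K` from the first factor to the second produces `act K x` of the expression in
  -- `act_tracePairing`, that is `coact H (coact K G) (-x)`, which is `G (-x)` almost everywhere.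
  rw [hE1.dist_hat_mul_hat hH.toIsConeKernel hE2, ← hK.integral_mul_act hF.integrable hF.support]
  · have hae : ∀ᵐ x, coact H (coact K G) (-x) = G (-x) :=
      (Measure.measurePreserving_neg volume).quasiMeasurePreserving.ae (hG.coact_coact hγ hK hH)
    refine integral_congr_ae ?_
    filter_upwards [hae] with x hx
    rw [hE2.act_tracePairing hγ hK hH, hx]
  · exact (hE2.integrable.comp_neg.integrableOn).add (integrableOn_of_isLocBdd hT σ)
  · simp only [mul_add]
    exact (hF.memLp.integrable_mul hneg).add
      (integrable_mul_of_isLocBdd hF.integrable hF.support hT)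

end SpectralFn

/-! ### The functional as an element of the dual of `Z`, and the scalar expansion formula. -/

namespace SpectralFn
open Set Function Real
open scoped FourierTransform

variable {W K H : ℝ → ℝ → ℂ} {γ E F G : ℝ → ℂ} {σ τ : ℝ} {e e' : ℂ → ℂ}

lemma mem_Z {C : ℝ} (hd : Differentiable ℂ e) (hb : ∀ ρ : ℂ, ‖e ρ‖ ≤ C * exp (σ * |ρ.im|))
    (hi : Integrable fun t : ℝ => e t) : e ∈ Z := by
  refine ⟨⟨hd, |C| + 1, by positivity, |σ| + 1, by positivity, fun ρ => (hb ρ).trans ?_⟩, hi⟩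
  have h1 : C ≤ |C| + 1 := (le_abs_self C).trans (by linarith)
  have h2 : σ ≤ |σ| + 1 := (le_abs_self σ).trans (by linarith)
  gcongr

lemma exists_bound_of_mem_Z (he : e ∈ Z) :
    ∃ C σ : ℝ, 0 ≤ C ∧ 0 ≤ σ ∧ ∀ ρ : ℂ, ‖e ρ‖ ≤ C * exp (σ * |ρ.im|) := by
  obtain ⟨⟨_, C, hC, σ, hσ, h⟩, _⟩ := he
  exact ⟨C, σ, hC.le, hσ.le, h⟩

/-- Multiplication by an entire function of exponential type that is bounded on the real line. -/
lemma mul_mem_Z {C : ℝ} (he : e ∈ Z) (hd : Differentiable ℂ e')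
    (hb : ∀ ρ : ℂ, ‖e' ρ‖ ≤ C * exp (σ * |ρ.im|)) : (fun ρ => e ρ * e' ρ) ∈ Z := by
  obtain ⟨C', σ', hC', hσ', hb'⟩ := exists_bound_of_mem_Z he
  refine mem_Z (C := C' * C) (σ := σ' + σ) (he.1.1.mul hd) (fun ρ => ?_) ?_
  · rw [norm_mul, add_mul, exp_add]
    calc _ ≤ (C' * exp (σ' * |ρ.im|)) * (C * exp (σ * |ρ.im|)) :=
          mul_le_mul (hb' ρ) (hb ρ) (norm_nonneg _) (by positivity)
      _ = _ := by ring
  · refine (he.2.norm.mul_const C).mono' (he.2.aestronglyMeasurable.mul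
      (hd.continuous.comp Complex.continuous_ofReal).aestronglyMeasurable)
      (Eventually.of_forall fun t => ?_)
    rw [norm_mul]
    have := hb t
    rw [Complex.ofReal_im, abs_zero, mul_zero, exp_zero, mul_one] at this
    exact mul_le_mul_of_nonneg_left this (norm_nonneg _)

lemma IsL2On.hat_mul_hat_mem_Z (hE : IsL2On E σ) (hF : IsL2On F τ) :
    (fun ρ => hat E ρ * hat F ρ) ∈ Z := by
  refine mem_Z (C := (∫ s, ‖E s‖) * ∫ s, ‖F s‖) (σ := σ + τ)
    ((differentiable_hat hE.integrable hE.support).mul (differentiable_hat hF.integrable hF.support))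
    (fun ρ => ?_) (hE.integrable_hat_mul hF)
  rw [norm_mul, add_mul, exp_add]
  have h0 : 0 ≤ ∫ s, ‖E s‖ := integral_nonneg fun _ => norm_nonneg _
  calc _ ≤ ((∫ s, ‖E s‖) * exp (σ * |ρ.im|)) * ((∫ s, ‖F s‖) * exp (τ * |ρ.im|)) :=
        mul_le_mul (norm_hat_le hE.integrable hE.support ρ) (norm_hat_le hF.integrable hF.support ρ)
          (norm_nonneg _) (by positivity)
    _ = _ := by ring

lemma IsL2On.spectral_mul_spectral_mem_Z (hK : IsConeKernel K) (hF : IsL2On F σ)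
    (hG : IsL2On G σ) : (fun ρ => spectral K F ρ * spectral K G ρ) ∈ Z := by
  simp only [hF.spectral_eq_hat hK, hG.spectral_eq_hat hK]
  exact (hK.isL2On_coact hF).hat_mul_hat_mem_Z (hK.isL2On_coact hG)

lemma isL2On_of_bounded {C : ℝ} (hm : AEStronglyMeasurable E volume) (hb : ∀ s, ‖E s‖ ≤ C)
    (hs : ∀ s, σ < |s| → E s = 0) : IsL2On E σ := by
  have hC : 0 ≤ C := (norm_nonneg _).trans (hb 0)
  refine ⟨(memLp_two_iff_integrable_sq_norm hm).2 ?_, hs⟩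
  have h1 := integrable_of_bounded_interval (f := fun v => (((‖E v‖ ^ 2 : ℝ)) : ℂ))
    (R := σ) (C := C ^ 2)
    (Complex.continuous_ofReal.comp_aestronglyMeasurable (hm.norm.pow 2)) (fun v => ?_)
    fun v hv => by simp [hs v hv]
  · exact h1.re
  · rw [Complex.norm_real, Real.norm_of_nonneg (by positivity)]
    have := hb v
    gcongr

lemma IsConeKernel.isL2On (hW : IsConeKernel W) (x : ℝ) : IsL2On (W x) |x| := by
  obtain ⟨C, hC0, hC⟩ := hW.bound |x|
  exact isL2On_of_bounded (hW.measurable_right x).aestronglyMeasurable (fun v => hC x v le_rfl)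
    fun v hv => hW.support x v hv

lemma psi_eq_add_hat (K : ℝ → ℝ → ℂ) (ρ : ℂ) (y : ℝ) :
    psi K ρ y = Complex.exp (Complex.I * ρ * y) + hat (K y) ρ := rfl

lemma IsConeKernel.differentiable_psi (hK : IsConeKernel K) (y : ℝ) :
    Differentiable ℂ fun ρ => psi K ρ y := by
  have h := hK.isL2On y
  have : Differentiable ℂ fun ρ : ℂ => Complex.exp (Complex.I * ρ * y) := by fun_prop
  exact this.add (differentiable_hat h.integrable h.support)

lemma IsConeKernel.norm_psi_le (hK : IsConeKernel K) (ρ : ℂ) (y : ℝ) :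
    ‖psi K ρ y‖ ≤ (1 + ∫ v, ‖K y v‖) * exp (|y| * |ρ.im|) := by
  have h := hK.isL2On y
  rw [psi_eq_add_hat, add_mul, one_mul]
  exact (norm_add_le _ _).trans
    (add_le_add (norm_cexp_I_mul_le ρ le_rfl) (norm_hat_le h.integrable h.support ρ))

lemma IsConeKernel.mul_psi_mem_Z (hK : IsConeKernel K) (he : e ∈ Z) (y : ℝ) :
    (fun ρ => e ρ * psi K ρ y) ∈ Z :=
  mul_mem_Z he (hK.differentiable_psi y) fun ρ => hK.norm_psi_le ρ y

lemma norm_unhat_le (hi : Integrable fun t : ℝ => e t) (s : ℝ) :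
    ‖unhat e s‖ ≤ ∫ t : ℝ, ‖e t‖ := by
  rw [unhat, norm_mul]
  have h1 : ‖(1 / (2 * π) : ℂ)‖ ≤ 1 := by
    rw [norm_div, norm_one, norm_mul, Complex.norm_ofNat, Complex.norm_real,
      Real.norm_of_nonneg pi_pos.le]
    rw [div_le_one (by positivity)]
    linarith [pi_gt_three]
  have h2 : ‖∫ t : ℝ, e t * Complex.exp (-(Complex.I * t * s))‖ ≤ ∫ t : ℝ, ‖e t‖ :=
    norm_integral_le_of_norm_le hi.norm (Eventually.of_forall fun t => by
      rw [norm_mul, norm_cexp_neg_I_mul, mul_one])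
  calc _ ≤ 1 * ∫ t : ℝ, ‖e t‖ := mul_le_mul h1 h2 (norm_nonneg _) zero_le_one
    _ = _ := one_mul _

lemma continuous_unhat (hi : Integrable fun t : ℝ => e t) : Continuous (unhat e) := by
  refine continuous_const.mul (continuous_of_dominated (fun s => (integrable_unhat hi s).aestronglyMeasurable)
    (fun s => Eventually.of_forall fun t => ?_) hi.norm (Eventually.of_forall fun t => by fun_prop))
  rw [norm_mul, norm_cexp_neg_I_mul, mul_one]

lemma isL2On_unhat (hi : Integrable fun t : ℝ => e t) (hs : ∀ s, τ < |s| → unhat e s = 0) :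
    IsL2On (unhat e) τ :=
  isL2On_of_bounded (continuous_unhat hi).aestronglyMeasurable (norm_unhat_le hi) hs

lemma exists_isL2On_unhat (he : e ∈ Z) : ∃ τ, 0 ≤ τ ∧ IsL2On (unhat e) τ := by
  obtain ⟨C, σ, hC, hσ, hb⟩ := exists_bound_of_mem_Z he
  exact ⟨σ, hσ, isL2On_unhat he.2 fun s hs => unhat_eq_zero he.1.1 hC hb he.2 hs⟩

lemma IsL2On.integrable_trace_mul (hH : IsConeKernel H) (hE : IsL2On E τ) :
    Integrable fun s => H s 0 * E s := by
  refine (integrable_mul_of_isLocBdd hE.integrable hE.support hH.isLocBdd_trace).congr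
    (Eventually.of_forall fun s => mul_comm _ _)

lemma unhat_add (h : Integrable fun t : ℝ => e t) (h' : Integrable fun t : ℝ => e' t) (s : ℝ) :
    unhat (fun ρ => e ρ + e' ρ) s = unhat e s + unhat e' s := by
  simp only [unhat, add_mul]
  rw [integral_add (integrable_unhat h s) (integrable_unhat h' s), mul_add]

lemma unhat_const_mul (c : ℂ) (e : ℂ → ℂ) (s : ℝ) :
    unhat (fun ρ => c * e ρ) s = c * unhat e s := by
  simp only [unhat, mul_assoc]
  rw [integral_const_mul]
  ring

lemma IsConeKernel.dist_add (hH : IsConeKernel H) (he : e ∈ Z) (he' : e' ∈ Z) :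
    dist H (fun ρ => e ρ + e' ρ) = dist H e + dist H e' := by
  obtain ⟨τ, _, h⟩ := exists_isL2On_unhat he
  obtain ⟨τ', _, h'⟩ := exists_isL2On_unhat he'
  simp only [dist, unhat_add he.2 he'.2, mul_add]
  rw [integral_add (h.integrable_trace_mul hH) (h'.integrable_trace_mul hH)]
  ring

lemma dist_const_mul (H : ℝ → ℝ → ℂ) (c : ℂ) (e : ℂ → ℂ) :
    dist H (fun ρ => c * e ρ) = c * dist H e := by
  simp only [dist, unhat_const_mul, mul_left_comm _ c]
  rw [integral_const_mul]
  ring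

/-- The spectral functional of the reduced problem as a linear functional on `Z`. -/
noncomputable def distLinear (hH : IsConeKernel H) : Z →ₗ[ℂ] ℂ where
  toFun e := dist H e
  map_add' a b := hH.dist_add a.2 b.2
  map_smul' c a := dist_const_mul H c a

/-- Each value of `unhat e` is bounded by the `L¹` norm of `e`, so the constant depends only on the
interval carrying `unhat e`. -/
lemma norm_dist_le {C : ℝ} (hC : ∀ s, |s| ≤ τ → ‖H s 0‖ ≤ C) (hτ : 0 ≤ τ) (he : e ∈ Z)
    (hs : ∀ s, τ < |s| → unhat e s = 0) :
    ‖dist H e‖ ≤ (1 + 2 * τ * C) * ∫ t : ℝ, ‖e t‖ := by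
  have hC0 : 0 ≤ C := (norm_nonneg _).trans (hC 0 (by simpa using hτ))
  have h0 : 0 ≤ ∫ t : ℝ, ‖e t‖ := integral_nonneg fun _ => norm_nonneg _
  have h1 : ∫ s, H s 0 * unhat e s = ∫ s in Icc (-τ) τ, H s 0 * unhat e s := by
    refine (setIntegral_eq_integral_of_forall_compl_eq_zero fun s hs' => ?_).symm
    rw [mem_Icc, ← abs_le, not_le] at hs'
    rw [hs s hs', mul_zero]
  have h2 : ‖∫ s in Icc (-τ) τ, H s 0 * unhat e s‖ ≤ (C * ∫ t : ℝ, ‖e t‖) * (2 * τ) := by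
    refine (norm_setIntegral_le_of_norm_le_const (C := C * ∫ t : ℝ, ‖e t‖) (by simp)
      fun s hs' => ?_).trans (le_of_eq ?_)
    · rw [norm_mul]
      exact mul_le_mul (hC s (abs_le.2 hs')) (norm_unhat_le he.2 s) (norm_nonneg _) hC0
    · rw [measureReal_def, Real.volume_Icc, ENNReal.toReal_ofReal (by linarith)]; ring
  rw [dist, h1]
  calc _ ≤ (∫ t : ℝ, ‖e t‖) + (C * ∫ t : ℝ, ‖e t‖) * (2 * τ) :=
        (norm_add_le _ _).trans (add_le_add (norm_unhat_le he.2 0) h2)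
    _ = _ := by ring

theorem distLinear_mem_ZDual (hH : IsConeKernel H) : distLinear hH ∈ ZDual := by
  rintro e e₀ ⟨hlim, htype⟩
  obtain ⟨τ, hτ, _⟩ := EReal.lt_iff_exists_real_btwn.1 htype
  obtain ⟨C₀, σ, hC₀, hσ, hb₀⟩ := exists_bound_of_mem_Z e₀.2
  set T := max |τ| σ with hT
  have hT0 : 0 ≤ T := (abs_nonneg τ).trans (le_max_left _ _)
  obtain ⟨C, hC0, hC⟩ := hH.isLocBdd_trace.bound T
  have hs : ∀ n s, T < |s| → unhat ((e n - e₀ : Z) : ℂ → ℂ) s = 0 := by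
    intro n s hs
    -- The constant `C₁` may vary with `n`; only the common exponent `τ` matters, since it alone
    -- determines the support in Paley–Wiener.
    obtain ⟨C₁, hC₁, hb₁⟩ := (e n).2.1.norm_le_of_expType_lt (τ := τ)
      ((le_iSup (fun n => expType (e n)) n).trans_lt hτ)
    refine unhat_eq_zero (C := C₁ + C₀) (σ := T) (e n - e₀).2.1.1 (by positivity) (fun ρ => ?_)
      (e n - e₀).2.2 hs
    calc ‖((e n - e₀ : Z) : ℂ → ℂ) ρ‖ ≤ ‖(e n : ℂ → ℂ) ρ‖ + ‖(e₀ : ℂ → ℂ) ρ‖ := norm_sub_le _ _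
      _ ≤ C₁ * exp (τ * |ρ.im|) + C₀ * exp (σ * |ρ.im|) := add_le_add (hb₁ ρ) (hb₀ ρ)
      _ ≤ C₁ * exp (T * |ρ.im|) + C₀ * exp (T * |ρ.im|) := by
          have h1 : τ ≤ T := (le_abs_self τ).trans (le_max_left _ _)
          have h2 : σ ≤ T := le_max_right _ _
          gcongr
      _ = _ := by ring
  rw [tendsto_iff_norm_sub_tendsto_zero]
  have h := hlim.const_mul (1 + 2 * T * C)
  rw [mul_zero] at h
  refine squeeze_zero (fun _ => norm_nonneg _) (fun n => ?_) h
  rw [← map_sub]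
  exact norm_dist_le hC hT0 (e n - e₀).2 (hs n)

/-- Fourier inversion for test functions. -/
theorem hat_unhat (he : e ∈ Z) (t : ℝ) : hat (unhat e) t = e t := by
  obtain ⟨τ, _, hE⟩ := exists_isL2On_unhat he
  have hπ : (π : ℂ) ≠ 0 := by exact_mod_cast pi_ne_zero
  have hc : Continuous fun t : ℝ => e t := he.1.1.continuous.comp Complex.continuous_ofReal
  have h1 : ∀ u, unhat e (2 * π * u) = 1 / (2 * π) * 𝓕 (fun t : ℝ => e t) u := by
    intro u
    rw [unhat, Real.fourier_eq']
    congr 2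
    ext s
    simp only [smul_eq_mul, inner]
    rw [mul_comm]
    congr 2
    push_cast
    simp
    ring
  have h2 : 𝓕 (fun t : ℝ => e t) = fun u => 2 * π * unhat e (u * (2 * π)) := by
    ext u
    rw [mul_comm u, h1]
    field_simp
  -- The transform is bounded with compact support, so pointwise Fourier inversion is available.
  have hF : Integrable (𝓕 fun t : ℝ => e t) := by
    rw [h2]
    exact (hE.integrable.comp_mul_right' (R := 2 * π) (by positivity)).const_mul _
  have h3 := congrFun (hc.fourierInv_fourier_eq he.2 hF) t
  rw [← h3, Real.fourierInv_eq', h2]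
  have h4 := Measure.integral_comp_mul_right
    (fun s : ℝ => unhat e s * Complex.exp (Complex.I * t * s)) (2 * π)
  rw [hat]
  have h5 : ∀ v : ℝ, Complex.exp (((2 * π * inner ℝ v t : ℝ) : ℂ) * Complex.I) •
      (2 * π * unhat e (v * (2 * π)) : ℂ) = 2 * π * (unhat e (v * (2 * π)) *
        Complex.exp (Complex.I * t * ((v * (2 * π) : ℝ) : ℂ))) := by
    intro v
    simp only [smul_eq_mul, inner]
    rw [mul_comm (Complex.exp _), mul_assoc]
    congr 3
    push_cast
    simp
    ring
  simp only [h5]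
  rw [integral_const_mul, h4, abs_of_pos (by positivity), Complex.real_smul]
  push_cast
  field_simp

/-- The exponential factor translates `unhat e` by `y`. The result is the function to which `act K`
is applied in `act_tracePairing`. -/
lemma dist_mul_cexp (hE : E = unhat e) (y : ℝ) :
    dist H (fun ρ => e ρ * Complex.exp (Complex.I * ρ * y)) = E (-y) + tracePairing H E y := by
  have h : ∀ s, unhat (fun ρ => e ρ * Complex.exp (Complex.I * ρ * y)) s = E (s - y) := fun s => by
    rw [hE, unhat, unhat]
    congr 2; ext t
    rw [mul_assoc, ← Complex.exp_add]
    congr 2; push_cast; ring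
  simp only [dist, h, zero_sub, tracePairing]
  rw [← integral_add_right_eq_self (fun s => H s 0 * E (s - y)) y]
  congr 2; ext s
  rw [add_sub_cancel_right, mul_comm]

lemma coact_congr (h : E =ᵐ[volume] F) : coact W E =ᵐ[volume] coact W F := by
  filter_upwards [h] with v hv
  rw [coact, coact, hv]
  congr 1
  refine integral_congr_ae ?_
  filter_upwards [h] with x hx
  rw [hx]

/-- The expansion formula for the reduced problem. -/
theorem IsL2On.dist_spectral_mul_psi (hγ : IsPotential γ) (hK : IsTransmutation γ K)
    (hH : IsInverseTransmutation γ H) (hF : IsL2On F σ) (hZ : spectral K F ∈ Z) :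
    ∀ᵐ y, dist H (fun ρ => spectral K F ρ * psi K ρ y) = F (-y) := by
  obtain ⟨τ, hτ, hE⟩ := exists_isL2On_unhat hZ
  set E := unhat (spectral K F) with hEdef
  have hE0 := hK.isL2On_coact hF
  have hae : E =ᵐ[volume] coact K F := by
    have h1 := (hE.mono (le_max_left τ σ)).sub (hE0.mono (le_max_right τ σ))
    have h2 := h1.ae_eq_zero_of_hat fun t => by
      simp only [hat, sub_mul]
      rw [integral_sub (integrable_hat hE.integrable hE.support _)
        (integrable_hat hE0.integrable hE0.support _)]
      have h3 := hat_unhat hZ t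
      have h4 := hF.spectral_eq_hat hK.toIsConeKernel t
      simp only [hat] at h3 h4
      rw [h3, ← h4, sub_self]
    filter_upwards [h2] with x hx
    exact sub_eq_zero.1 hx
  have hhat : spectral K F = hat E := by
    ext ρ
    rw [hF.spectral_eq_hat hK.toIsConeKernel, hat, hat]
    refine integral_congr_ae ?_
    filter_upwards [hae] with x hx
    rw [hx]
  have hco : ∀ᵐ y, coact H E (-y) = F (-y) :=
    (Measure.measurePreserving_neg volume).quasiMeasurePreserving.ae
      ((coact_congr hae).trans (hF.coact_coact hγ hK hH))
  filter_upwards [hco] with y hy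
  have hKy := hK.isL2On y
  -- The exponential part of `Ψ` is not the transform of a square integrable function and is treated
  -- by translation; the remainder is `hat (K y)` and falls under the product formula. Together they
  -- form `act K y`.
  have e1 : (fun ρ => spectral K F ρ * psi K ρ y) = fun ρ =>
      spectral K F ρ * Complex.exp (Complex.I * ρ * y) + hat (K y) ρ * hat E ρ := by
    ext ρ
    rw [psi_eq_add_hat, ← hhat]; ring
  rw [e1, hH.dist_add (e := fun ρ => spectral K F ρ * Complex.exp (Complex.I * ρ * y))
    (mul_mem_Z (C := 1) (σ := |y|) hZ (by fun_prop) fun ρ => by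
      rw [one_mul]; exact norm_cexp_I_mul_le ρ le_rfl)
    (hKy.hat_mul_hat_mem_Z hE), dist_mul_cexp hEdef,
    (hKy.mono (le_max_left |y| τ)).dist_hat_mul_hat hH.toIsConeKernel
      (hE.mono (le_max_right |y| τ)), ← hy, ← hE.act_tracePairing hγ hK hH y, act]

end SpectralFn

/-! ### From systems on the half line to the scalar problem on the line. -/

namespace SpectralFn
open Set Function Real

variable {f g h : ℝ → ℂ} {σ : ℝ}

/-- The function on the line given by `f(x)` for `x > 0`, by `g(-x)` for `x < 0`, and by `0`
at the origin. -/
noncomputable def glue (f g : ℝ → ℂ) (x : ℝ) : ℂ :=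
  (Ioi 0).indicator f x + (Ioi 0).indicator g (-x)

lemma glue_of_pos (f g : ℝ → ℂ) {x : ℝ} (hx : 0 < x) : glue f g x = f x := by
  have h : -x ∉ Ioi (0 : ℝ) := by simp [hx.le]
  rw [glue, indicator_of_mem (mem_Ioi.2 hx), indicator_of_notMem h, add_zero]

lemma glue_neg_of_pos (f g : ℝ → ℂ) {x : ℝ} (hx : 0 < x) : glue f g (-x) = g x := by
  have h : -x ∉ Ioi (0 : ℝ) := by simp [hx.le]
  rw [glue, neg_neg, indicator_of_mem (mem_Ioi.2 hx), indicator_of_notMem h, zero_add]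

lemma glue_zero (f g : ℝ → ℂ) : glue f g 0 = 0 := by simp [glue]

lemma isLocBdd_glue (hf : Continuous f) (hg : Continuous g) : IsLocBdd (glue f g) := by
  refine ⟨(hf.measurable.indicator measurableSet_Ioi).add
    ((hg.measurable.indicator measurableSet_Ioi).comp measurable_neg), fun R => ?_⟩
  obtain ⟨C, hC0, hC⟩ := (IsLocBdd.of_continuous hf).bound R
  obtain ⟨C', hC0', hC'⟩ := (IsLocBdd.of_continuous hg).bound R
  refine ⟨C + C', by positivity, fun x hx => (norm_add_le _ _).trans (add_le_add ?_ ?_)⟩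
  · exact (norm_indicator_le_norm_self f x).trans (hC x hx)
  · exact (norm_indicator_le_norm_self g (-x)).trans (hC' (-x) (by rwa [abs_neg]))

lemma isL2On_glue (hf : MemLp f 2 (volume.restrict (Ioi 0)))
    (hg : MemLp g 2 (volume.restrict (Ioi 0))) (hfs : ∀ x, σ < x → f x = 0)
    (hgs : ∀ x, σ < x → g x = 0) : IsL2On (glue f g) σ := by
  refine ⟨((memLp_indicator_iff_restrict measurableSet_Ioi).2 hf).add
    (((memLp_indicator_iff_restrict measurableSet_Ioi).2 hg).comp_measurePreserving
      (Measure.measurePreserving_neg volume)), fun x hx => ?_⟩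
  rcases lt_trichotomy x 0 with h | rfl | h
  · rw [← neg_neg x, glue_neg_of_pos f g (neg_pos.2 h)]
    exact hgs _ (by rwa [abs_of_neg h] at hx)
  · exact glue_zero f g
  · rw [glue_of_pos f g h]
    exact hfs _ (by rwa [abs_of_pos h] at hx)

lemma IsL2On.mul_isLocBdd {E : ℝ → ℂ} (hE : IsL2On E σ) (hg : IsLocBdd g) :
    IsL2On (fun x => E x * g x) σ := by
  obtain ⟨C, hC0, hC⟩ := hg.bound σ
  refine ⟨(hE.memLp.norm.const_mul C).mono
    (hE.memLp.aestronglyMeasurable.mul hg.measurable.aestronglyMeasurable)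
    (Eventually.of_forall fun x => ?_), fun x hx => by rw [hE.support x hx, zero_mul]⟩
  rw [norm_mul, norm_mul, norm_norm, Real.norm_of_nonneg hC0, mul_comm]
  rcases le_or_gt |x| σ with hx | hx
  · gcongr
    exact hC x hx
  · rw [hE.support x hx]; simp

lemma integral_eq_integral_Ioi_add_neg {k : ℝ → ℂ} (hk : Integrable k) :
    ∫ x, k x = ∫ x in Ioi (0 : ℝ), (k x + k (-x)) := by
  rw [integral_add hk.integrableOn hk.comp_neg.integrableOn, integral_comp_neg_Ioi, neg_zero,
    add_comm]
  exact (intervalIntegral.integral_Iic_add_Ioi hk.integrableOn hk.integrableOn).symm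

/-- Variation of constants on the half line. -/
lemma eq_exp_mul_sub_integral {p q γ : ℝ → ℂ} {μ : ℂ} (hγ : IsLocBdd γ)
    (hp : ContinuousOn p (Ici 0)) (hq : ContinuousOn q (Ici 0))
    (h : ∀ x, 0 < x → HasDerivAt p (μ * p x - γ x * q x) x) {x : ℝ} (hx : 0 ≤ x) :
    p x = Complex.exp (μ * x) * p 0 -
      ∫ t in (0 : ℝ)..x, Complex.exp (μ * (x - t)) * (γ t * q t) := by
  have hexp : ∀ t : ℝ, HasDerivAt (fun t : ℝ => Complex.exp (μ * (x - t)))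
      (Complex.exp (μ * (x - t)) * -μ) t := by
    intro t
    have h1 : HasDerivAt (fun t : ℝ => μ * ((x : ℂ) - t)) (-μ) t := by
      simpa using ((Complex.ofRealCLM.hasDerivAt (x := t)).const_sub (x : ℂ)).const_mul μ
    exact h1.cexp
  have hcont : Continuous fun t : ℝ => Complex.exp (μ * (x - t)) := by fun_prop
  have hsub : Icc 0 x ⊆ Ici 0 := fun t ht => ht.1
  have hi : IntervalIntegrable (fun t : ℝ => -(Complex.exp (μ * (x - t)) * (γ t * q t)))
      volume 0 x := by
    have h1 : IntervalIntegrable (fun t : ℝ => γ t * (Complex.exp (μ * (x - t)) * q t))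
        volume 0 x := by
      refine (hγ.intervalIntegrable 0 x).mul_continuousOn ?_
      rw [uIcc_of_le hx]
      exact hcont.continuousOn.mul (hq.mono hsub)
    exact h1.neg.congr (fun t _ => by simp only [Pi.neg_apply]; ring)
  have key := intervalIntegral.integral_eq_sub_of_hasDerivAt_of_le hx
    (f := fun t : ℝ => Complex.exp (μ * (x - t)) * p t)
    (f' := fun t : ℝ => -(Complex.exp (μ * (x - t)) * (γ t * q t)))
    (hcont.continuousOn.mul (hp.mono hsub))
    (fun t ht => ((hexp t).mul (h t ht.1)).congr_deriv (by ring)) hi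
  rw [intervalIntegral.integral_neg] at key
  simp only [sub_self, mul_zero, Complex.exp_zero, one_mul, Complex.ofReal_zero, sub_zero] at key
  linear_combination -key

/-- Solutions of the reduced system on the half line are multiples of `Ψ(x)`, `Ψ(-x)`. -/
theorem IsTransmutation.eq_mul_psi {γ p q : ℝ → ℂ} {K : ℝ → ℝ → ℂ} {ρ c : ℂ}
    (hγ : IsPotential γ) (hK : IsTransmutation γ K)
    (hp : ContinuousOn p (Ici 0)) (hq : ContinuousOn q (Ici 0)) (hp0 : p 0 = c) (hq0 : q 0 = c)
    (hp' : ∀ x, 0 < x → HasDerivAt p (Complex.I * ρ * p x - γ x * q x) x)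
    (hq' : ∀ x, 0 < x → HasDerivAt q (-(Complex.I * ρ) * q x + γ (-x) * p x) x)
    {x : ℝ} (hx : 0 ≤ x) : p x = c * psi K ρ x ∧ q x = c * psi K ρ (-x) := by
  -- Since `p 0 = q 0`, the two components glue to one function with `Y (-y) = q y`. The two
  -- half-line equations become the single Duhamel equation that characterises `c Ψ`.
  set Y : ℝ → ℂ := fun y => if 0 ≤ y then p y else q (-y) with hY
  have hYp : ∀ y, 0 ≤ y → Y y = p y := fun y hy => if_pos hy
  have hYq : ∀ y, 0 ≤ y → Y (-y) = q y := fun y hy => by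
    rcases hy.eq_or_lt with rfl | hy
    · rw [neg_zero, hYp 0 le_rfl, hp0, hq0]
    · rw [hY]; simp only
      rw [if_neg (by linarith), neg_neg]
  have hYeq : ∀ y, Y y = Complex.exp (Complex.I * ρ * y) * c -
      ∫ t in (0 : ℝ)..y, Complex.exp (Complex.I * ρ * (y - t)) * (γ t * Y (-t)) := by
    intro y
    rcases le_total 0 y with hy | hy
    · rw [hYp y hy, eq_exp_mul_sub_integral hγ.toIsLocBdd hp hq hp' hy, hp0]
      congr 1
      refine intervalIntegral.integral_congr fun t ht => ?_
      rw [uIcc_of_le hy] at ht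
      rw [hYq t ht.1]
    · have hγn : IsLocBdd fun t => -γ (-t) := by
        refine ⟨(hγ.measurable.comp measurable_neg).neg, fun R => ?_⟩
        obtain ⟨C, hC0, hC⟩ := hγ.bound R
        exact ⟨C, hC0, fun x hx => by rw [norm_neg]; exact hC _ (by rwa [abs_neg])⟩
      have h1 := eq_exp_mul_sub_integral (μ := -(Complex.I * ρ)) hγn hq hp
        (fun x hx => (hq' x hx).congr_deriv (by ring)) (neg_nonneg.2 hy)
      have h2 := hYq (-y) (neg_nonneg.2 hy)
      rw [neg_neg] at h2
      rw [h2, h1, hq0]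
      have h3 := intervalIntegral.integral_comp_neg (a := 0) (b := -y)
        (fun t : ℝ => Complex.exp (Complex.I * ρ * (y - t)) * (γ t * Y (-t)))
      rw [neg_neg, neg_zero] at h3
      rw [intervalIntegral.integral_symm y 0, ← h3, sub_neg_eq_add, sub_eq_add_neg,
        ← intervalIntegral.integral_neg]
      congr 1
      · push_cast
        rw [neg_mul_neg]
      · refine intervalIntegral.integral_congr fun t ht => ?_
        rw [uIcc_of_le (neg_nonneg.2 hy)] at ht
        simp only [neg_neg]
        rw [hYp t ht.1]
        push_cast
        rw [show -(Complex.I * ρ) * (-y - t) = Complex.I * ρ * (y - -t) by ring]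
        ring
  -- boundedness on compact intervals
  set R := |x| with hR
  obtain ⟨C₁, hC₁⟩ := (isCompact_Icc (a := (0 : ℝ)) (b := R)).exists_bound_of_continuousOn
    (hp.mono fun t ht => ht.1)
  obtain ⟨C₂, hC₂⟩ := (isCompact_Icc (a := (0 : ℝ)) (b := R)).exists_bound_of_continuousOn
    (hq.mono fun t ht => ht.1)
  obtain ⟨C₃, hC₃0, hC₃⟩ := (hK.isLocBdd_psi ρ).bound R
  obtain ⟨Cγ, hCγ0, hCγ⟩ := hγ.bound R
  have hR0 : 0 ≤ R := abs_nonneg x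
  have hC₁0 : 0 ≤ C₁ := (norm_nonneg _).trans (hC₁ 0 ⟨le_rfl, hR0⟩)
  have hC₂0 : 0 ≤ C₂ := (norm_nonneg _).trans (hC₂ 0 ⟨le_rfl, hR0⟩)
  have hYb : ∀ y, |y| ≤ R → ‖Y y‖ ≤ C₁ + C₂ := by
    intro y hy
    rcases le_total 0 y with h0 | h0
    · rw [hYp y h0]
      have := hC₁ y ⟨h0, (le_abs_self y).trans hy⟩
      linarith
    · rw [← neg_neg y, hYq (-y) (neg_nonneg.2 h0)]
      have := hC₂ (-y) ⟨neg_nonneg.2 h0, (neg_le_abs y).trans hy⟩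
      linarith
  have main : ∀ y, |y| ≤ R → Y y - c * psi K ρ y = 0 := by
    intro y hy
    refine volterra_unique (ι := Unit) (f := fun y _ => Y y - c * psi K ρ y)
      (S := fun y _ => |y| ≤ R) (C := C₁ + C₂ + ‖c‖ * C₃)
      (M := exp (2 * R * |ρ.im|) * Cγ) ?_ ?_ (x := y) (i := ()) hy
    · intro z _ hz
      refine (norm_sub_le _ _).trans (add_le_add (hYb z hz) ?_)
      rw [norm_mul]
      gcongr
      exact hC₃ z hz
    · intro z _ hz
      refine ⟨fun t => -(Complex.exp (Complex.I * ρ * (z - t)) *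
        (γ t * (Y (-t) - c * psi K ρ (-t)))), ?_, fun t ht => ?_⟩
      · have hexp : Continuous fun t : ℝ => Complex.exp (Complex.I * ρ * (z - t)) := by fun_prop
        have hi1 : IntervalIntegrable (fun t : ℝ => Complex.exp (Complex.I * ρ * (z - t)) *
            (γ t * Y (-t))) volume 0 z := by
          -- The case `z = 0` is trivial, and the sign of `z` decides whether `Y (-t)` is a value of
          -- `p` or of `q`.
          by_contra hcon
          have hz0 : z ≠ 0 := by rintro rfl; exact hcon (by simp)
          rcases hz0.lt_or_gt with hlt | hlt
          · refine hcon ?_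
            have h1 : IntervalIntegrable (fun t : ℝ => γ t *
                (Complex.exp (Complex.I * ρ * (z - t)) * p (-t))) volume 0 z := by
              refine (hγ.intervalIntegrable 0 z).mul_continuousOn ?_
              rw [uIcc_of_ge hlt.le]
              exact hexp.continuousOn.mul (hp.comp continuousOn_neg
                fun t ht => neg_nonneg.2 ht.2)
            refine h1.congr fun t ht => ?_
            rw [uIoc_of_ge hlt.le] at ht
            rw [hYp (-t) (neg_nonneg.2 ht.2)]; ring
          · refine hcon ?_
            have h1 : IntervalIntegrable (fun t : ℝ => γ t *
                (Complex.exp (Complex.I * ρ * (z - t)) * q t)) volume 0 z := by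
              refine (hγ.intervalIntegrable 0 z).mul_continuousOn ?_
              rw [uIcc_of_le hlt.le]
              exact hexp.continuousOn.mul (hq.mono fun t ht => ht.1)
            refine h1.congr fun t ht => ?_
            rw [uIoc_of_le hlt.le] at ht
            rw [hYq t ht.1.le]; ring
        have hi2 : IntervalIntegrable (fun t : ℝ => Complex.exp (Complex.I * ρ * (z - t)) *
            (γ t * psi K ρ (-t))) volume 0 z :=
          ((IsLocBdd.of_continuous hexp).mul (hK.isLocBdd_rhs hγ ρ)).intervalIntegrable _ _
        have e : ∀ t : ℝ, -(Complex.exp (Complex.I * ρ * (z - t)) *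
            (γ t * (Y (-t) - c * psi K ρ (-t)))) =
            c * (Complex.exp (Complex.I * ρ * (z - t)) * (γ t * psi K ρ (-t))) -
            Complex.exp (Complex.I * ρ * (z - t)) * (γ t * Y (-t)) := fun t => by ring
        simp only [e]
        rw [intervalIntegral.integral_sub (hi2.const_mul c) hi1,
          intervalIntegral.integral_const_mul, hYeq z, hK.psi_eq hγ ρ z]
        ring
      · have htz := abs_le_of_mem_uIoc ht
        refine ⟨(), by rw [abs_neg]; exact htz.trans hz, ?_⟩
        rw [norm_neg, norm_mul, norm_mul, ← mul_assoc]
        gcongr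
        · have h1 := norm_cexp_I_mul_le (σ := 2 * R) ρ (s := z - t)
            ((abs_sub z t).trans (by linarith))
          rwa [Complex.ofReal_sub] at h1
        · exact hCγ t (htz.trans hz)
  have hxx := main x le_rfl
  have hxn := main (-x) (by rw [abs_neg])
  rw [hYp x hx] at hxx
  rw [hYq x hx] at hxn
  exact ⟨sub_eq_zero.1 hxx, sub_eq_zero.1 hxn⟩

end SpectralFn

/-! ### Gauge factors, and the matrix solutions in terms of the scalar ones. -/

namespace SpectralFn
open Set Function Real

/-- `exp(½ ∫₀ˣ a)`. -/
noncomputable def expHalfIntegral (a : ℝ → ℂ) (x : ℝ) : ℂ :=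
  Complex.exp (1 / 2 * ∫ t in (0 : ℝ)..x, a t)

lemma hasDerivAt_expHalfIntegral {a : ℝ → ℂ} (ha : Continuous a) (x : ℝ) :
    HasDerivAt (expHalfIntegral a) (expHalfIntegral a x * (1 / 2 * a x)) x :=
  ((intervalIntegral.integral_hasDerivAt_right (ha.intervalIntegrable _ _)
    (ha.stronglyMeasurableAtFilter _ _) ha.continuousAt).const_mul (1 / 2 : ℂ)).cexp

lemma continuous_expHalfIntegral {a : ℝ → ℂ} (ha : Continuous a) :
    Continuous (expHalfIntegral a) :=
  continuous_iff_continuousAt.2 fun x => (hasDerivAt_expHalfIntegral ha x).continuousAt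

lemma expHalfIntegral_ne_zero (a : ℝ → ℂ) (x : ℝ) : expHalfIntegral a x ≠ 0 := Complex.exp_ne_zero _

lemma expHalfIntegral_zero (a : ℝ → ℂ) : expHalfIntegral a 0 = 1 := by simp [expHalfIntegral]

/-- `(1, s) P(x) (1, t)ᵀ` for `x ≥ 0`, extended to `x < 0` by its value at `0`. -/
noncomputable def component (P : ℝ → M2) (s t : ℂ) (x : ℝ) : ℂ :=
  P (max x 0) 0 0 + t * P (max x 0) 0 1 + s * P (max x 0) 1 0 + s * t * P (max x 0) 1 1

/-- `exp(½ ∫₀ˣ (1, 1) P (1, 1)ᵀ)`. -/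
noncomputable def gaugePlus (P : ℝ → M2) : ℝ → ℂ := expHalfIntegral (component P 1 1)

/-- `exp(½ ∫₀ˣ (1, -1) P (1, -1)ᵀ)`. -/
noncomputable def gaugeMinus (P : ℝ → M2) : ℝ → ℂ := expHalfIntegral (component P (-1) (-1))

/-- The coefficient of the scalar problem on the line equivalent to the matrix problem. -/
noncomputable def potential (P : ℝ → M2) (κ : ℂ) : ℝ → ℂ :=
  glue (fun x => component P 1 (-1) x * (gaugePlus P x * gaugeMinus P x) / (2 * κ))
    (fun x => κ * component P (-1) 1 x / (2 * (gaugePlus P x * gaugeMinus P x)))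

variable {P : ℝ → M2} {Q : M2} {κ : ℂ} {ℓ m : Fin 2 → ℂ} {K : ℝ → ℝ → ℂ}

lemma continuous_component (hP : ∀ i j, ContinuousOn (fun x => P x i j) (Ici 0)) (s t : ℂ) :
    Continuous (component P s t) := by
  have h : ∀ i j, Continuous fun x : ℝ => P (max x 0) i j := fun i j =>
    (hP i j).comp_continuous (f := fun x : ℝ => max x 0) (by fun_prop) fun x => le_max_right x 0
  exact (((h 0 0).add (continuous_const.mul (h 0 1))).add (continuous_const.mul (h 1 0))).add
    (continuous_const.mul (h 1 1))

lemma gaugePlus_ne_zero (P : ℝ → M2) (x : ℝ) : gaugePlus P x ≠ 0 := expHalfIntegral_ne_zero _ x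

lemma gaugeMinus_ne_zero (P : ℝ → M2) (x : ℝ) : gaugeMinus P x ≠ 0 := expHalfIntegral_ne_zero _ x

lemma continuous_gaugePlus (hP : ∀ i j, ContinuousOn (fun x => P x i j) (Ici 0)) :
    Continuous (gaugePlus P) := continuous_expHalfIntegral (continuous_component hP 1 1)

lemma continuous_gaugeMinus (hP : ∀ i j, ContinuousOn (fun x => P x i j) (Ici 0)) :
    Continuous (gaugeMinus P) := continuous_expHalfIntegral (continuous_component hP (-1) (-1))

lemma isPotential_potential (hP : ∀ i j, ContinuousOn (fun x => P x i j) (Ici 0)) (κ : ℂ) :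
    IsPotential (potential P κ) := by
  have h1 := continuous_gaugePlus hP
  have h2 := continuous_gaugeMinus hP
  have h3 := continuous_component hP 1 (-1)
  have h4 := continuous_component hP (-1) 1
  refine ⟨isLocBdd_glue (by fun_prop) (Continuous.div (by fun_prop) (by fun_prop) fun x => ?_),
    glue_zero _ _⟩
  exact mul_ne_zero two_ne_zero (mul_ne_zero (gaugePlus_ne_zero P x) (gaugeMinus_ne_zero P x))

/-- The solutions of the matrix problem in terms of the solutions of the scalar problem. -/
theorem IsSolution.eq_psi {v : ℝ → M2} {ρ : ℂ}
    (hP : ∀ i j, ContinuousOn (fun x => P x i j) (Ici 0)) (hκ : κ ≠ 0)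
    (hQ : ∀ i j, Q i j = m i * ℓ j) (hm : m 0 + m 1 = 1) (hm' : m 0 - m 1 = κ⁻¹)
    (hK : IsTransmutation (potential P κ) K) (hv : IsSolution P Q (Complex.I * ρ) v)
    {x : ℝ} (hx : 0 ≤ x) (j : Fin 2) :
    v x 0 j + v x 1 j = (gaugePlus P x)⁻¹ * ℓ j * psi K ρ x ∧
      v x 0 j - v x 1 j = κ⁻¹ * gaugeMinus P x * ℓ j * psi K ρ (-x) := by
  obtain ⟨hv0, hvc, hvd⟩ := hv
  have hc : ∀ i, ContinuousOn (fun x => v x i j) (Ici 0) := fun i =>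
    (continuous_id.matrix_elem i j).comp_continuousOn hvc
  have hu := gaugePlus_ne_zero P
  have hw := gaugeMinus_ne_zero P
  have hder : ∀ x, 0 < x →
      HasDerivAt (fun x => v x 0 j + v x 1 j) (Complex.I * ρ * (v x 0 j + v x 1 j) -
        1 / 2 * (component P 1 1 x * (v x 0 j + v x 1 j) +
          component P 1 (-1) x * (v x 0 j - v x 1 j))) x ∧
      HasDerivAt (fun x => v x 0 j - v x 1 j) (-(Complex.I * ρ) * (v x 0 j - v x 1 j) +
        1 / 2 * (component P (-1) 1 x * (v x 0 j + v x 1 j) +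
          component P (-1) (-1) x * (v x 0 j - v x 1 j))) x := by
    intro x hx
    obtain ⟨v', hd, he⟩ := hvd x hx
    have e0 := congrFun (congrFun he 0) j
    have e1 := congrFun (congrFun he 1) j
    simp only [B, Matrix.add_apply, Matrix.mul_apply, Fin.sum_univ_two, Matrix.smul_apply,
      smul_eq_mul, Matrix.of_apply, Matrix.cons_val', Matrix.cons_val_zero, Matrix.cons_val_one,
      Matrix.cons_val_fin_one, zero_mul, one_mul, zero_add, add_zero] at e0 e1
    refine ⟨((hd 0 j).add (hd 1 j)).congr_deriv ?_, ((hd 0 j).sub (hd 1 j)).congr_deriv ?_⟩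
    · simp only [component, max_eq_left hx.le]
      linear_combination e0 + e1
    · simp only [component, max_eq_left hx.le]
      linear_combination e1 - e0
  -- The gauge factors cancel the diagonal coefficients of the system for sum and difference. The
  -- factor `κ` makes both initial values equal to `ℓ j`.
  have key := hK.eq_mul_psi (p := fun x => gaugePlus P x * (v x 0 j + v x 1 j))
    (q := fun x => κ * (gaugeMinus P x)⁻¹ * (v x 0 j - v x 1 j)) (ρ := ρ) (c := ℓ j)
    (isPotential_potential hP κ)
    ((continuous_gaugePlus hP).continuousOn.mul ((hc 0).add (hc 1)))
    ((continuousOn_const.mul ((continuous_gaugeMinus hP).continuousOn.inv₀ fun x _ => hw x)).mul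
      ((hc 0).sub (hc 1)))
    (by simp only [gaugePlus, expHalfIntegral_zero, hv0, hQ]; rw [← add_mul, hm]; ring)
    (by
      simp only [gaugeMinus, expHalfIntegral_zero, hv0, hQ]
      rw [← sub_mul, hm']; field_simp)
    (fun x hx => by
      refine ((hasDerivAt_expHalfIntegral (continuous_component hP 1 1) x).mul
        (hder x hx).1).congr_deriv ?_
      rw [potential, glue_of_pos _ _ hx]
      change gaugePlus P x * _ * _ + gaugePlus P x * _ = _
      have := hw x
      field_simp
      ring)
    (fun x hx => by
      refine ((((hasDerivAt_expHalfIntegral (continuous_component hP (-1) (-1)) x).inv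
        (hw x)).const_mul κ).mul (hder x hx).2).congr_deriv ?_
      rw [potential, glue_neg_of_pos _ _ hx]
      change κ * (-(gaugeMinus P x * _) / gaugeMinus P x ^ 2) * _ +
        κ * (gaugeMinus P x)⁻¹ * _ = _
      have h1 := hw x
      have h2 := hu x
      field_simp
      ring) hx
  have h1 := hw x
  have h2 := hu x
  obtain ⟨k1, k2⟩ := key
  constructor
  · rw [mul_assoc, ← k1]; field_simp
  · rw [mul_assoc, ← k2]; field_simp

/-- The solutions of the adjoint matrix problem in terms of the solutions of the scalar problem. -/
theorem IsAdjSolution.eq_psi {v : ℝ → M2} {ρ : ℂ}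
    (hP : ∀ i j, ContinuousOn (fun x => P x i j) (Ici 0)) (hκ : κ ≠ 0)
    (hQ : ∀ i j, Q i j = m i * ℓ j) (hℓ : ℓ 0 + ℓ 1 = 1) (hℓ' : ℓ 0 - ℓ 1 = κ)
    (hK : IsTransmutation (potential P κ) K) (hv : IsAdjSolution P Q (Complex.I * ρ) v)
    {x : ℝ} (hx : 0 ≤ x) (i : Fin 2) :
    v x i 0 + v x i 1 = gaugePlus P x * m i * psi K ρ (-x) ∧
      v x i 0 - v x i 1 = κ * (gaugeMinus P x)⁻¹ * m i * psi K ρ x := by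
  obtain ⟨hv0, hvc, hvd⟩ := hv
  have hc : ∀ j, ContinuousOn (fun x => v x i j) (Ici 0) := fun j =>
    (continuous_id.matrix_elem i j).comp_continuousOn hvc
  have hu := gaugePlus_ne_zero P
  have hw := gaugeMinus_ne_zero P
  have hder : ∀ x, 0 < x →
      HasDerivAt (fun x => v x i 0 + v x i 1) (-(Complex.I * ρ) * (v x i 0 + v x i 1) +
        1 / 2 * (component P 1 1 x * (v x i 0 + v x i 1) +
          component P (-1) 1 x * (v x i 0 - v x i 1))) x ∧
      HasDerivAt (fun x => v x i 0 - v x i 1) (Complex.I * ρ * (v x i 0 - v x i 1) -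
        1 / 2 * (component P 1 (-1) x * (v x i 0 + v x i 1) +
          component P (-1) (-1) x * (v x i 0 - v x i 1))) x := by
    intro x hx
    obtain ⟨v', hd, he⟩ := hvd x hx
    have e0 := congrFun (congrFun he i) 0
    have e1 := congrFun (congrFun he i) 1
    simp only [B, Matrix.add_apply, Matrix.neg_apply, Matrix.mul_apply, Fin.sum_univ_two,
      Matrix.smul_apply, smul_eq_mul, Matrix.of_apply, Matrix.cons_val', Matrix.cons_val_zero,
      Matrix.cons_val_one, Matrix.cons_val_fin_one, mul_zero, mul_one, zero_add, add_zero] at e0 e1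
    refine ⟨((hd i 0).add (hd i 1)).congr_deriv ?_, ((hd i 0).sub (hd i 1)).congr_deriv ?_⟩
    · simp only [component, max_eq_left hx.le]
      linear_combination -e0 - e1
    · simp only [component, max_eq_left hx.le]
      linear_combination e0 - e1
  -- For the adjoint equation the inverse gauge factors are needed and the roles are exchanged: the
  -- difference carries `Ψ(x)`, the sum `Ψ(-x)`. With this choice the coefficient is the same
  -- `potential P κ`.
  have key := hK.eq_mul_psi (p := fun x => κ⁻¹ * gaugeMinus P x * (v x i 0 - v x i 1))
    (q := fun x => (gaugePlus P x)⁻¹ * (v x i 0 + v x i 1)) (ρ := ρ) (c := m i)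
    (isPotential_potential hP κ)
    ((continuousOn_const.mul (continuous_gaugeMinus hP).continuousOn).mul ((hc 0).sub (hc 1)))
    (((continuous_gaugePlus hP).continuousOn.inv₀ fun x _ => hu x).mul ((hc 0).add (hc 1)))
    (by
      simp only [gaugeMinus, expHalfIntegral_zero, hv0, hQ]
      rw [← mul_sub, hℓ']; field_simp)
    (by simp only [gaugePlus, expHalfIntegral_zero, hv0, hQ]; rw [← mul_add, hℓ]; simp)
    (fun x hx => by
      refine (((hasDerivAt_expHalfIntegral (continuous_component hP (-1) (-1)) x).const_mul
        κ⁻¹).mul (hder x hx).2).congr_deriv ?_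
      rw [potential, glue_of_pos _ _ hx]
      change κ⁻¹ * (gaugeMinus P x * _) * _ + κ⁻¹ * gaugeMinus P x * _ = _
      have := hu x
      field_simp
      ring)
    (fun x hx => by
      refine (((hasDerivAt_expHalfIntegral (continuous_component hP 1 1) x).inv
        (hu x)).mul (hder x hx).1).congr_deriv ?_
      rw [potential, glue_neg_of_pos _ _ hx]
      change -(gaugePlus P x * _) / gaugePlus P x ^ 2 * _ + (gaugePlus P x)⁻¹ * _ = _
      have h1 := hw x
      have h2 := hu x
      field_simp
      ring) hx
  have h1 := hw x
  have h2 := hu x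
  obtain ⟨k1, k2⟩ := key
  constructor
  · rw [mul_assoc, ← k2]; field_simp
  · rw [mul_assoc, ← k1]; field_simp

/-- The projections `Q` with `QB + BQ = B` have rank one. -/
lemma exists_rankOne (hQB : Q * B + B * Q = B) (hQ : Q * Q = Q) :
    ∃ (κ : ℂ) (ℓ m : Fin 2 → ℂ), κ ≠ 0 ∧ (∀ i j, Q i j = m i * ℓ j) ∧ m 0 + m 1 = 1 ∧
      m 0 - m 1 = κ⁻¹ ∧ ℓ 0 + ℓ 1 = 1 ∧ ℓ 0 - ℓ 1 = κ := by
  have h00 := congrFun (congrFun hQB 0) 0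
  have h01 := congrFun (congrFun hQB 0) 1
  have g00 := congrFun (congrFun hQ 0) 0
  simp only [B, Matrix.add_apply, Matrix.mul_apply, Fin.sum_univ_two, Matrix.of_apply,
    Matrix.cons_val', Matrix.cons_val_zero, Matrix.cons_val_one, Matrix.cons_val_fin_one,
    zero_mul, one_mul, mul_zero, mul_one, zero_add, add_zero] at h00 h01 g00
  have e1 : Q 1 0 = -Q 0 1 := by linear_combination h00
  have e2 : Q 1 1 = 1 - Q 0 0 := by linear_combination h01
  rw [e1] at g00
  -- The factors are `ℓ 0 - ℓ 1` and `m 0 - m 1` for the vectors below; `Q * Q = Q` makes them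
  -- inverse to each other.
  have hk : (2 * Q 0 0 - 2 * Q 0 1 - 1) * (2 * Q 0 0 + 2 * Q 0 1 - 1) = 1 := by
    linear_combination 4 * g00
  have hκ : 2 * Q 0 0 - 2 * Q 0 1 - 1 ≠ 0 := left_ne_zero_of_mul_eq_one hk
  refine ⟨2 * Q 0 0 - 2 * Q 0 1 - 1, ![Q 0 0 - Q 0 1, Q 0 1 + 1 - Q 0 0],
    ![Q 0 0 + Q 0 1, 1 - Q 0 0 - Q 0 1], hκ, fun i j => ?_, ?_, ?_, ?_, ?_⟩
  · fin_cases i <;> fin_cases j <;> simp [e1, e2]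
    · linear_combination -g00
    · linear_combination g00
    · linear_combination g00
    · linear_combination -g00
  · simp
  · refine eq_inv_of_mul_eq_one_left ?_
    simp only [Matrix.cons_val_zero, Matrix.cons_val_one, Matrix.cons_val_fin_one]
    linear_combination hk
  · simp
  · simp; ring

end SpectralFn

/-! ### The matrix transforms as scalar spectral transforms. -/

namespace SpectralFn
open Set Function Real

variable {P : ℝ → M2} {Q : M2} {κ ρ : ℂ} {ℓ m : Fin 2 → ℂ} {K H : ℝ → ℝ → ℂ} {σ τ : ℝ}
  {φ φt : ℂ → ℝ → M2} {f g : ℝ → M2}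

/-- The `i`-th row of `f` as a function on the line. -/
noncomputable def lineRow (P : ℝ → M2) (κ : ℂ) (f : ℝ → M2) (i : Fin 2) (x : ℝ) : ℂ :=
  glue (fun x => f x i 0 + f x i 1) (fun x => f x i 0 - f x i 1) x *
    glue (fun x => (gaugePlus P x)⁻¹ / 2) (fun x => κ⁻¹ * gaugeMinus P x / 2) x

/-- The `j`-th column of `g` as a function on the line. -/
noncomputable def lineCol (P : ℝ → M2) (κ : ℂ) (g : ℝ → M2) (j : Fin 2) (x : ℝ) : ℂ :=
  glue (fun x => g x 0 j - g x 1 j) (fun x => g x 0 j + g x 1 j) x *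
    glue (fun x => κ * (gaugeMinus P x)⁻¹ / 2) (fun x => gaugePlus P x / 2) x

lemma lineRow_of_pos (f : ℝ → M2) (i : Fin 2) {x : ℝ} (hx : 0 < x) :
    lineRow P κ f i x = (f x i 0 + f x i 1) * ((gaugePlus P x)⁻¹ / 2) := by
  rw [lineRow, glue_of_pos _ _ hx, glue_of_pos _ _ hx]

lemma lineRow_neg_of_pos (f : ℝ → M2) (i : Fin 2) {x : ℝ} (hx : 0 < x) :
    lineRow P κ f i (-x) = (f x i 0 - f x i 1) * (κ⁻¹ * gaugeMinus P x / 2) := by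
  rw [lineRow, glue_neg_of_pos _ _ hx, glue_neg_of_pos _ _ hx]

lemma lineCol_of_pos (g : ℝ → M2) (j : Fin 2) {x : ℝ} (hx : 0 < x) :
    lineCol P κ g j x = (g x 0 j - g x 1 j) * (κ * (gaugeMinus P x)⁻¹ / 2) := by
  rw [lineCol, glue_of_pos _ _ hx, glue_of_pos _ _ hx]

lemma lineCol_neg_of_pos (g : ℝ → M2) (j : Fin 2) {x : ℝ} (hx : 0 < x) :
    lineCol P κ g j (-x) = (g x 0 j + g x 1 j) * (gaugePlus P x / 2) := by
  rw [lineCol, glue_neg_of_pos _ _ hx, glue_neg_of_pos _ _ hx]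

lemma isL2On_lineRow (hP : ∀ i j, ContinuousOn (fun x => P x i j) (Ici 0)) (hf : IsL2 f)
    (hfs : ∀ x, σ < x → f x = 0) (i : Fin 2) : IsL2On (lineRow P κ f i) σ := by
  refine (isL2On_glue ((hf i 0).add (hf i 1)) ((hf i 0).sub (hf i 1)) (fun x hx => ?_)
    fun x hx => ?_).mul_isLocBdd (isLocBdd_glue ?_ ?_)
  · simp [hfs x hx]
  · simp [hfs x hx]
  · exact ((continuous_gaugePlus hP).inv₀ (gaugePlus_ne_zero P)).div_const 2
  · exact (continuous_const.mul (continuous_gaugeMinus hP)).div_const 2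

lemma isL2On_lineCol (hP : ∀ i j, ContinuousOn (fun x => P x i j) (Ici 0)) (hg : IsL2 g)
    (hgs : ∀ x, σ < x → g x = 0) (j : Fin 2) : IsL2On (lineCol P κ g j) σ := by
  refine (isL2On_glue ((hg 0 j).sub (hg 1 j)) ((hg 0 j).add (hg 1 j)) (fun x hx => ?_)
    fun x hx => ?_).mul_isLocBdd (isLocBdd_glue ?_ ?_)
  · simp [hgs x hx]
  · simp [hgs x hx]
  · exact (continuous_const.mul ((continuous_gaugeMinus hP).inv₀ (gaugeMinus_ne_zero P))).div_const 2
  · exact (continuous_gaugePlus hP).div_const 2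

/-- The gauge factors and `κ` cancel between `lineRow` at `x` and `lineCol` at `-x`. Each carries `1
/ 2`, while `(a + b)(c + d) + (a - b)(c - d) = 2(ac + bd)`; this leaves the factor `2`. -/
lemma two_mul_integral_lineRow_mul_lineCol (hκ : κ ≠ 0) {i j : Fin 2}
    (hF : IsL2On (lineRow P κ f i) σ) (hG : IsL2On (lineCol P κ g j) τ) :
    2 * ∫ x, lineRow P κ f i x * lineCol P κ g j (-x) =
      halfLineIntegral (fun x => f x * g x) i j := by
  have hi : Integrable fun x => lineRow P κ f i x * lineCol P κ g j (-x) :=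
    hF.memLp.integrable_mul (hG.memLp.comp_measurePreserving (Measure.measurePreserving_neg volume))
  rw [integral_eq_integral_Ioi_add_neg hi, ← integral_const_mul]
  refine setIntegral_congr_fun measurableSet_Ioi fun x hx => ?_
  have hu := gaugePlus_ne_zero P x
  have hw := gaugeMinus_ne_zero P x
  simp only [neg_neg, lineRow_of_pos f i hx, lineRow_neg_of_pos f i hx, lineCol_of_pos g j hx,
    lineCol_neg_of_pos g j hx, Matrix.mul_apply, Fin.sum_univ_two]
  field_simp
  ring

/-- The product `f φ` is expanded in sums and differences of components; the terms with `Ψ(-x)`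
become the part of the integral over the negative half line. -/
theorem Phi_eq (hP : ∀ i j, ContinuousOn (fun x => P x i j) (Ici 0)) (hκ : κ ≠ 0)
    (hQ : ∀ i j, Q i j = m i * ℓ j) (hm : m 0 + m 1 = 1) (hm' : m 0 - m 1 = κ⁻¹)
    (hK : IsTransmutation (potential P κ) K) (hφ : ∀ lam : ℂ, IsSolution P Q lam (φ lam))
    {i : Fin 2} (hF : IsL2On (lineRow P κ f i) σ) (j : Fin 2) :
    Phi φ f ρ i j = spectral K (lineRow P κ f i) ρ * ℓ j := by
  rw [spectral, integral_eq_integral_Ioi_add_neg (integrable_mul_of_isLocBdd hF.integrable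
    hF.support (hK.isLocBdd_psi ρ)), ← integral_mul_const]
  refine setIntegral_congr_fun measurableSet_Ioi fun x hx => ?_
  obtain ⟨h1, h2⟩ := (hφ (Complex.I * ρ)).eq_psi hP hκ hQ hm hm' hK (mem_Ioi.1 hx).le j
  simp only [lineRow_of_pos f i hx, lineRow_neg_of_pos f i hx, Matrix.mul_apply, Fin.sum_univ_two]
  linear_combination (f x i 0 + f x i 1) / 2 * h1 + (f x i 0 - f x i 1) / 2 * h2

theorem PhiTilde_eq (hP : ∀ i j, ContinuousOn (fun x => P x i j) (Ici 0)) (hκ : κ ≠ 0)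
    (hQ : ∀ i j, Q i j = m i * ℓ j) (hℓ : ℓ 0 + ℓ 1 = 1) (hℓ' : ℓ 0 - ℓ 1 = κ)
    (hK : IsTransmutation (potential P κ) K) (hφt : ∀ lam : ℂ, IsAdjSolution P Q lam (φt lam))
    {j : Fin 2} (hG : IsL2On (lineCol P κ g j) σ) (i : Fin 2) :
    PhiTilde φt g ρ i j = m i * spectral K (lineCol P κ g j) ρ := by
  rw [spectral, integral_eq_integral_Ioi_add_neg (integrable_mul_of_isLocBdd hG.integrable
    hG.support (hK.isLocBdd_psi ρ)), ← integral_const_mul]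
  refine setIntegral_congr_fun measurableSet_Ioi fun x hx => ?_
  obtain ⟨h1, h2⟩ := (hφt (Complex.I * ρ)).eq_psi hP hκ hQ hℓ hℓ' hK (mem_Ioi.1 hx).le i
  simp only [lineCol_of_pos g j hx, lineCol_neg_of_pos g j hx, Matrix.mul_apply, Fin.sum_univ_two]
  linear_combination (g x 0 j + g x 1 j) / 2 * h1 + (g x 0 j - g x 1 j) / 2 * h2

/-- `IsL2On` requires vanishing everywhere outside an interval, whereas `IsK2` grants it almost
everywhere. -/
lemma IsK2.exists_ae_eq (hf : IsK2 f) : ∃ (f₁ : ℝ → M2) (σ : ℝ),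
    f =ᵐ[volume.restrict (Ioi 0)] f₁ ∧ IsL2 f₁ ∧ ∀ x, σ < x → f₁ x = 0 := by
  obtain ⟨hf, σ, hσ, hs⟩ := hf
  have h : f =ᵐ[volume.restrict (Ioi 0)] (Iic σ).indicator f := by
    filter_upwards [hs] with x hx
    rcases le_or_gt x σ with h | h
    · rw [indicator_of_mem (mem_Iic.2 h)]
    · rw [indicator_of_notMem (notMem_Iic.2 h), hx h]
  refine ⟨(Iic σ).indicator f, σ, h, fun i j => ?_, fun x hx => indicator_of_notMem (notMem_Iic.2 hx) f⟩
  refine (memLp_congr_ae ?_).1 (hf i j)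
  filter_upwards [h] with x hx
  rw [hx]

lemma halfLineIntegral_congr (h : f =ᵐ[volume.restrict (Ioi 0)] g) :
    halfLineIntegral f = halfLineIntegral g := by
  ext i j
  refine integral_congr_ae ?_
  filter_upwards [h] with x hx
  rw [hx]

lemma Phi_congr (φ : ℂ → ℝ → M2) (h : f =ᵐ[volume.restrict (Ioi 0)] g) : Phi φ f = Phi φ g := by
  ext1 ρ
  refine halfLineIntegral_congr ?_
  filter_upwards [h] with x hx
  rw [hx]

lemma PhiTilde_congr (φt : ℂ → ℝ → M2) (h : f =ᵐ[volume.restrict (Ioi 0)] g) :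
    PhiTilde φt f = PhiTilde φt g := by
  ext1 ρ
  refine halfLineIntegral_congr ?_
  filter_upwards [h] with x hx
  rw [hx]

/-- Matrices of distributions of rank one. -/
lemma hasDistIntegral_of_rankOne (d : ZDual) {A C : ℂ → M2} {M : M2} {α β : Fin 2 → ℂ → ℂ}
    (hℓm : ℓ 0 * m 0 + ℓ 1 * m 1 = 1) (hA : ∀ ρ i k, A ρ i k = α i ρ * ℓ k)
    (hC : ∀ ρ l j, C ρ l j = m l * β j ρ) (hZ : ∀ i j, (fun ρ => α i ρ * β j ρ) ∈ Z)
    (hM : ∀ i j, M i j = (d : Z →ₗ[ℂ] ℂ) ⟨_, hZ i j⟩) :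
    HasDistIntegral (Matrix.of fun k l => (m k * ℓ l) • d) A C M := by
  have e : ∀ i k l j, (fun ρ => A ρ i k * C ρ l j) = (ℓ k * m l) • fun ρ => α i ρ * β j ρ := by
    intro i k l j
    ext ρ
    rw [hA, hC, Pi.smul_apply, smul_eq_mul]
    ring
  have h : ∀ i k l j, (fun ρ => A ρ i k * C ρ l j) ∈ Z := fun i k l j => by
    rw [e]; exact Z.smul_mem _ (hZ i j)
  refine ⟨h, fun i j => ?_⟩
  have e' : ∀ k l, (⟨_, h i k l j⟩ : Z) = (ℓ k * m l) • ⟨_, hZ i j⟩ := fun k l =>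
    Subtype.ext (e i k l j)
  simp only [e', map_smul, Matrix.of_apply, Submodule.coe_smul, LinearMap.smul_apply, smul_eq_mul,
    Fin.sum_univ_two, hM i j]
  -- The double sum contributes the factor `(ℓ · m)² = 1`.
  linear_combination (-(ℓ 0 * m 0 + ℓ 1 * m 1) - 1) * (d : Z →ₗ[ℂ] ℂ) ⟨_, hZ i j⟩ * hℓm

lemma sandwich_rankOne (d : ZDual) (hQ : ∀ i j, Q i j = m i * ℓ j)
    (hℓm : ℓ 0 * m 0 + ℓ 1 * m 1 = 1) :
    (Matrix.of fun k l => (m k * ℓ l) • d : Matrix (Fin 2) (Fin 2) ZDual) =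
      sandwich Q (Matrix.of fun k l => (m k * ℓ l) • d) := by
  ext1 i j
  simp only [sandwich, Matrix.of_apply, Fin.sum_univ_two, hQ, smul_smul, ← add_smul]
  congr 1
  linear_combination (-(ℓ 0 * m 0 + ℓ 1 * m 1) - 1) * m i * ℓ j * hℓm

/-- The integral is the `L²` inner product of `star b` and `a`, which is jointly continuous. -/
lemma tendsto_integral_mul {X : Type*} [MeasurableSpace X] {μ : Measure X} {f g : X → ℂ}
    {fn gn : ℕ → X → ℂ} (hf : MemLp f 2 μ) (hg : MemLp g 2 μ) (hfn : ∀ n, MemLp (fn n) 2 μ)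
    (hgn : ∀ n, MemLp (gn n) 2 μ)
    (hfl : Tendsto (fun n => eLpNorm (fun x => fn n x - f x) 2 μ) atTop (𝓝 0))
    (hgl : Tendsto (fun n => eLpNorm (fun x => gn n x - g x) 2 μ) atTop (𝓝 0)) :
    Tendsto (fun n => ∫ x, fn n x * gn n x ∂μ) atTop (𝓝 (∫ x, f x * g x ∂μ)) := by
  have key : ∀ {a b : X → ℂ} (ha : MemLp a 2 μ) (hb : MemLp b 2 μ),
      inner ℂ (hb.star.toLp (star b)) (ha.toLp a) = ∫ x, a x * b x ∂μ := by
    intro a b ha hb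
    rw [L2.inner_def]
    refine integral_congr_ae ?_
    filter_upwards [ha.coeFn_toLp, hb.star.coeFn_toLp] with x h1 h2
    rw [h1, h2]
    simp
  have h1 := (Lp.tendsto_Lp_iff_tendsto_eLpNorm'' fn hfn f hf).2 hfl
  have h2 := (Lp.tendsto_Lp_iff_tendsto_eLpNorm'' (fun n => star (gn n)) (fun n => (hgn n).star)
    (star g) hg.star).2 (by
      refine hgl.congr fun n => eLpNorm_congr_norm_ae (Eventually.of_forall fun x => ?_)
      simp only [Pi.sub_apply, Pi.star_apply, ← star_sub, norm_star])
  rw [← key hf hg]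
  exact (h2.inner (𝕜 := ℂ) h1).congr fun n => key (hfn n) (hgn n)

lemma tendsto_halfLineIntegral_mul {fn gn : ℕ → ℝ → M2} (hf : IsL2 f) (hg : IsL2 g)
    (hfn : ∀ n, IsL2 (fn n)) (hgn : ∀ n, IsL2 (gn n)) (hfl : L2Converges fn f)
    (hgl : L2Converges gn g) :
    Tendsto (fun n => halfLineIntegral fun x => fn n x * gn n x) atTop
      (𝓝 (halfLineIntegral fun x => f x * g x)) := by
  have e : ∀ {a b : ℝ → M2}, IsL2 a → IsL2 b → ∀ i j,
      halfLineIntegral (fun x => a x * b x) i j = (∫ x in Ioi (0 : ℝ), a x i 0 * b x 0 j) +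
        ∫ x in Ioi (0 : ℝ), a x i 1 * b x 1 j := by
    intro a b ha hb i j
    have h := integral_add ((ha i 0).integrable_mul (hb 0 j)) ((ha i 1).integrable_mul (hb 1 j))
    simp only [Pi.mul_apply] at h
    rw [← h]
    simp only [halfLineIntegral, Matrix.of_apply, Matrix.mul_apply, Fin.sum_univ_two]
  refine tendsto_pi_nhds.2 fun i => tendsto_pi_nhds.2 fun j => ?_
  simp only [e hf hg, e (hfn _) (hgn _)]
  exact (tendsto_integral_mul (hf i 0) (hg 0 j) (fun n => hfn n i 0) (fun n => hgn n 0 j)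
    (hfl i 0) (hgl 0 j)).add (tendsto_integral_mul (hf i 1) (hg 1 j) (fun n => hfn n i 1)
      (fun n => hgn n 1 j) (hfl i 1) (hgl 1 j))

end SpectralFn

/-! ### The matrix of distributions and the proof of the theorem. -/

open SpectralFn
theorem theorem2 (P : ℝ → M2)
    (hP : ∀ i j, ContDiffOn ℝ 1 (fun x => P x i j) (Set.Ici 0))
    (Q : M2) (hQB : Q * B + B * Q = B) (hQ : Q * Q = Q)
    (φ φt : ℂ → ℝ → M2)
    (hφ : ∀ lam : ℂ, IsSolution P Q lam (φ lam))
    (hφt : ∀ lam : ℂ, IsAdjSolution P Q lam (φt lam)) :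
    ∃ D : Matrix (Fin 2) (Fin 2) ZDual,
      D = sandwich Q D ∧
      -- the Parseval equality for compactly supported square integrable functions
      (∀ f g : ℝ → M2, IsK2 f → IsK2 g →
        HasDistIntegral D (Phi φ f) (PhiTilde φt g) (halfLineIntegral fun x => f x * g x)) ∧
      -- the Parseval equality for all of `L²`, the right-hand side being understood as a limit
      (∀ f g : ℝ → M2, IsL2 f → IsL2 g →
        ∀ fn gn : ℕ → ℝ → M2, (∀ n, IsK2 (fn n)) → (∀ n, IsK2 (gn n)) →
          L2Converges fn f → L2Converges gn g →
          ∃ T : ℕ → M2,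
            (∀ n, HasDistIntegral D (Phi φ (fn n)) (PhiTilde φt (gn n)) (T n)) ∧
            Tendsto T atTop (𝓝 (halfLineIntegral fun x => f x * g x))) ∧
      -- the expansion formulas
      (∀ f : ℝ → M2, IsK2 f →
        (∀ i j, (fun ρ => Phi φ f ρ i j) ∈ Z) → (∀ i j, (fun ρ => PhiTilde φt f ρ i j) ∈ Z) →
        ∀ᵐ x ∂(volume.restrict (Set.Ioi (0 : ℝ))),
          HasDistIntegral D (Phi φ f) (fun ρ => φt (Complex.I * ρ) x) (f x) ∧
          HasDistIntegral D (fun ρ => φ (Complex.I * ρ) x) (PhiTilde φt f) (f x)) := by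
  have hPc : ∀ i j, ContinuousOn (fun x => P x i j) (Set.Ici 0) := fun i j => (hP i j).continuousOn
  obtain ⟨κ, ℓ, m, hκ, hQm, hm, hm', hℓ, hℓ'⟩ := exists_rankOne hQB hQ
  have hℓm : ℓ 0 * m 0 + ℓ 1 * m 1 = 1 := by
    have h1 : (ℓ 0 - ℓ 1) * (m 0 - m 1) = 1 := by rw [hℓ', hm', mul_inv_cancel₀ hκ]
    have h2 : (ℓ 0 + ℓ 1) * (m 0 + m 1) = 1 := by rw [hℓ, hm, one_mul]
    linear_combination (h1 + h2) / 2
  have hγ := isPotential_potential hPc κ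
  obtain ⟨K, hK⟩ := exists_transmutation hγ
  obtain ⟨H, hH⟩ := exists_inverseTransmutation hγ
  -- The factor `2` compensates the halves in `lineRow` and `lineCol`.
  set d : ZDual := (2 : ℂ) • ⟨distLinear hH.toIsConeKernel, distLinear_mem_ZDual _⟩ with hd
  have hdapply : ∀ e : Z, (d : Z →ₗ[ℂ] ℂ) e = 2 * SpectralFn.dist H e := fun e => rfl
  have hparseval : ∀ f g : ℝ → M2, IsK2 f → IsK2 g →
      HasDistIntegral (Matrix.of fun k l => (m k * ℓ l) • d) (Phi φ f) (PhiTilde φt g)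
        (halfLineIntegral fun x => f x * g x) := by
    intro f g hf hg
    obtain ⟨f₁, σ, hff, hf₁, hfs⟩ := hf.exists_ae_eq
    obtain ⟨g₁, τ, hgg, hg₁, hgs⟩ := hg.exists_ae_eq
    have hF := fun i => (isL2On_lineRow (κ := κ) hPc hf₁ hfs i).mono (le_max_left σ τ)
    have hG := fun j => (isL2On_lineCol (κ := κ) hPc hg₁ hgs j).mono (le_max_right σ τ)
    rw [Phi_congr φ hff, PhiTilde_congr φt hgg, halfLineIntegral_congr
      (show (fun x => f x * g x) =ᵐ[volume.restrict (Set.Ioi 0)] fun x => f₁ x * g₁ x from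
        hff.mul hgg)]
    refine hasDistIntegral_of_rankOne d hℓm
      (fun ρ i k => Phi_eq hPc hκ hQm hm hm' hK hφ (hF i) k)
      (fun ρ l j => PhiTilde_eq hPc hκ hQm hℓ hℓ' hK hφt (hG j) l)
      (fun i j => (hF i).spectral_mul_spectral_mem_Z hK.toIsConeKernel (hG j)) fun i j => ?_
    rw [hdapply, (hF i).dist_spectral_mul_spectral hγ hK hH (hG j),
      two_mul_integral_lineRow_mul_lineCol hκ (hF i) (hG j)]
  refine ⟨Matrix.of fun k l => (m k * ℓ l) • d, sandwich_rankOne d hQm hℓm, hparseval,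
    fun f g hf hg fn gn hfn hgn hfl hgl => ⟨fun n => halfLineIntegral fun x => fn n x * gn n x,
      fun n => hparseval _ _ (hfn n) (hgn n), tendsto_halfLineIntegral_mul hf hg
        (fun n => (hfn n).1) (fun n => (hgn n).1) hfl hgl⟩, fun f hf hΦ hΦt => ?_⟩
  obtain ⟨f₁, σ, hff, hf₁, hfs⟩ := hf.exists_ae_eq
  have hF := fun i => isL2On_lineRow (κ := κ) hPc hf₁ hfs i
  have hG := fun j => isL2On_lineCol (κ := κ) hPc hf₁ hfs j
  rw [Phi_congr φ hff] at hΦ ⊢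
  rw [PhiTilde_congr φt hff] at hΦt ⊢
  have hΦe := fun ρ i k => Phi_eq (ρ := ρ) hPc hκ hQm hm hm' hK hφ (hF i) k
  have hΦte := fun ρ l j => PhiTilde_eq (ρ := ρ) hPc hκ hQm hℓ hℓ' hK hφt (hG j) l
  -- The entries of `Φ_f` are multiples of the scalar transform by `ℓ 0` and `ℓ 1`; as `ℓ 0 + ℓ 1 =
  -- 1`, their sum recovers it.
  have hFZ : ∀ i, spectral K (lineRow P κ f₁ i) ∈ Z := fun i => by
    have h := Z.add_mem (hΦ i 0) (hΦ i 1)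
    convert h using 1
    ext ρ
    simp only [Pi.add_apply, hΦe]
    rw [← mul_add, hℓ, mul_one]
  have hGZ : ∀ j, spectral K (lineCol P κ f₁ j) ∈ Z := fun j => by
    have h := Z.add_mem (hΦt 0 j) (hΦt 1 j)
    convert h using 1
    ext ρ
    simp only [Pi.add_apply, hΦte]
    rw [← add_mul, hm, one_mul]
  have hrow := ae_all_iff.2 fun i => (hF i).dist_spectral_mul_psi hγ hK hH (hFZ i)
  have hcol := ae_all_iff.2 fun j => (hG j).dist_spectral_mul_psi hγ hK hH (hGZ j)
  have hneg := (Measure.measurePreserving_neg (volume : Measure ℝ)).quasiMeasurePreserving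
  -- The scalar expansion is needed at both `x` and `-x`, hence the reflected almost-everywhere
  -- statements.
  filter_upwards [ae_restrict_of_ae hrow, ae_restrict_of_ae (hneg.ae hrow),
    ae_restrict_of_ae hcol, ae_restrict_of_ae (hneg.ae hcol), ae_restrict_mem measurableSet_Ioi,
    hff] with x r1 r2 c1 c2 hx hfx
  rw [hfx]
  have hx0 : 0 < x := hx
  have hu := gaugePlus_ne_zero P x
  have hw := gaugeMinus_ne_zero P x
  have hcone := hK.toIsConeKernel
  simp only [neg_neg] at r2 c2
  -- the action of the functional on combinations of `Ψ(x)` and `Ψ(-x)`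
  have hcomb : ∀ (e : ℂ → ℂ) (he : e ∈ Z) (a b : ℂ),
      (fun ρ => e ρ * (a * psi K ρ x + b * psi K ρ (-x))) ∈ Z ∧
      SpectralFn.dist H (fun ρ => e ρ * (a * psi K ρ x + b * psi K ρ (-x))) =
        a * SpectralFn.dist H (fun ρ => e ρ * psi K ρ x) +
        b * SpectralFn.dist H (fun ρ => e ρ * psi K ρ (-x)) := by
    intro e he a b
    have e1 : (fun ρ => e ρ * (a * psi K ρ x + b * psi K ρ (-x))) =
        fun ρ => a * (e ρ * psi K ρ x) + b * (e ρ * psi K ρ (-x)) := by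
      ext ρ; ring
    have z1 : (fun ρ => a * (e ρ * psi K ρ x)) ∈ Z := Z.smul_mem a (hcone.mul_psi_mem_Z he x)
    have z2 : (fun ρ => b * (e ρ * psi K ρ (-x))) ∈ Z := Z.smul_mem b (hcone.mul_psi_mem_Z he (-x))
    rw [e1, hH.dist_add (e := fun ρ => a * (e ρ * psi K ρ x)) z1 z2, dist_const_mul, dist_const_mul]
    exact ⟨Z.add_mem z1 z2, rfl⟩
  constructor
  -- Here `β j` is half the sum or half the difference of the two combinations in
  -- `IsAdjSolution.eq_psi`, with the factor `m l` removed; the entry of `![1, -1]` selects the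
  -- sign.
  · refine hasDistIntegral_of_rankOne d hℓm hΦe (β := fun j ρ =>
      ![1, -1] j * (κ * (gaugeMinus P x)⁻¹ / 2) * psi K ρ x + gaugePlus P x / 2 * psi K ρ (-x))
      (fun ρ l j => ?_) (fun i j => (hcomb _ (hFZ i) _ _).1) fun i j => ?_
    · obtain ⟨h1, h2⟩ := (hφt (Complex.I * ρ)).eq_psi hPc hκ hQm hℓ hℓ' hK hx0.le l
      fin_cases j
      · simp only [Fin.zero_eta, Matrix.cons_val_zero]
        linear_combination (h1 + h2) / 2
      · simp only [Fin.mk_one, Matrix.cons_val_one, Matrix.cons_val_fin_one]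
        linear_combination (h1 - h2) / 2
    · rw [hdapply, (hcomb _ (hFZ i) _ _).2, r1 i, r2 i, lineRow_neg_of_pos _ _ hx0,
        lineRow_of_pos _ _ hx0]
      fin_cases j
      · simp only [Fin.zero_eta, Matrix.cons_val_zero]
        field_simp
        ring
      · simp only [Fin.mk_one, Matrix.cons_val_one, Matrix.cons_val_fin_one]
        field_simp
        ring
  · have hcomm : ∀ i j, (fun ρ => ((gaugePlus P x)⁻¹ / 2 * psi K ρ x +
        ![1, -1] i * (κ⁻¹ * gaugeMinus P x / 2) * psi K ρ (-x)) *
          spectral K (lineCol P κ f₁ j) ρ) = fun ρ => spectral K (lineCol P κ f₁ j) ρ *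
        ((gaugePlus P x)⁻¹ / 2 * psi K ρ x +
          ![1, -1] i * (κ⁻¹ * gaugeMinus P x / 2) * psi K ρ (-x)) := fun i j =>
      funext fun ρ => mul_comm _ _
    refine hasDistIntegral_of_rankOne d hℓm (α := fun i ρ => (gaugePlus P x)⁻¹ / 2 * psi K ρ x +
      ![1, -1] i * (κ⁻¹ * gaugeMinus P x / 2) * psi K ρ (-x)) (fun ρ i k => ?_) hΦte
      (fun i j => by rw [hcomm]; exact (hcomb _ (hGZ j) _ _).1) fun i j => ?_
    · obtain ⟨h1, h2⟩ := (hφ (Complex.I * ρ)).eq_psi hPc hκ hQm hm hm' hK hx0.le k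
      fin_cases i
      · simp only [Fin.zero_eta, Matrix.cons_val_zero]
        linear_combination (h1 + h2) / 2
      · simp only [Fin.mk_one, Matrix.cons_val_one, Matrix.cons_val_fin_one]
        linear_combination (h1 - h2) / 2
    · rw [hdapply]
      simp only [hcomm]
      rw [(hcomb _ (hGZ j) _ _).2, c1 j, c2 j, lineCol_neg_of_pos _ _ hx0, lineCol_of_pos _ _ hx0]
      fin_cases i
      · simp only [Fin.zero_eta, Matrix.cons_val_zero]
        field_simp
        ring
      · simp only [Fin.mk_one, Matrix.cons_val_one, Matrix.cons_val_fin_one]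
        field_simp
        ring
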